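/- Let $k$ be an algebraically closed field of characteristic $0$, $\theta\in\mathbb N$, and let $\Lambda$ be the free abelian group with basis $\alpha_1,\dots,\alpha_\theta$, ordered by $\lambda\le\mu\iff\mu-\lambda\in\sum_i\mathbb N_0\alpha_i$. Let $(q_{ij})_{1\le i,j\le\theta}$ be a symmetric matrix with entries in $k^\times$, let $V$ (resp. $W$) be the braided vector space of diagonal type with basis $v_1,\dots,v_\theta$ and matrix $(q_{ij})$ (resp. $w_1,\dots,w_\theta$ and $(q_{ij}^{-1})$), and let $\mathcal B(V)=T(V)/\mathcal J(V)$, $\mathcal B(W)=T(W)/\mathcal J(W)$ be their Nichols algebras, where $\mathcal J$ denotes the largest homogeneous Hopf ideal that is generated in degrees $\ge 2$ and is a Yetter–Drinfeld submodule. Assume that $\dim\mathcal B(V)<\infty$, grade $\mathcal B(V)$ by $\Lambda$ with $\deg v_i=\alpha_i$, and let $\varrho\in\Lambda$ be the degree of its top component, i.e. its greatest weight. Let $\Gamma$ be a finite abelian group with elements $g_1,\dots,g_\theta$ and characters $\chi_1,\dots,\chi_\theta:\Gamma\to k^\times$ such that $\chi_j(g_i)=q_{ij}$, and let $\langle\ ,\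 \rangle:\Gamma\times\Lambda\to k^\times$ be the bilinear form with $\langle g,\alpha_j\rangle=\chi_j(g)$ for all $g\in\Gamma$ and all $j$. Put $\Gamma^\perp=\{\mu\in\Lambda:\langle g,\mu\rangle=1\ \text{for all}\ g\in\Gamma\}$. Let $\mathcal U$ be the Hopf algebra $T(W\oplus V)\#k\Gamma$ modulo the ideal generated by $\mathcal J(V)$, $\mathcal J(W)$ and the elements $$v_iw_j-\chi_j^{-1}(g_i)\,w_jv_i-\delta_{ij}(g_i^2-1),$$ where $gv_i=\chi_i(g)v_ig$, $gw_i=\chi_i^{-1}(g)w_ig$ for $g\in\Gamma$, and $\Delta(v_i)=v_i\otimes1+g_i\otimes v_i$, $\Delta(w_i)=w_i\otimes1+g_i\otimes w_i$, $\Delta(g)=g\otimes g$. It is $\Lambda$-graded by $\deg v_i=\alpha_i=-\deg w_i$, $\deg g=0$. Let $B\simeq\mathcal B(V)\#k\Gamma$ be the subalgebra generated by $v_1,\dots,v_\theta$ and $\Gamma$. Let $\mathcal C_{\mathcal U}$ be the category of finite-dimensional $\mathcal U$-modules $M$ with a grading $M=\bigoplus_{\lambda\in\Lambda}M_\lambda$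 such that $g\cdot m=\langle g,\lambda\rangle m$ for $g\in\Gamma$, $m\in M_\lambda$, and $v_i\cdot M_\lambda\subseteq M_{\lambda+\alpha_i}$, $w_i\cdot M_\lambda\subseteq M_{\lambda-\alpha_i}$; morphisms are the $\mathcal U$-linear maps that preserve the grading, and the tensor product is taken with the diagonal action and the total grading. For $\lambda\in\Lambda$ let $k_\lambda$ be the one-dimensional graded $B$-module concentrated in degree $\lambda$ on which $g\in\Gamma$ acts by $\langle g,\lambda\rangle$ and each $v_i$ acts by $0$. Let $\Delta(\lambda)=\mathcal U\otimes_Bk_\lambda$ and $\nabla(\lambda)=\operatorname{Hom}_B(\mathcal U,k_{\lambda-\varrho})$, where in the first $x\otimes t$ has degree $\deg x+\deg t$, in the second $f$ has degree $\mu$ if $f(\mathcal U_\beta)\subseteq(k_{\lambda-\varrho})_{\beta+\mu}$ for all $\beta\in\Lambda$, and $(xf)(y)=f(yx)$ for $x,y\in\mathcal U$. Let $E(\lambda)$ be the head of $\Delta(\lambda)$, i.e. its quotient by the intersection of its maximal graded submodules. Then: 1. $\Delta(\lambda)$ and $\nabla(\lambda)$ are objects of $\mathcal C_{\mathcal U}$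 for all $\lambda\in\Lambda$. Each $E(\lambda)$ is a simple object of $\mathcal C_{\mathcal U}$, every simple object of $\mathcal C_{\mathcal U}$ is isomorphic to some $E(\lambda)$, and $E(\lambda)\not\simeq E(\mu)$ if $\lambda\ne\mu$. 2. If $\mu\in\Gamma^\perp$, then $\dim E(\mu)=1$ and $E(\mu)\otimes E(\lambda)\simeq E(\lambda)\otimes E(\mu)\simeq E(\lambda+\mu)$ in $\mathcal C_{\mathcal U}$ for all $\lambda\in\Lambda$. 3. There is a bijection $w_0:\Lambda\to\Lambda$ such that, for every $\lambda\in\Lambda$, $E(\lambda)$ is isomorphic to the socle (the sum of the simple graded submodules) of $\nabla(w_0(\lambda))$. -/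

import Mathlib

open scoped TensorProduct

universe u v w w'

namespace NicholsQG

/-! ### The lattice `Λ` -/

/-- The free abelian group `Λ` with basis `α₁, …, α_θ`; the pointwise order of `Fin θ → ℤ` is the
order `λ ≤ μ ↔ μ - λ ∈ ∑ ℕ αᵢ`. -/
abbrev Lat (θ : ℕ) : Type := Fin θ → ℤ

/-- The basis element `αᵢ`. -/
def alpha {θ : ℕ} (i : Fin θ) : Lat θ := Pi.single i 1

/-! ### Nichols algebras of diagonal type

`T(V)` is the free algebra on `v₁, …, v_θ`.  It is a braided Hopf algebra in the category of
Yetter-Drinfeld modules over the group algebra of `Λ`, where `vⱼ` has degree `αⱼ` and `αᵢ` acts on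
`vⱼ` by `q i j`; the braiding is `c (vᵢ ⊗ vⱼ) = q i j • vⱼ ⊗ vᵢ`. -/

section Nichols

variable {k : Type u} [Field k] {θ : ℕ}

/-- The monomial in the generators given by a list of indices. -/
def word {X : Type v} (l : List X) : FreeAlgebra k X := (l.map (FreeAlgebra.ι k)).prod

/-- The component of degree `β` of the free algebra on `X`, when the generator `x` is given the
degree `d x`: the span of the monomials of degree `β`. -/
def homog (k : Type u) [Field k] {X : Type v} (d : X → Lat θ) (β : Lat θ) :
    Submodule k (FreeAlgebra k X) :=
  Submodule.span k {x | ∃ l : List X, (l.map d).sum = β ∧ word l = x}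

/-- The sum `⊕_{n ≥ 2} Tⁿ(V)`. -/
def degGeTwo (k : Type u) [Field k] (θ : ℕ) : Submodule k (FreeAlgebra k (Fin θ)) :=
  Submodule.span k {x | ∃ l : List (Fin θ), 2 ≤ l.length ∧ word l = x}

/-- The action of `αᵢ` on `T(V)`: the algebra map `vⱼ ↦ q i j • vⱼ`. -/
def twist (q : Fin θ → Fin θ → kˣ) (i : Fin θ) :
    FreeAlgebra k (Fin θ) →ₐ[k] FreeAlgebra k (Fin θ) :=
  FreeAlgebra.lift k fun j => (q i j : k) • FreeAlgebra.ι k j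

/-- Left multiplication by `vᵢ ⊗ 1 + 1 ⊗ vᵢ` in the braided tensor product algebra
`T(V) ⊗ T(V)`, where `(1 ⊗ vᵢ)(a ⊗ b) = (αᵢ · a) ⊗ vᵢ b`. -/
noncomputable def mulPrimitive (q : Fin θ → Fin θ → kˣ) (i : Fin θ) :
    Module.End k (FreeAlgebra k (Fin θ) ⊗[k] FreeAlgebra k (Fin θ)) :=
  TensorProduct.map (LinearMap.mulLeft k (FreeAlgebra.ι k i)) LinearMap.id +
    TensorProduct.map (twist q i).toLinearMap (LinearMap.mulLeft k (FreeAlgebra.ι k i))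

/-- The comultiplication of the braided Hopf algebra `T(V)`: the algebra map to the braided tensor
product `T(V) ⊗ T(V)` with `vᵢ ↦ vᵢ ⊗ 1 + 1 ⊗ vᵢ`.  It is written through the left regular
representation of the braided tensor product: `x` goes to `Δ(x) · (1 ⊗ 1)`. -/
noncomputable def braidedComul (q : Fin θ → Fin θ → kˣ) :
    FreeAlgebra k (Fin θ) →ₗ[k] FreeAlgebra k (Fin θ) ⊗[k] FreeAlgebra k (Fin θ) :=
  (LinearMap.applyₗ ((1 : FreeAlgebra k (Fin θ)) ⊗ₜ[k] (1 : FreeAlgebra k (Fin θ)))).comp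
    (FreeAlgebra.lift k (mulPrimitive q)).toLinearMap

/-- The class of homogeneous Hopf ideals of `T(V)` that are generated in degrees `≥ 2` and are
Yetter-Drinfeld submodules.  Being a Yetter-Drinfeld submodule means being `Λ`-homogeneous (the
action of `Λ` is then automatic).  As these ideals are graded and lie in degrees `≥ 2`,
the counit vanishes on them and they are automatically stable under the antipode. -/
structure IsHopfIdeal (q : Fin θ → Fin θ → kˣ) (I : Submodule k (FreeAlgebra k (Fin θ))) :
    Prop where
  mul_left : ∀ a x, x ∈ I → a * x ∈ I
  mul_right : ∀ a x, x ∈ I → x * a ∈ I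
  homogeneous : I ≤ ⨆ β : Lat θ, I ⊓ homog k alpha β
  degree : I ≤ degGeTwo k θ
  coideal : ∀ x ∈ I, braidedComul q x ∈
    LinearMap.range (TensorProduct.map I.subtype
        (LinearMap.id : FreeAlgebra k (Fin θ) →ₗ[k] FreeAlgebra k (Fin θ))) ⊔
      LinearMap.range (TensorProduct.map
        (LinearMap.id : FreeAlgebra k (Fin θ) →ₗ[k] FreeAlgebra k (Fin θ)) I.subtype)

/-- The defining ideal `J(V)` of the Nichols algebra: the largest ideal of the above class. -/
def nicholsIdeal (q : Fin θ → Fin θ → kˣ) : Submodule k (FreeAlgebra k (Fin θ)) :=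
  sSup {I | IsHopfIdeal q I}

/-- The Nichols algebra `B(V) = T(V) / J(V)`. -/
abbrev NicholsAlgebra (q : Fin θ → Fin θ → kˣ) : Type u :=
  RingQuot fun a b : FreeAlgebra k (Fin θ) => a ∈ nicholsIdeal q ∧ b = 0

/-- The homogeneous components of the Nichols algebra. -/
noncomputable def nicholsGr (q : Fin θ → Fin θ → kˣ) (β : Lat θ) :
    Submodule k (NicholsAlgebra q) :=
  (homog k alpha β).map (RingQuot.mkAlgHom k
    fun a b : FreeAlgebra k (Fin θ) => a ∈ nicholsIdeal q ∧ b = 0).toLinearMap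

/-- The set of weights of `B(V)`. -/
def nicholsWeights (q : Fin θ → Fin θ → kˣ) : Set (Lat θ) := {β | nicholsGr q β ≠ ⊥}

/-- The degree `ϱ` of the top component of a finite dimensional Nichols algebra, that is the
greatest weight of `B(V)` for the order of `Λ` (the supremum is the coordinatewise one). -/
noncomputable def topDegree (q : Fin θ → Fin θ → kˣ) : Lat θ := sSup (nicholsWeights q)

end Nichols

/-! ### Graded modules over a `Λ`-graded algebra -/

section Graded

variable {k : Type u} [Field k] {θ : ℕ}

/-- A module over the `k`-algebra `A` with a family of subspaces indexed by `Λ`. -/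
structure GrMod (k : Type u) [Field k] (A : Type v) [Ring A] [Algebra k A] (θ : ℕ) where
  carrier : Type w
  [addCommGroup : AddCommGroup carrier]
  [moduleField : Module k carrier]
  [module : Module A carrier]
  [isScalarTower : IsScalarTower k A carrier]
  gr : Lat θ → Submodule k carrier

namespace GrMod

attribute [instance] GrMod.addCommGroup GrMod.moduleField GrMod.module GrMod.isScalarTower

variable {A : Type v} [Ring A] [Algebra k A]

/-- Isomorphisms of graded modules: bijective `A`-linear maps that preserve the grading. -/
structure Iso (M : GrMod.{u, v, w} k A θ) (N : GrMod.{u, v, w'} k A θ) where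
  toEquiv : M.carrier ≃ₗ[A] N.carrier
  mem_gr : ∀ μ m, m ∈ M.gr μ ↔ toEquiv m ∈ N.gr μ

/-- Graded submodules: those that are the sum of their intersections with the components. -/
def IsGradedSub (M : GrMod.{u, v, w} k A θ) (N : Submodule A M.carrier) : Prop :=
  N.restrictScalars k ≤ ⨆ μ, N.restrictScalars k ⊓ M.gr μ

/-- The proper graded submodules that are maximal among these. -/
def IsMaximalSub (M : GrMod.{u, v, w} k A θ) (N : Submodule A M.carrier) : Prop :=
  Maximal (fun N' => M.IsGradedSub N' ∧ N' ≠ ⊤) N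

/-- The simple graded submodules. -/
def IsSimpleSub (M : GrMod.{u, v, w} k A θ) (N : Submodule A M.carrier) : Prop :=
  Minimal (fun N' => M.IsGradedSub N' ∧ N' ≠ ⊥) N

/-- The radical: the intersection of all maximal graded submodules. -/
def radical (M : GrMod.{u, v, w} k A θ) : Submodule A M.carrier := sInf {N | M.IsMaximalSub N}

/-- The sum of all simple graded submodules. -/
def socleSub (M : GrMod.{u, v, w} k A θ) : Submodule A M.carrier := sSup {N | M.IsSimpleSub N}

/-- The head `M / rad M`, with the quotient grading. -/
def head (M : GrMod.{u, v, w} k A θ) : GrMod.{u, v, w} k A θ where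
  carrier := M.carrier ⧸ M.radical
  gr μ := (M.gr μ).map (M.radical.mkQ.restrictScalars k)

/-- The socle, with the induced grading. -/
def socle (M : GrMod.{u, v, w} k A θ) : GrMod.{u, v, w} k A θ where
  carrier := M.socleSub
  gr μ := (M.gr μ).comap (M.socleSub.subtype.restrictScalars k)

end GrMod

end Graded

/-! ### Induced and produced modules -/

section IndPro

variable {k : Type u} [Field k] {θ : ℕ} {A : Type v} [Ring A] [Algebra k A]
  {B : Type v} [Ring B] [Algebra k B] (φ : B →ₐ[k] A)

/-- The relations `a b ⊗ t = a ⊗ b t` defining `A ⊗_B T` as a quotient of `A ⊗_k T`. -/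
def balanced (T : Type w) [AddCommGroup T] [Module k T] [Module B T] :
    Submodule A (A ⊗[k] T) :=
  Submodule.span A {z | ∃ (a : A) (b : B) (t : T), z = (a * φ b) ⊗ₜ[k] t - a ⊗ₜ[k] (b • t)}

/-- `Hom_B(A, T)`, as a subspace of `Hom_k(A, T)`. -/
def produced (T : Type w) [AddCommGroup T] [Module k T] [Module B T] [IsScalarTower k B T] :
    Submodule k (A →ₗ[k] T) where
  carrier := {f | ∀ (b : B) (a : A), f (φ b * a) = b • f a}
  add_mem' hf hg b a := by simp [hf b a, hg b a]
  zero_mem' b a := by simp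
  smul_mem' c f hf b a := by simp [hf b a, smul_comm c b]

/-- The action of `A` on `Hom_B(A, T)`: `(a f)(x) = f (x a)`. -/
instance producedModule (T : Type w) [AddCommGroup T] [Module k T] [Module B T]
    [IsScalarTower k B T] : Module A (produced φ T) where
  smul a f := ⟨f.1.comp (LinearMap.mulRight k a), fun b x => by
    simpa [mul_assoc] using f.2 b (x * a)⟩
  one_smul f := Subtype.ext <| LinearMap.ext fun x => congrArg f.1 (mul_one x)
  mul_smul a b f := Subtype.ext <| LinearMap.ext fun x => congrArg f.1 (mul_assoc x a b).symm
  smul_zero a := rfl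
  smul_add a f g := rfl
  add_smul a b f := Subtype.ext <| LinearMap.ext fun x =>
    (congrArg f.1 (mul_add x a b)).trans (map_add f.1 _ _)
  zero_smul f := Subtype.ext <| LinearMap.ext fun x =>
    (congrArg f.1 (mul_zero x)).trans (map_zero f.1)

theorem produced_smul_apply (T : Type w) [AddCommGroup T] [Module k T] [Module B T]
    [IsScalarTower k B T] (a : A) (f : produced φ T) (x : A) :
    (a • f).1 x = f.1 (x * a) := rfl

instance producedTower (T : Type w) [AddCommGroup T] [Module k T] [Module B T]
    [IsScalarTower k B T] : IsScalarTower k A (produced φ T) where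
  smul_assoc c a f := Subtype.ext <| LinearMap.ext fun x => by
    simp [produced_smul_apply]

/-- The induced module `A ⊗_B T`; if `a` and `t` have degrees `β` and `γ`, then `a ⊗ t` has
degree `β + γ`. -/
noncomputable def GrMod.ind (grA : Lat θ → Submodule k A) (T : GrMod.{u, v, w} k B θ) :
    GrMod.{u, v, max v w} k A θ where
  carrier := (A ⊗[k] T.carrier) ⧸ balanced φ T.carrier
  gr μ := ⨆ β : Lat θ,
    (Submodule.map₂ (TensorProduct.mk k A T.carrier) (grA β) (T.gr (μ - β))).map
      ((balanced φ T.carrier).mkQ.restrictScalars k)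

/-- The produced module `Hom_B(A, T)`; `f` has degree `μ` if it maps the component of degree `β`
of `A` to the component of degree `β + μ` of `T`, for all `β`. -/
noncomputable def GrMod.pro (grA : Lat θ → Submodule k A) (T : GrMod.{u, v, w} k B θ) :
    GrMod.{u, v, max v w} k A θ where
  carrier := produced φ T.carrier
  gr μ :=
    { carrier := {f | ∀ β, ∀ x ∈ grA β, f.1 x ∈ T.gr (β + μ)}
      add_mem' := fun hf hg _ _ hx => Submodule.add_mem _ (hf _ _ hx) (hg _ _ hx)
      zero_mem' := fun _ _ _ => Submodule.zero_mem _
      smul_mem' := fun c _ hf _ _ hx => Submodule.smul_mem _ c (hf _ _ hx) }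

end IndPro

/-! ### The algebra `U` -/

/-- The data: a symmetric matrix `(q i j)`, elements `g i` of the abelian group `Γ` and characters
`χ j` with `χ j (g i) = q i j`, and a bilinear form `Γ × Λ → kˣ` with `⟨γ, αⱼ⟩ = χ j γ` for all
`γ` in `Γ`. -/
structure Datum (k : Type u) [Field k] (Γ : Type v) [CommGroup Γ] (θ : ℕ) where
  q : Fin θ → Fin θ → kˣ
  symm : ∀ i j, q i j = q j i
  g : Fin θ → Γ
  χ : Fin θ → Γ →* kˣ
  χ_g : ∀ i j, χ j (g i) = q i j
  pairing : Γ →* Multiplicative (Lat θ) →* kˣ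
  pairing_alpha : ∀ γ j, pairing γ (Multiplicative.ofAdd (alpha j)) = χ j γ

/-- The generators of `U`. -/
inductive Gen (θ : ℕ) (Γ : Type v) : Type v
  | v (i : Fin θ)
  | w (i : Fin θ)
  | g (γ : Γ)

/-- The generators of `B(V) # kΓ`. -/
inductive BGen (θ : ℕ) (Γ : Type v) : Type v
  | v (i : Fin θ)
  | g (γ : Γ)

namespace Datum

variable {k : Type u} [Field k] {Γ : Type v} [CommGroup Γ] {θ : ℕ} (D : Datum k Γ θ)

/-- The value `⟨γ, lam⟩` of the bilinear form. -/
def form (γ : Γ) (lam : Lat θ) : kˣ := D.pairing γ (Multiplicative.ofAdd lam)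

/-- The set `Γ^⊥` of the `μ` in `Λ` with `⟨γ, μ⟩ = 1` for all `γ` in `Γ`. -/
def perp : Set (Lat θ) := {μ | ∀ γ, D.form γ μ = 1}

/-- The defining relations of `U = T(W ⊕ V) # kΓ / I`: the relations of the smash product
`T(W ⊕ V) # kΓ`, where `vᵢ` and `wᵢ` have the characters `χᵢ` and `χᵢ⁻¹`, the relations of the
Nichols algebras of `V` (with matrix `q`) and `W` (with matrix `q⁻¹`), and the linking relations
`vᵢ wⱼ - χⱼ⁻¹(gᵢ) wⱼ vᵢ = δᵢⱼ (gᵢ² - 1)`. -/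
inductive Rel : FreeAlgebra k (Gen θ Γ) → FreeAlgebra k (Gen θ Γ) → Prop
  | g_one : Rel (FreeAlgebra.ι k (Gen.g 1)) 1
  | g_mul (γ γ' : Γ) : Rel (FreeAlgebra.ι k (Gen.g (γ * γ')))
      (FreeAlgebra.ι k (Gen.g γ) * FreeAlgebra.ι k (Gen.g γ'))
  | g_v (γ : Γ) (i : Fin θ) : Rel (FreeAlgebra.ι k (Gen.g γ) * FreeAlgebra.ι k (Gen.v i))
      ((D.χ i γ : k) • (FreeAlgebra.ι k (Gen.v i) * FreeAlgebra.ι k (Gen.g γ)))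
  | g_w (γ : Γ) (i : Fin θ) : Rel (FreeAlgebra.ι k (Gen.g γ) * FreeAlgebra.ι k (Gen.w i))
      ((((D.χ i γ)⁻¹ : kˣ) : k) • (FreeAlgebra.ι k (Gen.w i) * FreeAlgebra.ι k (Gen.g γ)))
  | nichols_v (x : FreeAlgebra k (Fin θ)) (hx : x ∈ nicholsIdeal D.q) :
      Rel (FreeAlgebra.lift k (fun i => FreeAlgebra.ι k (Gen.v i)) x) 0
  | nichols_w (x : FreeAlgebra k (Fin θ)) (hx : x ∈ nicholsIdeal D.q⁻¹) :
      Rel (FreeAlgebra.lift k (fun i => FreeAlgebra.ι k (Gen.w i)) x) 0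
  | linking (i j : Fin θ) : Rel (FreeAlgebra.ι k (Gen.v i) * FreeAlgebra.ι k (Gen.w j) -
        (((D.χ j (D.g i))⁻¹ : kˣ) : k) •
          (FreeAlgebra.ι k (Gen.w j) * FreeAlgebra.ι k (Gen.v i)))
      (if i = j then FreeAlgebra.ι k (Gen.g (D.g i)) ^ 2 - 1 else 0)

/-- The algebra `U`. -/
abbrev U : Type (max u v) := RingQuot D.Rel

/-- The projection of the free algebra on the generators to `U`. -/
noncomputable def mkU : FreeAlgebra k (Gen θ Γ) →ₐ[k] D.U := RingQuot.mkAlgHom k D.Rel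

/-- The generators in `U`. -/
noncomputable def gen (x : Gen θ Γ) : D.U := D.mkU (FreeAlgebra.ι k x)

/-- The degrees of the generators: `deg vᵢ = αᵢ = - deg wᵢ` and `deg γ = 0`. -/
def genDeg : Gen θ Γ → Lat θ
  | .v i => alpha i
  | .w i => -alpha i
  | .g _ => 0

/-- The grading of `U` by `Λ`. -/
noncomputable def grU (β : Lat θ) : Submodule k D.U :=
  (homog k genDeg β).map D.mkU.toLinearMap

/-- The defining relations of `B(V) # kΓ`. -/
inductive BRel : FreeAlgebra k (BGen θ Γ) → FreeAlgebra k (BGen θ Γ) → Prop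
  | g_one : BRel (FreeAlgebra.ι k (BGen.g 1)) 1
  | g_mul (γ γ' : Γ) : BRel (FreeAlgebra.ι k (BGen.g (γ * γ')))
      (FreeAlgebra.ι k (BGen.g γ) * FreeAlgebra.ι k (BGen.g γ'))
  | g_v (γ : Γ) (i : Fin θ) : BRel (FreeAlgebra.ι k (BGen.g γ) * FreeAlgebra.ι k (BGen.v i))
      ((D.χ i γ : k) • (FreeAlgebra.ι k (BGen.v i) * FreeAlgebra.ι k (BGen.g γ)))
  | nichols_v (x : FreeAlgebra k (Fin θ)) (hx : x ∈ nicholsIdeal D.q) :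
      BRel (FreeAlgebra.lift k (fun i => FreeAlgebra.ι k (BGen.v i)) x) 0

/-- The algebra `B = B(V) # kΓ`, identified with the subalgebra of `U` generated by the `vᵢ`
and `Γ` through the map `toU`. -/
abbrev Bor : Type (max u v) := RingQuot D.BRel

variable {D} in
theorem gen_rel {x y : FreeAlgebra k (Gen θ Γ)} (h : D.Rel x y) : D.mkU x = D.mkU y :=
  RingQuot.mkAlgHom_rel k h

theorem gen_g_one : D.gen (.g 1) = 1 := by
  simpa [gen] using gen_rel (D := D) Rel.g_one

theorem gen_g_mul (γ γ' : Γ) : D.gen (.g (γ * γ')) = D.gen (.g γ) * D.gen (.g γ') := by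
  simpa [gen] using gen_rel (D := D) (Rel.g_mul γ γ')

theorem gen_g_v (γ : Γ) (i : Fin θ) :
    D.gen (.g γ) * D.gen (.v i) = (D.χ i γ : k) • (D.gen (.v i) * D.gen (.g γ)) := by
  simpa [gen] using gen_rel (D := D) (Rel.g_v γ i)

theorem gen_g_w (γ : Γ) (i : Fin θ) : D.gen (.g γ) * D.gen (.w i) =
    (((D.χ i γ)⁻¹ : kˣ) : k) • (D.gen (.w i) * D.gen (.g γ)) := by
  simpa [gen] using gen_rel (D := D) (Rel.g_w γ i)

theorem lift_comp_ι {X Y : Type*} {A : Type*} [Semiring A] [Algebra k A] (f : X → Y)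
    (F : FreeAlgebra k Y →ₐ[k] A) (x : FreeAlgebra k X) :
    F (FreeAlgebra.lift k (fun i => FreeAlgebra.ι k (f i)) x) =
      FreeAlgebra.lift k (fun i => F (FreeAlgebra.ι k (f i))) x := by
  rw [← AlgHom.comp_apply]
  congr 1
  ext i
  simp

theorem gen_nichols_v (x : FreeAlgebra k (Fin θ)) (hx : x ∈ nicholsIdeal D.q) :
    FreeAlgebra.lift k (fun i => D.gen (.v i)) x = 0 := by
  have h := gen_rel (D := D) (Rel.nichols_v x hx)
  rw [lift_comp_ι, map_zero] at h
  exact h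

theorem gen_nichols_w (x : FreeAlgebra k (Fin θ)) (hx : x ∈ nicholsIdeal D.q⁻¹) :
    FreeAlgebra.lift k (fun i => D.gen (.w i)) x = 0 := by
  have h := gen_rel (D := D) (Rel.nichols_w x hx)
  rw [lift_comp_ι, map_zero] at h
  exact h

theorem gen_linking (i j : Fin θ) : D.gen (.v i) * D.gen (.w j) =
    (((D.χ j (D.g i))⁻¹ : kˣ) : k) • (D.gen (.w j) * D.gen (.v i)) +
      (if i = j then D.gen (.g (D.g i)) ^ 2 - 1 else 0) := by
  have h := gen_rel (D := D) (Rel.linking i j)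
  rw [map_sub, map_smul, map_mul, map_mul, sub_eq_iff_eq_add'] at h
  rw [gen, gen, h]
  split_ifs <;> simp [gen]

/-- The inclusion of `B` into `U`. -/
noncomputable def toU : D.Bor →ₐ[k] D.U :=
  RingQuot.liftAlgHom k ⟨FreeAlgebra.lift k fun x => match x with
    | .v i => D.gen (.v i)
    | .g γ => D.gen (.g γ), by
    intro x y h
    induction h with
    | g_one => simpa using D.gen_g_one
    | g_mul γ γ' => simpa using D.gen_g_mul γ γ'
    | g_v γ i => simpa using D.gen_g_v γ i
    | nichols_v x hx =>
      rw [lift_comp_ι, map_zero]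
      simpa using D.gen_nichols_v x hx⟩

/-- The character of `B` given by `vᵢ ↦ 0` and `γ ↦ ⟨γ, lam⟩`. -/
noncomputable def charB (lam : Lat θ) : D.Bor →ₐ[k] k :=
  RingQuot.liftAlgHom k ⟨FreeAlgebra.lift k fun x => match x with
    | .v _ => 0
    | .g γ => (D.form γ lam : k), by
    intro x y h
    induction h with
    | g_one => simp [form]
    | g_mul γ γ' => simp [form]
    | g_v γ i => simp
    | nichols_v x hx =>
      rw [lift_comp_ι, map_zero]
      have hJ : nicholsIdeal D.q ≤ degGeTwo k θ := sSup_le fun I hI => hI.degree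
      refine Submodule.span_induction (p := fun y _ => FreeAlgebra.lift k
        (fun i : Fin θ => FreeAlgebra.lift k (fun x : BGen θ Γ => match x with
          | .v _ => (0 : k)
          | .g γ => (D.form γ lam : k)) (FreeAlgebra.ι k (BGen.v i))) y = 0) ?_ ?_ ?_ ?_ (hJ hx)
      · rintro _ ⟨l, hl, rfl⟩
        cases l with
        | nil => simp at hl
        | cons a l => simp [word]
      · simp
      · intro a b _ _ ha hb
        rw [map_add, ha, hb, add_zero]
      · intro c a _ ha
        rw [map_smul, ha, smul_zero]⟩

/-- The one-dimensional graded `B`-module `k_lam`, concentrated in degree `lam`, on which `γ` acts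
by `⟨γ, lam⟩` and the `vᵢ` act by `0`. -/
noncomputable def oneDim (lam : Lat θ) : GrMod.{u, max u v, u} k D.Bor θ :=
  letI : Module D.Bor k := Module.compHom k (D.charB lam).toRingHom
  haveI : IsScalarTower k D.Bor k := ⟨fun c b x => by
    change D.charB lam (c • b) * x = c * (D.charB lam b * x)
    rw [map_smul, smul_eq_mul, mul_assoc]⟩
  { carrier := k
    gr := fun μ => if μ = lam then ⊤ else ⊥ }

/-- The Weyl module `Δ(lam) = Ind_B^U k_lam`. -/
noncomputable def weyl (lam : Lat θ) : GrMod.{u, max u v, max u v} k D.U θ :=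
  GrMod.ind D.toU D.grU (D.oneDim lam)

/-- The dual Weyl module `∇(lam) = Pro_B^U k_{lam - ϱ}`. -/
noncomputable def dualWeyl (lam : Lat θ) : GrMod.{u, max u v, max u v} k D.U θ :=
  GrMod.pro D.toU D.grU (D.oneDim (lam - topDegree D.q))

/-- The head `E(lam)` of the Weyl module `Δ(lam)`. -/
noncomputable def E (lam : Lat θ) : GrMod.{u, max u v, max u v} k D.U θ := (D.weyl lam).head

/-! ### The category `C_U` -/

/-- The graded `U`-module `M` is an object of `C_U`. -/
structure IsObj (M : GrMod.{u, max u v, w} k D.U θ) : Prop where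
  finite : FiniteDimensional k M.carrier
  internal : DirectSum.IsInternal M.gr
  g_smul : ∀ (γ : Γ) (lam : Lat θ), ∀ m ∈ M.gr lam, D.gen (.g γ) • m = (D.form γ lam : k) • m
  v_smul : ∀ (i : Fin θ) (lam : Lat θ), ∀ m ∈ M.gr lam, D.gen (.v i) • m ∈ M.gr (lam + alpha i)
  w_smul : ∀ (i : Fin θ) (lam : Lat θ), ∀ m ∈ M.gr lam, D.gen (.w i) • m ∈ M.gr (lam - alpha i)

/-- The simple objects of `C_U`.  The subobjects of an object are its graded submodules. -/
structure IsSimpleObj (M : GrMod.{u, max u v, w} k D.U θ) : Prop where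
  isObj : D.IsObj M
  nontrivial : Nontrivial M.carrier
  eq_bot_or_eq_top : ∀ N : Submodule D.U M.carrier, M.IsGradedSub N → N = ⊥ ∨ N = ⊤

/-! ### The comultiplication of `U` and the tensor product of `C_U` -/

end Datum

section Comul

variable {k : Type u} [Field k] {θ : ℕ}

/-- The product of the `g i` over a list depends only on the degree. -/
theorem prod_eq_of_degree {Γ : Type v} [CommGroup Γ] (g : Fin θ → Γ) (l : List (Fin θ)) :
    (l.map g).prod = ∏ i, g i ^ (l.map alpha).sum i := by
  induction l with
  | nil => simp
  | cons a l ih =>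
    simp only [List.map_cons, List.prod_cons, ih, List.sum_cons, Pi.add_apply, zpow_add,
      Finset.prod_mul_distrib]
    congr 1
    rw [Finset.prod_eq_single a] <;> simp +contextual [alpha]

/-- If the elements `x i` of `A` satisfy the relations of a Nichols algebra, then so do the elements
`x i ⊗ 1 + g i ⊗ x i` of `A ⊗ A`. -/
theorem lift_comul_eq_zero {Γ : Type v} [CommGroup Γ] {A : Type w} [Ring A] [Algebra k A]
    (q : Fin θ → Fin θ → kˣ) (x : Fin θ → A) (g : Fin θ → Γ) (G : Γ →* A)
    (hgx : ∀ i j, G (g i) * x j = (q i j : k) • (x j * G (g i)))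
    (hx : ∀ y ∈ nicholsIdeal q, FreeAlgebra.lift k x y = 0)
    (y : FreeAlgebra k (Fin θ)) (hy : y ∈ nicholsIdeal q) :
    FreeAlgebra.lift k (fun i => x i ⊗ₜ[k] (1 : A) + G (g i) ⊗ₜ[k] x i) y = 0 := by
  let X := FreeAlgebra.lift k x
  let δ : FreeAlgebra k (Fin θ) →ₐ[k] A ⊗[k] A :=
    FreeAlgebra.lift k fun i => G (g i) ⊗ₜ[k] x i
  let C : FreeAlgebra k (Fin θ) →ₐ[k] A ⊗[k] A :=
    FreeAlgebra.lift k fun i => x i ⊗ₜ[k] (1 : A) + G (g i) ⊗ₜ[k] x i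
  let Ψ : FreeAlgebra k (Fin θ) ⊗[k] FreeAlgebra k (Fin θ) →ₗ[k] A ⊗[k] A :=
    (LinearMap.mul' k (A ⊗[k] A)).comp
      (TensorProduct.map ((Algebra.TensorProduct.includeLeft (R := k) (S := k) (A := A)
        (B := A)).comp X).toLinearMap δ.toLinearMap)
  have hΨ : ∀ a b, Ψ (a ⊗ₜ b) = (X a ⊗ₜ[k] (1 : A)) * δ b := fun a b => by simp [Ψ]
  have hcomm : ∀ i a, G (g i) * X a = X (twist q i a) * G (g i) := by
    intro i a
    induction a using FreeAlgebra.induction with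
    | grade0 r => simp [Algebra.commutes]
    | grade1 j => simp [X, twist, hgx]
    | mul a b ha hb => rw [map_mul, ← mul_assoc, ha, mul_assoc, hb, map_mul, map_mul, mul_assoc]
    | add a b ha hb => simp only [map_add, mul_add, add_mul, ha, hb]
  have hL : ∀ i z, Ψ (mulPrimitive q i z) =
      (x i ⊗ₜ[k] (1 : A) + G (g i) ⊗ₜ[k] x i) * Ψ z := by
    intro i z
    induction z using TensorProduct.induction_on with
    | zero => simp
    | add a b ha hb => rw [map_add, map_add, ha, hb, map_add, mul_add]
    | tmul a b =>
      simp only [mulPrimitive, LinearMap.add_apply, TensorProduct.map_tmul, map_add, hΨ,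
        LinearMap.mulLeft_apply, LinearMap.id_coe, id_eq, AlgHom.toLinearMap_apply, map_mul,
        add_mul]
      have h1 : X (FreeAlgebra.ι k i) = x i := by simp [X]
      have h2 : δ (FreeAlgebra.ι k i) = G (g i) ⊗ₜ[k] x i := by simp [δ]
      rw [h1, h2, ← mul_assoc, ← mul_assoc, ← mul_assoc]
      simp [hcomm]
  have hlift : ∀ y z, Ψ (FreeAlgebra.lift k (mulPrimitive q) y z) = C y * Ψ z := by
    intro y
    induction y using FreeAlgebra.induction with
    | grade0 r => intro z; simp [Algebra.smul_def]
    | grade1 i => intro z; simp [C, hL]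
    | mul a b ha hb => intro z; simp [ha, hb, mul_assoc]
    | add a b ha hb => intro z; simp [ha, hb, add_mul]
  have hC : ∀ y, C y = Ψ (braidedComul q y) := by
    intro y
    have h1 : Ψ (1 ⊗ₜ 1) = 1 := by rw [hΨ]; simp [Algebra.TensorProduct.one_def]
    have h2 : braidedComul q y = FreeAlgebra.lift k (mulPrimitive q) y (1 ⊗ₜ 1) := rfl
    rw [h2, hlift, h1, mul_one]
  have hδ : ∀ β, ∀ b ∈ homog k (alpha (θ := θ)) β,
      δ b = G (∏ i, g i ^ β i) ⊗ₜ[k] X b := by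
    intro β b hb
    refine Submodule.span_induction (p := fun b _ => δ b = G (∏ i, g i ^ β i) ⊗ₜ[k] X b)
      ?_ ?_ ?_ ?_ hb
    · rintro _ ⟨l, rfl, rfl⟩
      rw [← prod_eq_of_degree]
      clear hb
      induction l with
      | nil => simp [word, Algebra.TensorProduct.one_def]
      | cons a l ih =>
        have hw : word (k := k) (a :: l) = FreeAlgebra.ι k a * word l := by simp [word]
        rw [hw, map_mul, map_mul, ih]
        simp [δ, X]
    · simp
    · intro a b _ _ ha hb
      rw [map_add, map_add, ha, hb, TensorProduct.tmul_add]
    · intro c a _ ha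
      rw [map_smul, map_smul, ha, TensorProduct.tmul_smul]
  change C y = 0
  refine LinearMap.mem_ker.1 ((sSup_le (a := LinearMap.ker C.toLinearMap) ?_) hy)
  intro I hI z hz
  have hIJ : I ≤ nicholsIdeal q := le_sSup hI
  have hδI : ∀ b ∈ I, δ b = 0 := by
    intro b hb
    have hle : (⨆ β : Lat θ, I ⊓ homog k alpha β) ≤ LinearMap.ker δ.toLinearMap := ?_
    · exact hle (hI.homogeneous hb)
    refine iSup_le fun β c hc => ?_
    have : X c = 0 := hx c (hIJ hc.1)
    rw [LinearMap.mem_ker, AlgHom.toLinearMap_apply, hδ β c hc.2, this, TensorProduct.tmul_zero]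
  rw [LinearMap.mem_ker, AlgHom.toLinearMap_apply, hC]
  rw [← LinearMap.mem_ker]
  refine (sup_le ?_ ?_ : _ ≤ LinearMap.ker Ψ) (hI.coideal z hz)
  · rintro _ ⟨t, rfl⟩
    rw [LinearMap.mem_ker, ← LinearMap.comp_apply]
    have : Ψ.comp (TensorProduct.map I.subtype LinearMap.id) = 0 := by
      ext a b
      have : X a = 0 := hx a (hIJ a.2)
      simp [hΨ, this]
    rw [this, LinearMap.zero_apply]
  · rintro _ ⟨t, rfl⟩
    rw [LinearMap.mem_ker, ← LinearMap.comp_apply]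
    have : Ψ.comp (TensorProduct.map LinearMap.id I.subtype) = 0 := by
      ext a b
      have := hδI b b.2
      simp [hΨ, this]
    rw [this, LinearMap.zero_apply]

end Comul

namespace Datum

variable {k : Type u} [Field k] {Γ : Type v} [CommGroup Γ] {θ : ℕ} (D : Datum k Γ θ)

/-- The comultiplication on generators: `vᵢ ↦ vᵢ ⊗ 1 + gᵢ ⊗ vᵢ`, `wᵢ ↦ wᵢ ⊗ 1 + gᵢ ⊗ wᵢ` and
`γ ↦ γ ⊗ γ`. -/
noncomputable def comulGen : Gen θ Γ → D.U ⊗[k] D.U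
  | .v i => D.gen (.v i) ⊗ₜ 1 + D.gen (.g (D.g i)) ⊗ₜ D.gen (.v i)
  | .w i => D.gen (.w i) ⊗ₜ 1 + D.gen (.g (D.g i)) ⊗ₜ D.gen (.w i)
  | .g γ => D.gen (.g γ) ⊗ₜ D.gen (.g γ)

/-- The group `Γ` in `U`. -/
noncomputable def gHom : Γ →* D.U where
  toFun γ := D.gen (.g γ)
  map_one' := D.gen_g_one
  map_mul' := D.gen_g_mul

theorem comul_linking (i j : Fin θ) : D.comulGen (.v i) * D.comulGen (.w j) -
    (((D.χ j (D.g i))⁻¹ : kˣ) : k) • (D.comulGen (.w j) * D.comulGen (.v i)) =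
      if i = j then D.comulGen (.g (D.g i)) ^ 2 - 1 else 0 := by
  have h1 : D.comulGen (.v i) * D.comulGen (.w j) =
      (D.gen (.v i) * D.gen (.w j)) ⊗ₜ[k] 1 +
      (D.gen (.v i) * D.gen (.g (D.g j))) ⊗ₜ[k] D.gen (.w j) +
      (((D.χ j (D.g i))⁻¹ : kˣ) : k) • ((D.gen (.w j) * D.gen (.g (D.g i))) ⊗ₜ[k] D.gen (.v i)) +
      D.gen (.g (D.g i * D.g j)) ⊗ₜ[k] (D.gen (.v i) * D.gen (.w j)) := by
    simp only [comulGen, mul_add, add_mul, Algebra.TensorProduct.tmul_mul_tmul, mul_one, one_mul,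
      gen_g_w, gen_g_mul, TensorProduct.smul_tmul']
    abel
  have h2 : D.comulGen (.w j) * D.comulGen (.v i) =
      (D.gen (.w j) * D.gen (.v i)) ⊗ₜ[k] 1 +
      (D.gen (.w j) * D.gen (.g (D.g i))) ⊗ₜ[k] D.gen (.v i) +
      (D.χ j (D.g i) : k) • ((D.gen (.v i) * D.gen (.g (D.g j))) ⊗ₜ[k] D.gen (.w j)) +
      D.gen (.g (D.g i * D.g j)) ⊗ₜ[k] (D.gen (.w j) * D.gen (.v i)) := by
    have h3 : D.χ j (D.g i) = D.χ i (D.g j) := by rw [D.χ_g, D.χ_g, D.symm]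
    rw [h3, mul_comm (D.g i)]
    simp only [comulGen, mul_add, add_mul, Algebra.TensorProduct.tmul_mul_tmul, mul_one, one_mul,
      gen_g_v, gen_g_mul, TensorProduct.smul_tmul']
    abel
  have h4 := D.gen_linking i j
  rw [h1, h2, h4]
  simp only [smul_add, smul_smul, Units.inv_mul, one_smul, TensorProduct.add_tmul,
    TensorProduct.tmul_add, TensorProduct.smul_tmul', TensorProduct.tmul_smul]
  split_ifs with hij
  · subst hij
    rw [comulGen, Algebra.TensorProduct.tmul_pow, Algebra.TensorProduct.one_def, gen_g_mul,
      ← pow_two, TensorProduct.sub_tmul, TensorProduct.tmul_sub]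
    abel
  · simp only [TensorProduct.zero_tmul, TensorProduct.tmul_zero]
    abel

/-- The comultiplication of the Hopf algebra `U`. -/
noncomputable def comul : D.U →ₐ[k] D.U ⊗[k] D.U :=
  RingQuot.liftAlgHom k ⟨FreeAlgebra.lift k D.comulGen, by
    intro x y h
    induction h with
    | g_one => simp [comulGen, gen_g_one, Algebra.TensorProduct.one_def]
    | g_mul γ γ' => simp [comulGen, gen_g_mul]
    | g_v γ i =>
      simp only [map_mul, FreeAlgebra.lift_ι_apply, comulGen, map_smul, mul_add, add_mul,
        Algebra.TensorProduct.tmul_mul_tmul, mul_one, one_mul, gen_g_v, smul_add,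
        TensorProduct.tmul_smul, TensorProduct.smul_tmul', ← gen_g_mul, mul_comm]
    | g_w γ i =>
      simp only [map_mul, FreeAlgebra.lift_ι_apply, comulGen, map_smul, mul_add, add_mul,
        Algebra.TensorProduct.tmul_mul_tmul, mul_one, one_mul, gen_g_w, smul_add,
        TensorProduct.tmul_smul, TensorProduct.smul_tmul', ← gen_g_mul, mul_comm]
    | nichols_v x hx =>
      rw [lift_comp_ι, map_zero]
      simp only [FreeAlgebra.lift_ι_apply, comulGen]
      refine lift_comul_eq_zero D.q (fun i => D.gen (.v i)) D.g D.gHom ?_ D.gen_nichols_v x hx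
      intro i j
      simpa [D.χ_g, gHom] using D.gen_g_v (D.g i) j
    | nichols_w x hx =>
      rw [lift_comp_ι, map_zero]
      simp only [FreeAlgebra.lift_ι_apply, comulGen]
      refine lift_comul_eq_zero D.q⁻¹ (fun i => D.gen (.w i)) D.g D.gHom ?_ D.gen_nichols_w x hx
      intro i j
      simpa [D.χ_g, gHom] using D.gen_g_w (D.g i) j
    | linking i j =>
      have := D.comul_linking i j
      split_ifs with hij
      · rw [if_pos hij] at this
        simpa using this
      · rw [if_neg hij] at this
        simpa using this⟩

/-- The action of `U` on the tensor product of two `U`-modules through the comultiplication. -/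
noncomputable def tensorAction (M : GrMod.{u, max u v, w} k D.U θ)
    (N : GrMod.{u, max u v, w'} k D.U θ) :
    D.U →ₐ[k] Module.End k (M.carrier ⊗[k] N.carrier) :=
  (Module.endTensorEndAlgHom (R := k) (A := k) (M := M.carrier) (N := N.carrier)).comp
    ((Algebra.TensorProduct.map (Algebra.lsmul k k M.carrier) (Algebra.lsmul k k N.carrier)).comp
      D.comul)

/-- The vector space `M ⊗ N`, on which `U` acts through the comultiplication. -/
def TensorSpace (M : GrMod.{u, max u v, w} k D.U θ) (N : GrMod.{u, max u v, w'} k D.U θ) :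
    Type (max w w') := M.carrier ⊗[k] N.carrier

section

variable (M : GrMod.{u, max u v, w} k D.U θ) (N : GrMod.{u, max u v, w'} k D.U θ)

noncomputable instance : AddCommGroup (D.TensorSpace M N) :=
  inferInstanceAs (AddCommGroup (M.carrier ⊗[k] N.carrier))

noncomputable instance : Module k (D.TensorSpace M N) :=
  inferInstanceAs (Module k (M.carrier ⊗[k] N.carrier))

noncomputable instance : Module D.U (D.TensorSpace M N) :=
  Module.compHom (M.carrier ⊗[k] N.carrier) (D.tensorAction M N).toRingHom

theorem tensor_smul_def (x : D.U) (m : D.TensorSpace M N) :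
    x • m = (D.tensorAction M N x : Module.End k (M.carrier ⊗[k] N.carrier)) m := rfl

instance : IsScalarTower k D.U (D.TensorSpace M N) where
  smul_assoc c x m := by
    rw [tensor_smul_def, tensor_smul_def, map_smul]
    rfl

/-- The map `(m, n) ↦ m ⊗ n`. -/
noncomputable def tensorMk : M.carrier →ₗ[k] N.carrier →ₗ[k] D.TensorSpace M N :=
  TensorProduct.mk k M.carrier N.carrier

end

/-- The tensor product of `C_U`. -/
noncomputable def tensor (M : GrMod.{u, max u v, w} k D.U θ)
    (N : GrMod.{u, max u v, w'} k D.U θ) : GrMod.{u, max u v, max w w'} k D.U θ where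
  carrier := D.TensorSpace M N
  gr μ := ⨆ β : Lat θ, Submodule.map₂ (D.tensorMk M N) (M.gr β) (N.gr (μ - β))

end Datum

end NicholsQG

universe w''

namespace NicholsQG

/-! ### Graded vector spaces -/

section Proj

variable {k : Type u} [Field k] {θ : ℕ} {M : Type w} [AddCommGroup M] [Module k M]
  {gr : Lat θ → Submodule k M} {M' : Type w'} [AddCommGroup M'] [Module k M']
  {gr' : Lat θ → Submodule k M'}

/-! The proof is highest weight theory for `U`, with `B(W)` as the negative part. A full triangular
decomposition is not needed; it suffices to know `Δ(λ)` exactly. By the linking relations every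
element of `Δ(λ)` is an element of `T(W)` applied to the generator (`IsHighest.exists_wlift`), so
`Δ(λ)` is a quotient of `B(W)`. Conversely `U` acts on `B(W)` (`vermaRep`): `wᵢ` by left
multiplication, `Γ` by characters, `vᵢ` by a combination of a right and a left skew derivation. The
delicate point is that `J(V)` acts by zero: moving `y ∈ T(V)` past `wⱼ` produces rescalings and skew
derivatives of `y`, and these stay in `J(V)` (`vOps_ι_mul_right`, `vOps_of_mem`). Hence `Δ(λ) ≅
B(W)` (`weyl_iso_verma`). As `q` is symmetric, the comultiplication for `q⁻¹` is the one for `q`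
followed by the inverse braiding, so `J(V)` and `J(W)` are the same subspace of the free algebra and
`B(W)` is finite dimensional too.

The component of weight `λ` of `Δ(λ)` is a line that generates, so there is a greatest proper graded
submodule and `E(λ)` is simple (`weyl_radical`). In a simple object a vector of maximal weight is
killed by all `vᵢ` and makes the object a quotient of a Weyl module; `λ` is recovered as the
greatest weight of `E(λ)`.

If `μ ∈ Γ^⊥`, then `Γ` fixes the highest weight vector `m` of `E(μ)`, so `vⱼ wᵢ m = 0`, and `wᵢ m ≠
0` would give `E(μ) ≅ E(μ - αᵢ)`. Thus `E(μ)` is a line with trivial action, and tensoring with it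
only shifts degrees.

The module produced from `k_ν` consists of linear forms on `U`. Each of its nonzero graded
submodules contains the form of degree `ν` with value `1` at `1`, so any simple graded submodule is
the whole socle. Matrix coefficients of a lowest weight covector embed `E(λ)` there, with `ν` its
lowest weight. Exchanging the `vᵢ` and `wᵢ` (`opHom`) turns lowest weights into highest weights, so
`λ ↦ ν` is bijective; `w₀` is this map followed by translation by `ϱ`. -/

theorem bijective_coeLinearMap (h : DirectSum.IsInternal gr) :
    Function.Bijective (DirectSum.coeLinearMap gr) := h

/-- The projection of a graded vector space to its component of degree `μ`. -/
noncomputable def gproj (h : DirectSum.IsInternal gr) (μ : Lat θ) : M →ₗ[k] M :=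
  (gr μ).subtype ∘ₗ DirectSum.component k (Lat θ) (fun ν => gr ν) μ ∘ₗ
    (LinearEquiv.ofBijective (DirectSum.coeLinearMap gr)
      (bijective_coeLinearMap h)).symm.toLinearMap

theorem gproj_mem (h : DirectSum.IsInternal gr) (μ : Lat θ) (m : M) : gproj h μ m ∈ gr μ := by
  simp [gproj]

theorem ofBijective_symm_of_mem (h : DirectSum.IsInternal gr) {μ : Lat θ} {m : M}
    (hm : m ∈ gr μ) :
    (LinearEquiv.ofBijective (DirectSum.coeLinearMap gr) (bijective_coeLinearMap h)).symm m =
      DirectSum.lof k (Lat θ) (fun ν => gr ν) μ ⟨m, hm⟩ := by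
  rw [LinearEquiv.symm_apply_eq]
  simp

theorem gproj_of_mem (h : DirectSum.IsInternal gr) {μ : Lat θ} {m : M} (hm : m ∈ gr μ) :
    gproj h μ m = m := by
  simp only [gproj, LinearMap.comp_apply, LinearEquiv.coe_coe, ofBijective_symm_of_mem h hm]
  rw [DirectSum.component.lof_self]
  rfl

theorem gproj_of_mem_ne (h : DirectSum.IsInternal gr) {μ ν : Lat θ} {m : M} (hm : m ∈ gr ν)
    (hne : ν ≠ μ) : gproj h μ m = 0 := by
  simp only [gproj, LinearMap.comp_apply, LinearEquiv.coe_coe, ofBijective_symm_of_mem h hm]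
  rw [DirectSum.component.of, dif_neg hne]
  simp

theorem mem_iff_gproj_eq (h : DirectSum.IsInternal gr) {μ : Lat θ} {m : M} :
    m ∈ gr μ ↔ gproj h μ m = m :=
  ⟨gproj_of_mem h, fun e => e ▸ gproj_mem h μ m⟩

/-- An element lies in a sum of subspaces as soon as its components do. -/
theorem mem_iSup_of_gproj (h : DirectSum.IsInternal gr) {N : Lat θ → Submodule k M} {m : M}
    (hm : ∀ μ, gproj h μ m ∈ N μ) : m ∈ ⨆ μ, N μ := by
  obtain ⟨d, rfl⟩ := h.2 m
  have hd : ∀ μ, gproj h μ (DirectSum.coeAddMonoidHom gr d) = d μ := by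
    intro μ
    change gproj h μ (LinearEquiv.ofBijective (DirectSum.coeLinearMap gr)
      (bijective_coeLinearMap h) d) = d μ
    simp only [gproj, LinearMap.comp_apply, LinearEquiv.coe_coe, LinearEquiv.symm_apply_apply]
    rfl
  classical
  rw [DirectSum.coeAddMonoidHom_eq_dfinsuppSum, DFinsupp.sum]
  refine Submodule.sum_mem _ fun μ _ => Submodule.mem_iSup_of_mem μ ?_
  rw [← hd]
  exact hm μ

/-- Induction on homogeneous elements. -/
theorem gr_induction (htop : ⨆ μ, gr μ = ⊤) {P : M → Prop} (h0 : P 0)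
    (hadd : ∀ x y, P x → P y → P (x + y)) (hgr : ∀ μ, ∀ m ∈ gr μ, P m) (m : M) : P m :=
  Submodule.iSup_induction gr (motive := P) (htop ▸ Submodule.mem_top) hgr h0 hadd

/-- An element of `gr μ` that is also a sum of elements of other components is killed by `p μ`,
hence zero. The target is arbitrary because for produced modules the separating maps are
restrictions of linear forms and not projections. -/
theorem isInternal_of_ker (htop : ⨆ μ, gr μ = ⊤) (p : Lat θ → M →ₗ[k] M')
    (h1 : ∀ μ, ∀ m ∈ gr μ, p μ m = 0 → m = 0) (h2 : ∀ μ ν, ν ≠ μ → ∀ m ∈ gr ν, p μ m = 0) :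
    DirectSum.IsInternal gr := by
  rw [DirectSum.isInternal_submodule_iff_iSupIndep_and_iSup_eq_top]
  refine ⟨fun μ => ?_, htop⟩
  rw [Submodule.disjoint_def]
  intro x hx hx'
  have hle : (⨆ ν, ⨆ (_ : ν ≠ μ), gr ν) ≤ LinearMap.ker (p μ) :=
    iSup₂_le fun ν hν m hm => h2 μ ν hν m hm
  exact h1 μ x hx (hle hx')

theorem isInternal_of_proj (htop : ⨆ μ, gr μ = ⊤) (p : Lat θ → M →ₗ[k] M)
    (h1 : ∀ μ, ∀ m ∈ gr μ, p μ m = m) (h2 : ∀ μ ν, ν ≠ μ → ∀ m ∈ gr ν, p μ m = 0) :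
    DirectSum.IsInternal gr :=
  isInternal_of_ker htop p (fun μ m hm h0 => (h1 μ m hm).symm.trans h0) h2

theorem map_gproj (h : DirectSum.IsInternal gr) (h' : DirectSum.IsInternal gr')
    (f : M →ₗ[k] M') (hf : ∀ μ, ∀ m ∈ gr μ, f m ∈ gr' μ) (μ : Lat θ) (m : M) :
    f (gproj h μ m) = gproj h' μ (f m) := by
  induction m using gr_induction h.submodule_iSup_eq_top with
  | h0 => simp
  | hadd x y hx hy => simp [hx, hy]
  | hgr ν m hm =>
    by_cases e : ν = μ
    · subst e
      rw [gproj_of_mem h hm, gproj_of_mem h' (hf _ _ hm)]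
    · rw [gproj_of_mem_ne h hm e, gproj_of_mem_ne h' (hf _ _ hm) e, map_zero]

/-- The hypothesis on the kernel says that it is graded. Then `π ∘ gproj ∘ s`, with `s` a linear
section, does not depend on `s` and is the projection of the quotient grading. -/
theorem isInternal_map_of_surjective (h : DirectSum.IsInternal gr) (π : M →ₗ[k] M')
    (hπ : Function.Surjective π) (hker : ∀ μ x, π x = 0 → π (gproj h μ x) = 0) :
    DirectSum.IsInternal fun μ => (gr μ).map π := by
  obtain ⟨s, hs⟩ := π.exists_rightInverse_of_surjective (LinearMap.range_eq_top.2 hπ)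
  have hp : ∀ μ x, π (gproj h μ (s (π x))) = π (gproj h μ x) := by
    intro μ x
    rw [← sub_eq_zero, ← map_sub, ← map_sub]
    refine hker μ _ ?_
    rw [map_sub, ← LinearMap.comp_apply, hs, LinearMap.id_apply, sub_self]
  refine isInternal_of_proj ?_ (fun μ => π ∘ₗ gproj h μ ∘ₗ s) ?_ ?_
  · rw [← Submodule.map_iSup, h.submodule_iSup_eq_top, Submodule.map_top, LinearMap.range_eq_top]
    exact hπ
  · rintro μ _ ⟨x, hx, rfl⟩
    rw [LinearMap.comp_apply, LinearMap.comp_apply, hp, gproj_of_mem _ hx]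
  · rintro μ ν hne _ ⟨x, hx, rfl⟩
    rw [LinearMap.comp_apply, LinearMap.comp_apply, hp, gproj_of_mem_ne _ hx hne, map_zero]

end Proj

/-! ### Graded submodules, graded maps and isomorphisms. -/

namespace GrMod

variable {k : Type u} [Field k] {θ : ℕ} {A : Type v} [Ring A] [Algebra k A]

/-- Stability under the projections is the form in which gradedness passes to intersections, sums,
images and preimages. -/
theorem isGradedSub_iff {M : GrMod.{u, v, w} k A θ} (h : DirectSum.IsInternal M.gr)
    (N : Submodule A M.carrier) :
    M.IsGradedSub N ↔ ∀ x ∈ N, ∀ μ, gproj h μ x ∈ N := by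
  refine ⟨fun hN x hx μ => ?_, fun hN x hx => ?_⟩
  · have hle : (⨆ μ, N.restrictScalars k ⊓ M.gr μ) ≤
        (N.restrictScalars k).comap (gproj h μ) := by
      refine iSup_le fun ν y hy => ?_
      by_cases e : ν = μ
      · subst e
        rw [Submodule.mem_comap, gproj_of_mem h hy.2]
        exact hy.1
      · rw [Submodule.mem_comap, gproj_of_mem_ne h hy.2 e]
        exact Submodule.zero_mem _
    exact hle (hN hx)
  · exact mem_iSup_of_gproj h fun μ => ⟨hN x hx μ, gproj_mem h μ x⟩

theorem IsGradedSub.bot (M : GrMod.{u, v, w} k A θ) : M.IsGradedSub ⊥ := by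
  intro x hx
  have : x = 0 := by simpa using hx
  rw [this]
  exact Submodule.zero_mem _

theorem IsGradedSub.inf {M : GrMod.{u, v, w} k A θ} (h : DirectSum.IsInternal M.gr)
    {N N' : Submodule A M.carrier} (hN : M.IsGradedSub N) (hN' : M.IsGradedSub N') :
    M.IsGradedSub (N ⊓ N') := by
  rw [isGradedSub_iff h] at *
  exact fun x hx μ => ⟨hN x hx.1 μ, hN' x hx.2 μ⟩

theorem IsGradedSub.sSup {M : GrMod.{u, v, w} k A θ} (h : DirectSum.IsInternal M.gr)
    {s : Set (Submodule A M.carrier)} (hs : ∀ N ∈ s, M.IsGradedSub N) :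
    M.IsGradedSub (sSup s) := by
  rw [isGradedSub_iff h]
  intro x hx μ
  rw [sSup_eq_iSup'] at hx ⊢
  induction hx using Submodule.iSup_induction' with
  | mem i x hx =>
    exact Submodule.mem_iSup_of_mem i ((isGradedSub_iff h _).1 (hs i i.2) x hx μ)
  | zero => simp
  | add x y _ _ hx hy => rw [map_add]; exact Submodule.add_mem _ hx hy

section Maps

variable {M : GrMod.{u, v, w} k A θ} {N : GrMod.{u, v, w'} k A θ}
  (hM : DirectSum.IsInternal M.gr) (hN : DirectSum.IsInternal N.gr)
  (f : M.carrier →ₗ[A] N.carrier) (hf : ∀ μ, ∀ m ∈ M.gr μ, f m ∈ N.gr μ)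
include hM hN hf

theorem map_gproj' (μ : Lat θ) (m : M.carrier) : f (gproj hM μ m) = gproj hN μ (f m) :=
  map_gproj hM hN (f.restrictScalars k) hf μ m

theorem IsGradedSub.comap {P : Submodule A N.carrier} (hP : N.IsGradedSub P) :
    M.IsGradedSub (P.comap f) := by
  rw [isGradedSub_iff hM]
  intro x hx μ
  rw [Submodule.mem_comap, map_gproj' hM hN f hf]
  exact (isGradedSub_iff hN _).1 hP _ hx μ

theorem IsGradedSub.map {P : Submodule A M.carrier} (hP : M.IsGradedSub P) :
    N.IsGradedSub (P.map f) := by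
  rw [isGradedSub_iff hN]
  rintro _ ⟨x, hx, rfl⟩ μ
  rw [← map_gproj' hM hN f hf]
  exact ⟨_, (isGradedSub_iff hM _).1 hP x hx μ, rfl⟩

/-- A bijective graded map is an isomorphism of graded modules. -/
theorem nonempty_iso_of_bijective (hb : Function.Bijective f) : Nonempty (M.Iso N) :=
  ⟨⟨LinearEquiv.ofBijective f hb, fun μ m => ⟨hf μ m, fun h => by
    rw [mem_iff_gproj_eq hM]
    apply hb.1
    rw [map_gproj' hM hN f hf]
    exact gproj_of_mem hN h⟩⟩⟩

end Maps

/-- The inverse isomorphism. -/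
def Iso.symm {M : GrMod.{u, v, w} k A θ} {N : GrMod.{u, v, w'} k A θ} (e : M.Iso N) : N.Iso M :=
  ⟨e.toEquiv.symm, fun μ m => by rw [e.mem_gr, LinearEquiv.apply_symm_apply]⟩

/-- The composition of isomorphisms. -/
def Iso.trans {M : GrMod.{u, v, w} k A θ} {N : GrMod.{u, v, w'} k A θ}
    {P : GrMod.{u, v, w''} k A θ} (e : M.Iso N) (e' : N.Iso P) : M.Iso P :=
  ⟨e.toEquiv.trans e'.toEquiv, fun μ m => by rw [e.mem_gr, e'.mem_gr, LinearEquiv.trans_apply]⟩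

theorem Iso.isInternal {M : GrMod.{u, v, w} k A θ} {N : GrMod.{u, v, w'} k A θ} (e : M.Iso N)
    (h : DirectSum.IsInternal M.gr) : DirectSum.IsInternal N.gr := by
  let e' : M.carrier ≃ₗ[k] N.carrier := e.toEquiv.restrictScalars k
  have hgr : ∀ μ, ∀ m ∈ N.gr μ, e'.symm m ∈ M.gr μ := fun μ m hm => by
    rw [e.mem_gr]
    simpa [e'] using hm
  have htop : ⨆ μ, N.gr μ = ⊤ := by
    rw [eq_top_iff]
    intro x _
    obtain ⟨y, rfl⟩ := e'.surjective x
    induction y using gr_induction h.submodule_iSup_eq_top with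
    | h0 => simp
    | hadd x y hx hy =>
      rw [map_add]; exact Submodule.add_mem _ (hx Submodule.mem_top) (hy Submodule.mem_top)
    | hgr ν m hm => exact Submodule.mem_iSup_of_mem ν ((e.mem_gr _ _).1 hm)
  refine isInternal_of_proj htop (fun μ => e'.toLinearMap ∘ₗ gproj h μ ∘ₗ e'.symm.toLinearMap)
    (fun μ m hm => ?_) (fun μ ν hne m hm => ?_)
  · simp [gproj_of_mem h (hgr _ _ hm)]
  · simp [gproj_of_mem_ne h (hgr _ _ hm) hne]

end GrMod

/-! ### The free algebra and its grading -/

section Free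

variable {k : Type u} [Field k] {θ : ℕ} {X : Type v}

/-- The comultiplication, the skew derivations and the actions below are all given by a recursion
for left multiplication by a generator, and this is the matching induction principle. -/
theorem word_induction {P : FreeAlgebra k X → Prop} (h1 : P 1)
    (hι : ∀ i x, P x → P (FreeAlgebra.ι k i * x)) (hadd : ∀ x y, P x → P y → P (x + y))
    (hsmul : ∀ (c : k) x, P x → P (c • x)) (x : FreeAlgebra k X) : P x := by
  -- Strengthened claim: left multiplication by `x` preserves `P`. In this form the product case is
  -- immediate.
  have h : ∀ y, P y → P (x * y) := by
    induction x using FreeAlgebra.induction with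
    | grade0 r => intro y hy; rw [← Algebra.smul_def]; exact hsmul r y hy
    | grade1 i => exact hι i
    | mul a b ha hb => intro y hy; rw [mul_assoc]; exact ha _ (hb _ hy)
    | add a b ha hb => intro y hy; rw [add_mul]; exact hadd _ _ (ha _ hy) (hb _ hy)
  simpa using h 1 h1

/-- Linear maps on the free algebra are determined by a recursion for left multiplication. -/
theorem free_hom_ext {M : Type*} [AddCommGroup M] [Module k M] {f g : FreeAlgebra k X →ₗ[k] M}
    (h1 : f 1 = g 1) (hι : ∀ i x, f x = g x → f (FreeAlgebra.ι k i * x) =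
      g (FreeAlgebra.ι k i * x)) : f = g := by
  ext x
  induction x using word_induction with
  | h1 => exact h1
  | hι i x hx => exact hι i x hx
  | hadd x y hx hy => rw [map_add, map_add, hx, hy]
  | hsmul c x hx => rw [map_smul, map_smul, hx]

@[simp] theorem word_nil : word (k := k) ([] : List X) = 1 := rfl

@[simp] theorem word_cons (a : X) (l : List X) :
    word (k := k) (a :: l) = FreeAlgebra.ι k a * word l := by simp [word]

@[simp] theorem word_append (l l' : List X) :
    word (k := k) (l ++ l') = word l * word l' := by simp [word]

theorem word_mem_homog (d : X → Lat θ) (l : List X) : word l ∈ homog k d (l.map d).sum :=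
  Submodule.subset_span ⟨l, rfl, rfl⟩

theorem one_mem_homog (d : X → Lat θ) : (1 : FreeAlgebra k X) ∈ homog k d 0 :=
  word_mem_homog d []

theorem homog_induction {d : X → Lat θ} {β : Lat θ} {P : ∀ x, x ∈ homog k d β → Prop}
    (hw : ∀ (l : List X) (hl : (l.map d).sum = β), P (word l) (hl ▸ word_mem_homog d l))
    (hadd : ∀ x y {hx : x ∈ homog k d β} {hy : y ∈ homog k d β}, P x hx → P y hy →
      P (x + y) (add_mem hx hy))
    (hsmul : ∀ (c : k) x {hx : x ∈ homog k d β}, P x hx → P (c • x) (Submodule.smul_mem _ c hx))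
    (h0 : P 0 (zero_mem _)) {x : FreeAlgebra k X} (hx : x ∈ homog k d β) : P x hx := by
  refine Submodule.span_induction (p := P) ?_ h0 (fun x y _ _ => hadd x y)
    (fun c x _ => hsmul c x) hx
  rintro _ ⟨l, hl, rfl⟩
  exact hw l hl

theorem homog_mul {d : X → Lat θ} {β γ : Lat θ} {x y : FreeAlgebra k X}
    (hx : x ∈ homog k d β) (hy : y ∈ homog k d γ) : x * y ∈ homog k d (β + γ) := by
  induction hx using homog_induction with
  | h0 => simp
  | hadd a b ha hb => rw [add_mul]; exact add_mem ha hb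
  | hsmul c a ha => rw [smul_mul_assoc]; exact Submodule.smul_mem _ _ ha
  | hw l hl =>
    induction hy using homog_induction with
    | h0 => simp
    | hadd a b ha hb => rw [mul_add]; exact add_mem ha hb
    | hsmul c a ha => rw [mul_smul_comm]; exact Submodule.smul_mem _ _ ha
    | hw l' hl' =>
      rw [← word_append, ← hl, ← hl', ← List.sum_append, ← List.map_append]
      exact word_mem_homog d _

theorem ι_mem_homog (d : X → Lat θ) (i : X) : FreeAlgebra.ι k i ∈ homog k d (d i) := by
  simpa using word_mem_homog (k := k) d [i]

theorem iSup_homog (d : X → Lat θ) : ⨆ β, homog k d β = ⊤ := by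
  rw [eq_top_iff]
  intro x _
  induction x using word_induction with
  | h1 => exact Submodule.mem_iSup_of_mem 0 (one_mem_homog d)
  | hι i x hx =>
    have hle : (⨆ β, homog k d β) ≤
        (⨆ β, homog k d β).comap (LinearMap.mulLeft k (FreeAlgebra.ι k i)) :=
      iSup_le fun β y hy => Submodule.mem_iSup_of_mem (d i + β) (homog_mul (ι_mem_homog d i) hy)
    exact hle (hx Submodule.mem_top)
  | hadd x y hx hy => exact add_mem (hx Submodule.mem_top) (hy Submodule.mem_top)
  | hsmul c x hx => exact Submodule.smul_mem _ c (hx Submodule.mem_top)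

/-- The algebra map `T(X) → A[Λ]` sending a generator `x` to `f x` in degree `d x`. -/
noncomputable def coactLift {A : Type w} [Ring A] [Algebra k A] (d : X → Lat θ) (f : X → A) :
    FreeAlgebra k X →ₐ[k] AddMonoidAlgebra A (Lat θ) :=
  FreeAlgebra.lift k fun x => AddMonoidAlgebra.single (d x) (f x)

/-- A `Λ`-grading is a coaction of the group algebra of `Λ`; homogeneous elements are those that the
coaction sends to a single degree. This also handles algebras given by relations, since an algebra
map out of a quotient only needs to be checked on the relations. -/
theorem coactLift_of_mem {A : Type w} [Ring A] [Algebra k A] (d : X → Lat θ) (f : X → A)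
    {β : Lat θ} {x : FreeAlgebra k X} (hx : x ∈ homog k d β) :
    coactLift d f x = AddMonoidAlgebra.single β (FreeAlgebra.lift k f x) := by
  induction hx using homog_induction with
  | h0 => simp
  | hadd a b ha hb => rw [map_add, ha, hb, map_add, AddMonoidAlgebra.single_add]
  | hsmul c a ha => rw [map_smul, ha, map_smul, AddMonoidAlgebra.smul_single]
  | hw l hl =>
    rw [← hl]
    clear hl
    induction l with
    | nil => simp [AddMonoidAlgebra.one_def]
    | cons a l ih =>
      rw [word_cons, map_mul, ih, map_mul]
      simp [coactLift, AddMonoidAlgebra.single_mul_single]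

/-- The coefficient of degree `β` of an element of `A[Λ]`. -/
noncomputable def coeffHom (k : Type u) [Field k] (A : Type w) [Ring A] [Algebra k A]
    (β : Lat θ) : AddMonoidAlgebra A (Lat θ) →ₗ[k] A where
  toFun z := z.coeff β
  map_add' x y := by simp
  map_smul' c x := by simp

theorem coeffHom_single {A : Type w} [Ring A] [Algebra k A] (β γ : Lat θ) (a : A) :
    coeffHom k A β (AddMonoidAlgebra.single γ a) = if γ = β then a else 0 := by
  change (AddMonoidAlgebra.single γ a).coeff β = _
  rw [AddMonoidAlgebra.coeff_single, Finsupp.single_apply]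

/-- The coefficient of degree `β` of the coaction is the projection to the component of degree `β`.
-/
theorem isInternal_homog (d : X → Lat θ) : DirectSum.IsInternal (homog k d) := by
  have hι : ∀ x : FreeAlgebra k X, FreeAlgebra.lift k (FreeAlgebra.ι k) x = x := fun x => by
    rw [show FreeAlgebra.lift k (FreeAlgebra.ι k) = AlgHom.id k (FreeAlgebra k X) by ext; simp]
    rfl
  refine isInternal_of_proj (iSup_homog d) (fun β => coeffHom k _ β ∘ₗ
    (coactLift d (FreeAlgebra.ι k)).toLinearMap) (fun β x hx => ?_) (fun β γ hne x hx => ?_)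
  · simp [coactLift_of_mem d _ hx, coeffHom_single, hι]
  · simp [coactLift_of_mem d _ hx, coeffHom_single, hne]

/-- The degree of a monomial in the `vᵢ` is non-negative. -/
theorem homog_alpha_eq_bot {β : Lat θ} (h : ¬ 0 ≤ β) : homog k (alpha (θ := θ)) β = ⊥ := by
  rw [homog, Submodule.span_eq_bot]
  rintro _ ⟨l, hl, rfl⟩
  refine absurd ?_ h
  rw [← hl]
  refine List.sum_nonneg ?_
  simp only [List.mem_map]
  rintro _ ⟨i, _, rfl⟩
  exact Pi.single_nonneg.2 zero_le_one

theorem sum_map_alpha_eq_zero {l : List (Fin θ)} (h : (l.map alpha).sum = 0) : l = [] := by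
  have h1 : ∀ i, 0 ≤ alpha (θ := θ) i := fun i => Pi.single_nonneg.2 zero_le_one
  cases l with
  | nil => rfl
  | cons a l =>
    exfalso
    have h2 : 0 ≤ (l.map alpha).sum := by
      refine List.sum_nonneg ?_
      simp only [List.mem_map]
      rintro _ ⟨i, _, rfl⟩
      exact h1 i
    have h3 := congrFun h a
    have h4 := h2 a
    simp [alpha] at h3 h4
    omega

theorem homog_alpha_zero {x : FreeAlgebra k (Fin θ)} (hx : x ∈ homog k alpha 0) :
    ∃ c : k, x = c • 1 := by
  induction hx using homog_induction with
  | hw l hl => exact ⟨1, by simp [sum_map_alpha_eq_zero hl]⟩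
  | h0 => exact ⟨0, by simp⟩
  | hadd x y hx hy =>
    obtain ⟨c, rfl⟩ := hx
    obtain ⟨d, rfl⟩ := hy
    exact ⟨c + d, by rw [add_smul]⟩
  | hsmul a x hx =>
    obtain ⟨c, rfl⟩ := hx
    exact ⟨a * c, by rw [mul_smul]⟩

/-- The algebra endomorphism of `T(V)` which multiplies `vᵢ` by `c i`. -/
noncomputable def scale (c : Fin θ → kˣ) : FreeAlgebra k (Fin θ) →ₐ[k] FreeAlgebra k (Fin θ) :=
  FreeAlgebra.lift k fun j => (c j : k) • FreeAlgebra.ι k j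

@[simp] theorem scale_ι (c : Fin θ → kˣ) (j : Fin θ) :
    scale (k := k) c (FreeAlgebra.ι k j) = (c j : k) • FreeAlgebra.ι k j := by simp [scale]

theorem twist_eq_scale (q : Fin θ → Fin θ → kˣ) (i : Fin θ) : twist q i = scale (q i) := rfl

theorem scale_scale (c d : Fin θ → kˣ) (x : FreeAlgebra k (Fin θ)) :
    scale c (scale d x) = scale (c * d) x := by
  rw [← AlgHom.comp_apply]
  congr 1
  ext i
  simp [smul_smul, mul_comm]

theorem scale_one (x : FreeAlgebra k (Fin θ)) : scale 1 x = x := by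
  rw [show scale (k := k) (1 : Fin θ → kˣ) = AlgHom.id k _ by ext; simp]
  rfl

theorem scale_word (c : Fin θ → kˣ) (l : List (Fin θ)) :
    scale (k := k) c (word l) = ((l.map c).prod : k) • word l := by
  induction l with
  | nil => simp
  | cons a l ih => simp [ih, smul_smul, mul_comm]

theorem scale_of_mem (c : Fin θ → kˣ) {β : Lat θ} {x : FreeAlgebra k (Fin θ)}
    (hx : x ∈ homog k alpha β) : scale c x = ((∏ i, c i ^ β i : kˣ) : k) • x := by
  induction hx using homog_induction with
  | hw l hl =>
    rw [scale_word, ← hl, ← prod_eq_of_degree]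
  | h0 => simp
  | hadd x y hx hy => rw [map_add, hx, hy, smul_add]
  | hsmul a x hx => rw [map_smul, hx, smul_comm]

end Free

/-! ### Skew derivations -/

section Skew

variable {k : Type u} [Field k] {θ : ℕ}

/-- The counit of `T(V)`. -/
noncomputable def counit (k : Type u) [Field k] (θ : ℕ) : FreeAlgebra k (Fin θ) →ₐ[k] k :=
  FreeAlgebra.lift k fun _ => 0

/-- The coefficient of `vᵢ`. -/
noncomputable def coef (k : Type u) [Field k] {θ : ℕ} (i : Fin θ) :
    FreeAlgebra k (Fin θ) →ₗ[k] k :=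
  -- Dual numbers: sending `vⱼ` to `δᵢⱼ ε` with `ε² = 0` kills all words of length at least two, and
  -- the coefficient of `ε` is that of `vᵢ`.
  TrivSqZeroExt.sndHom k k ∘ₗ (FreeAlgebra.lift k fun j : Fin θ =>
    (TrivSqZeroExt.inr (if j = i then 1 else 0) : TrivSqZeroExt k k)).toLinearMap

@[simp] theorem counit_ι (i : Fin θ) : counit k θ (FreeAlgebra.ι k i) = 0 := by simp [counit]

@[simp] theorem coef_one (i : Fin θ) : coef k i 1 = 0 := by simp [coef]

theorem coef_ι_mul (i j : Fin θ) (x : FreeAlgebra k (Fin θ)) :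
    coef k i (FreeAlgebra.ι k j * x) = if j = i then counit k θ x else 0 := by
  have h : ∀ y, TrivSqZeroExt.fst (FreeAlgebra.lift k (fun j : Fin θ =>
      (TrivSqZeroExt.inr (if j = i then 1 else 0) : TrivSqZeroExt k k)) y) = counit k θ y := by
    intro y
    rw [← TrivSqZeroExt.fstHom_apply (R := k) (S := k), ← AlgHom.comp_apply]
    congr 1
    ext j
    by_cases hj : j = i <;> simp [hj]
  simp only [coef, LinearMap.comp_apply, AlgHom.toLinearMap_apply, map_mul,
    TrivSqZeroExt.sndHom_apply, TrivSqZeroExt.snd_mul, FreeAlgebra.lift_ι_apply, h]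
  split_ifs <;> simp

theorem counit_scale (c : Fin θ → kˣ) (x : FreeAlgebra k (Fin θ)) :
    counit k θ (scale c x) = counit k θ x := by
  rw [← AlgHom.comp_apply]
  congr 1
  ext i
  simp

/-- This is where generation in degrees `≥ 2` matters: a Hopf ideal of the class is invisible to the
linear coefficients, so skew derivations preserve it. -/
theorem coef_of_mem_degGeTwo (i : Fin θ) {x : FreeAlgebra k (Fin θ)} (hx : x ∈ degGeTwo k θ) :
    coef k i x = 0 := by
  rw [← LinearMap.mem_ker]
  refine (Submodule.span_le.2 ?_ : degGeTwo k θ ≤ _) hx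
  rintro _ ⟨l, hl, rfl⟩
  match l, hl with
  | a :: b :: l, _ => simp [coef_ι_mul]

variable (q : Fin θ → Fin θ → kˣ)

@[simp] theorem braidedComul_one : braidedComul q 1 = 1 ⊗ₜ[k] 1 := by simp [braidedComul]

theorem braidedComul_ι_mul (i : Fin θ) (x : FreeAlgebra k (Fin θ)) :
    braidedComul q (FreeAlgebra.ι k i * x) = mulPrimitive q i (braidedComul q x) := by
  simp [braidedComul]

/-- The left skew derivation `∂ᵢ`: the part of the comultiplication in `vᵢ ⊗ T(V)`. -/
noncomputable def derivL (i : Fin θ) : FreeAlgebra k (Fin θ) →ₗ[k] FreeAlgebra k (Fin θ) :=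
  (TensorProduct.lid k _).toLinearMap ∘ₗ TensorProduct.map (coef k i) LinearMap.id ∘ₗ
    braidedComul q

/-- The right skew derivation `∂ᵢ`: the part of the comultiplication in `T(V) ⊗ vᵢ`. -/
noncomputable def derivR (i : Fin θ) : FreeAlgebra k (Fin θ) →ₗ[k] FreeAlgebra k (Fin θ) :=
  (TensorProduct.rid k _).toLinearMap ∘ₗ TensorProduct.map LinearMap.id (coef k i) ∘ₗ
    braidedComul q

/-- One half of the counit axiom for the braided comultiplication; it identifies the
undifferentiated term in the Leibniz rule for `derivL`. -/
theorem counit_left (x : FreeAlgebra k (Fin θ)) :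
    TensorProduct.lid k _ (TensorProduct.map (counit k θ).toLinearMap LinearMap.id
      (braidedComul q x)) = x := by
  suffices h : (TensorProduct.lid k _).toLinearMap ∘ₗ TensorProduct.map
      (counit k θ).toLinearMap LinearMap.id ∘ₗ braidedComul q = LinearMap.id from
    LinearMap.congr_fun h x
  refine free_hom_ext (by simp) fun i x hx => ?_
  simp only [LinearMap.comp_apply, LinearMap.id_apply, LinearEquiv.coe_coe] at hx ⊢
  conv_rhs => rw [← hx]
  rw [braidedComul_ι_mul]
  induction braidedComul q x using TensorProduct.induction_on with
  | zero => simp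
  | tmul a b => simp [mulPrimitive, twist_eq_scale, counit_scale]
  | add a b ha hb => simp only [map_add, ha, hb, mul_add]

theorem counit_right (x : FreeAlgebra k (Fin θ)) :
    TensorProduct.rid k _ (TensorProduct.map LinearMap.id (counit k θ).toLinearMap
      (braidedComul q x)) = x := by
  suffices h : (TensorProduct.rid k _).toLinearMap ∘ₗ TensorProduct.map
      LinearMap.id (counit k θ).toLinearMap ∘ₗ braidedComul q = LinearMap.id from
    LinearMap.congr_fun h x
  refine free_hom_ext (by simp) fun i x hx => ?_
  simp only [LinearMap.comp_apply, LinearMap.id_apply, LinearEquiv.coe_coe] at hx ⊢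
  conv_rhs => rw [← hx]
  rw [braidedComul_ι_mul]
  induction braidedComul q x using TensorProduct.induction_on with
  | zero => simp
  | tmul a b => simp [mulPrimitive]
  | add a b ha hb => simp only [map_add, ha, hb, mul_add]

@[simp] theorem derivL_one (i : Fin θ) : derivL q i 1 = 0 := by simp [derivL]

@[simp] theorem derivR_one (i : Fin θ) : derivR q i 1 = 0 := by simp [derivR]

theorem derivL_ι_mul (i j : Fin θ) (x : FreeAlgebra k (Fin θ)) :
    derivL q i (FreeAlgebra.ι k j * x) = (if j = i then x else 0) +
      (q j i : k) • (FreeAlgebra.ι k j * derivL q i x) := by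
  -- Writing the undifferentiated `x` as `(ε ⊗ id) Δ(x)` makes both sides linear in `Δ(x)`, so the
  -- identity can be checked on pure tensors.
  conv_rhs => enter [1]; rw [← counit_left q x]
  simp only [derivL, LinearMap.comp_apply, LinearEquiv.coe_coe]
  rw [braidedComul_ι_mul]
  have hs : ∀ a : FreeAlgebra k (Fin θ), coef k i (scale (q j) a) = (q j i : k) * coef k i a := by
    intro a
    suffices h : coef k i ∘ₗ (scale (q j)).toLinearMap = (q j i : k) • coef k i from
      LinearMap.congr_fun h a
    refine free_hom_ext (by simp) fun l x _ => ?_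
    by_cases hl : l = i <;> simp [coef_ι_mul, counit_scale, hl]
  induction braidedComul q x using TensorProduct.induction_on with
  | zero => simp
  | tmul a b =>
    simp only [mulPrimitive, LinearMap.add_apply, TensorProduct.map_tmul, map_add,
      LinearMap.mulLeft_apply, LinearMap.id_apply, AlgHom.toLinearMap_apply, TensorProduct.lid_tmul,
      coef_ι_mul, twist_eq_scale, hs, mul_smul_comm, smul_smul]
    split_ifs <;> simp
  | add a b ha hb =>
    simp only [map_add, ha, hb, mul_add, smul_add]
    split_ifs <;> abel

/-- The Leibniz rule twists the other term than for `derivL`: in `(1 ⊗ vⱼ)(a ⊗ b) = (αⱼ · a) ⊗ vⱼ b`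
the action falls on the factor that survives. -/
theorem derivR_ι_mul (i j : Fin θ) (x : FreeAlgebra k (Fin θ)) :
    derivR q i (FreeAlgebra.ι k j * x) = FreeAlgebra.ι k j * derivR q i x +
      (if j = i then twist q i x else 0) := by
  conv_rhs => enter [2]; rw [← counit_right q x]
  simp only [derivR, LinearMap.comp_apply, LinearEquiv.coe_coe]
  rw [braidedComul_ι_mul]
  induction braidedComul q x using TensorProduct.induction_on with
  | zero => simp
  | tmul a b =>
    simp only [mulPrimitive, LinearMap.add_apply, TensorProduct.map_tmul, map_add,
      LinearMap.mulLeft_apply, LinearMap.id_apply, AlgHom.toLinearMap_apply, TensorProduct.rid_tmul,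
      coef_ι_mul, mul_smul_comm, map_smul]
    split_ifs with h
    · simp [h]
    · simp
  | add a b ha hb =>
    simp only [map_add, ha, hb, mul_add]
    split_ifs
    · abel
    · abel

end Skew

/-! ### The ideal of relations of a Nichols algebra -/

section Ideal

variable {k : Type u} [Field k] {θ : ℕ} {q : Fin θ → Fin θ → kˣ}

/-- In `Δ(I) ⊆ I ⊗ T + T ⊗ I` the coefficient map kills the left factor of `I ⊗ T` and sends `T ⊗ I`
into `I`. -/
theorem IsHopfIdeal.derivL_mem {I : Submodule k (FreeAlgebra k (Fin θ))} (hI : IsHopfIdeal q I)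
    (i : Fin θ) {x : FreeAlgebra k (Fin θ)} (hx : x ∈ I) : derivL q i x ∈ I := by
  refine (sup_le ?_ ?_ : _ ≤ I.comap ((TensorProduct.lid k _).toLinearMap ∘ₗ
    TensorProduct.map (coef k i) LinearMap.id)) (hI.coideal x hx)
  · rintro _ ⟨t, rfl⟩
    induction t using TensorProduct.induction_on with
    | zero => simp
    | tmul a b => simp [coef_of_mem_degGeTwo i (hI.degree a.2)]
    | add a b ha hb => rw [map_add]; exact add_mem ha hb
  · rintro _ ⟨t, rfl⟩
    induction t using TensorProduct.induction_on with
    | zero => simp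
    | tmul a b => simpa using I.smul_mem _ b.2
    | add a b ha hb => rw [map_add]; exact add_mem ha hb

theorem IsHopfIdeal.derivR_mem {I : Submodule k (FreeAlgebra k (Fin θ))} (hI : IsHopfIdeal q I)
    (i : Fin θ) {x : FreeAlgebra k (Fin θ)} (hx : x ∈ I) : derivR q i x ∈ I := by
  refine (sup_le ?_ ?_ : _ ≤ I.comap ((TensorProduct.rid k _).toLinearMap ∘ₗ
    TensorProduct.map LinearMap.id (coef k i))) (hI.coideal x hx)
  · rintro _ ⟨t, rfl⟩
    induction t using TensorProduct.induction_on with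
    | zero => simp
    | tmul a b => simpa using I.smul_mem _ a.2
    | add a b ha hb => rw [map_add]; exact add_mem ha hb
  · rintro _ ⟨t, rfl⟩
    induction t using TensorProduct.induction_on with
    | zero => simp
    | tmul a b => simp [coef_of_mem_degGeTwo i (hI.degree b.2)]
    | add a b ha hb => rw [map_add]; exact add_mem ha hb

/-- A linear map which preserves all Hopf ideals preserves the defining ideal of the Nichols
algebra. -/
theorem nicholsIdeal_map_mem {f : FreeAlgebra k (Fin θ) →ₗ[k] FreeAlgebra k (Fin θ)}
    (hf : ∀ I, IsHopfIdeal q I → ∀ x ∈ I, f x ∈ I) {x : FreeAlgebra k (Fin θ)}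
    (hx : x ∈ nicholsIdeal q) : f x ∈ nicholsIdeal q :=
  (sSup_le fun I hI y hy => (le_sSup hI : I ≤ nicholsIdeal q) (hf I hI y hy) :
    nicholsIdeal q ≤ (nicholsIdeal q).comap f) hx

theorem derivL_mem_nicholsIdeal (i : Fin θ) {x : FreeAlgebra k (Fin θ)}
    (hx : x ∈ nicholsIdeal q) : derivL q i x ∈ nicholsIdeal q :=
  nicholsIdeal_map_mem (fun _ hI _ hx => hI.derivL_mem i hx) hx

theorem derivR_mem_nicholsIdeal (i : Fin θ) {x : FreeAlgebra k (Fin θ)}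
    (hx : x ∈ nicholsIdeal q) : derivR q i x ∈ nicholsIdeal q :=
  nicholsIdeal_map_mem (fun _ hI _ hx => hI.derivR_mem i hx) hx

theorem mul_mem_nicholsIdeal_left (a : FreeAlgebra k (Fin θ)) {x : FreeAlgebra k (Fin θ)}
    (hx : x ∈ nicholsIdeal q) : a * x ∈ nicholsIdeal q :=
  nicholsIdeal_map_mem (f := LinearMap.mulLeft k a) (fun _ hI x hx => hI.mul_left a x hx) hx

theorem mul_mem_nicholsIdeal_right (a : FreeAlgebra k (Fin θ)) {x : FreeAlgebra k (Fin θ)}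
    (hx : x ∈ nicholsIdeal q) : x * a ∈ nicholsIdeal q :=
  nicholsIdeal_map_mem (f := LinearMap.mulRight k a) (fun _ hI x hx => hI.mul_right a x hx) hx

theorem nicholsIdeal_le_degGeTwo : nicholsIdeal q ≤ degGeTwo k θ := sSup_le fun _ hI => hI.degree

theorem nicholsIdeal_homogeneous :
    nicholsIdeal q ≤ ⨆ β : Lat θ, nicholsIdeal q ⊓ homog k alpha β :=
  sSup_le fun _ hI => hI.homogeneous.trans (iSup_mono fun _ => inf_le_inf_right _ (le_sSup hI))

theorem scale_mem_of_homogeneous {I : Submodule k (FreeAlgebra k (Fin θ))}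
    (hI : I ≤ ⨆ β : Lat θ, I ⊓ homog k alpha β) (c : Fin θ → kˣ) {x : FreeAlgebra k (Fin θ)}
    (hx : x ∈ I) : scale c x ∈ I := by
  refine (iSup_le fun β y hy => ?_ : _ ≤ I.comap (scale c).toLinearMap) (hI hx)
  rw [Submodule.mem_comap, AlgHom.toLinearMap_apply, scale_of_mem c hy.2]
  exact I.smul_mem _ hy.1

theorem scale_mem_nicholsIdeal (c : Fin θ → kˣ) {x : FreeAlgebra k (Fin θ)}
    (hx : x ∈ nicholsIdeal q) : scale c x ∈ nicholsIdeal q :=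
  scale_mem_of_homogeneous nicholsIdeal_homogeneous c hx

theorem gproj_mem_nicholsIdeal {x : FreeAlgebra k (Fin θ)} (hx : x ∈ nicholsIdeal q)
    (β : Lat θ) : gproj (isInternal_homog alpha) β x ∈ nicholsIdeal q := by
  refine (iSup_le fun γ y hy => ?_ : _ ≤ (nicholsIdeal q).comap
    (gproj (isInternal_homog (k := k) alpha) β)) (nicholsIdeal_homogeneous hx)
  rw [Submodule.mem_comap]
  by_cases e : γ = β
  · subst e
    rw [gproj_of_mem _ hy.2]
    exact hy.1
  · rw [gproj_of_mem_ne _ hy.2 e]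
    exact Submodule.zero_mem _

/-! ### Comparison of the Nichols ideals of `q` and `q⁻¹`. -/

variable (q) in
/-- The inverse of the braiding of `T(V)`, for a symmetric matrix. -/
noncomputable def invBraiding : FreeAlgebra k (Fin θ) ⊗[k] FreeAlgebra k (Fin θ) →ₗ[k]
    FreeAlgebra k (Fin θ) ⊗[k] FreeAlgebra k (Fin θ) :=
  -- Recursion on the second factor: `vⱼ` acts on `T ⊗ T` by multiplying on the left factor and
  -- rescaling the right one, and `a ⊗ b` goes to `b` acting on `1 ⊗ a`.
  TensorProduct.lift (LinearMap.flip
    ((LinearMap.lcomp k _ (TensorProduct.mk k (FreeAlgebra k (Fin θ)) (FreeAlgebra k (Fin θ)) 1)) ∘ₗ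
      (FreeAlgebra.lift k fun j => (TensorProduct.map (LinearMap.mulLeft k (FreeAlgebra.ι k j))
        (scale fun i => (q i j)⁻¹).toLinearMap :
          Module.End k (FreeAlgebra k (Fin θ) ⊗[k] FreeAlgebra k (Fin θ)))).toLinearMap))

theorem invBraiding_one (a : FreeAlgebra k (Fin θ)) :
    invBraiding q (a ⊗ₜ 1) = 1 ⊗ₜ a := by simp [invBraiding]

theorem invBraiding_ι_mul (a : FreeAlgebra k (Fin θ)) (j : Fin θ) (b : FreeAlgebra k (Fin θ)) :
    invBraiding q (a ⊗ₜ (FreeAlgebra.ι k j * b)) =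
      TensorProduct.map (LinearMap.mulLeft k (FreeAlgebra.ι k j))
        (scale fun i => (q i j)⁻¹).toLinearMap (invBraiding q (a ⊗ₜ b)) := by
  simp [invBraiding]

theorem invBraiding_scale (c : Fin θ → kˣ) (a b : FreeAlgebra k (Fin θ)) :
    invBraiding q (scale c a ⊗ₜ b) =
      TensorProduct.map LinearMap.id (scale c).toLinearMap (invBraiding q (a ⊗ₜ b)) := by
  induction b using word_induction with
  | h1 => simp [invBraiding_one]
  | hι j b hb =>
    rw [invBraiding_ι_mul, hb, invBraiding_ι_mul]
    induction invBraiding q (a ⊗ₜ b) using TensorProduct.induction_on with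
    | zero => simp
    | tmul x y => simp [scale_scale, mul_comm]
    | add x y hx hy => simp only [map_add, hx, hy]
  | hadd x y hx hy => simp only [TensorProduct.tmul_add, map_add, hx, hy]
  | hsmul c x hx => simp only [TensorProduct.tmul_smul, map_smul, hx]

theorem invBraiding_mul_left (i : Fin θ) (a b : FreeAlgebra k (Fin θ)) :
    invBraiding q ((FreeAlgebra.ι k i * a) ⊗ₜ b) = TensorProduct.map (twist q⁻¹ i).toLinearMap
      (LinearMap.mulLeft k (FreeAlgebra.ι k i)) (invBraiding q (a ⊗ₜ b)) := by
  induction b using word_induction with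
  | h1 => simp [invBraiding_one]
  | hι j b hb =>
    rw [invBraiding_ι_mul, hb, invBraiding_ι_mul]
    induction invBraiding q (a ⊗ₜ b) using TensorProduct.induction_on with
    | zero => simp
    | tmul x y => simp [twist_eq_scale, TensorProduct.smul_tmul]
    | add x y hx hy => simp only [map_add, hx, hy]
  | hadd x y hx hy => simp only [TensorProduct.tmul_add, map_add, hx, hy]
  | hsmul c x hx => simp only [TensorProduct.tmul_smul, map_smul, hx]

/-- The comultiplication for the inverse matrix is the opposite comultiplication. -/
theorem braidedComul_inv (hq : ∀ i j, q i j = q j i) (x : FreeAlgebra k (Fin θ)) :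
    braidedComul q⁻¹ x = invBraiding q (braidedComul q x) := by
  induction x using word_induction with
  | h1 => simp [invBraiding_one]
  | hι i x hx =>
    rw [braidedComul_ι_mul, hx, braidedComul_ι_mul]
    induction braidedComul q x using TensorProduct.induction_on with
    | zero => simp
    | tmul a b =>
      simp only [mulPrimitive, LinearMap.add_apply, TensorProduct.map_tmul, map_add,
        LinearMap.mulLeft_apply, LinearMap.id_apply, AlgHom.toLinearMap_apply,
        invBraiding_mul_left, invBraiding_ι_mul, twist_eq_scale q, invBraiding_scale]
      -- The inverse braiding exchanges the roles of the two summands of `vᵢ ⊗ 1 + 1 ⊗ vᵢ`.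
      rw [add_comm]
      congr 1
      -- Here the symmetry of the matrix enters: the twist made by `1 ⊗ vᵢ` is undone by the scaling
      -- in the inverse braiding.
      have : (fun j => (q j i)⁻¹) * q i = 1 := by
        ext j
        simp [hq i j]
      induction invBraiding q (a ⊗ₜ b) using TensorProduct.induction_on with
      | zero => simp
      | tmul x y => simp [scale_scale, this, scale_one]
      | add x y hx hy => simp only [map_add, hx, hy]
    | add x y hx hy => simp only [map_add, hx, hy]
  | hadd x y hx hy => simp only [map_add, hx, hy]
  | hsmul c x hx => simp only [map_smul, hx]

/-- On homogeneous elements the inverse braiding is the flip up to a rescaling, so it moves a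
homogeneous element of an ideal to the other tensor factor unchanged. -/
theorem invBraiding_of_mem {β : Lat θ} {b : FreeAlgebra k (Fin θ)} (hb : b ∈ homog k alpha β)
    (a : FreeAlgebra k (Fin θ)) :
    invBraiding q (a ⊗ₜ b) = b ⊗ₜ scale (fun i => ∏ j, (q i j)⁻¹ ^ β j) a := by
  induction hb using homog_induction with
  | h0 => simp
  | hadd x y hx hy => simp only [TensorProduct.tmul_add, map_add, hx, hy, TensorProduct.add_tmul]
  | hsmul c x hx => rw [TensorProduct.tmul_smul, map_smul, hx, TensorProduct.smul_tmul']
  | hw l hl =>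
    subst hl
    have h : (fun i => ∏ j, (q i j)⁻¹ ^ (l.map alpha).sum j) =
        fun i => (l.map fun j => (q i j)⁻¹).prod := by
      ext i
      rw [prod_eq_of_degree (fun j => (q i j)⁻¹) l]
    rw [h]
    clear h
    induction l with
    | nil => exact (invBraiding_one a).trans (congrArg _ (scale_one a).symm)
    | cons j l ih =>
      rw [word_cons, invBraiding_ι_mul, ih]
      simp only [TensorProduct.map_tmul, LinearMap.mulLeft_apply, AlgHom.toLinearMap_apply,
        scale_scale]
      rfl

/-- Passing to the inverse matrix composes the comultiplication with the inverse braiding, which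
exchanges `I ⊗ T` and `T ⊗ I`, because a homogeneous `I` is stable under rescaling. The other axioms
do not involve the matrix. -/
theorem IsHopfIdeal.inv (hq : ∀ i j, q i j = q j i) {I : Submodule k (FreeAlgebra k (Fin θ))}
    (hI : IsHopfIdeal q I) : IsHopfIdeal q⁻¹ I where
  mul_left := hI.mul_left
  mul_right := hI.mul_right
  homogeneous := hI.homogeneous
  degree := hI.degree
  coideal x hx := by
    rw [braidedComul_inv hq]
    refine (sup_le ?_ ?_ : _ ≤ Submodule.comap (invBraiding q)
      (LinearMap.range (TensorProduct.map I.subtype LinearMap.id) ⊔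
        LinearMap.range (TensorProduct.map LinearMap.id I.subtype))) (hI.coideal x hx)
    · rintro _ ⟨t, rfl⟩
      refine Submodule.mem_sup_right ?_
      induction t using TensorProduct.induction_on with
      | zero => simp
      | add a b ha hb => rw [map_add, map_add]; exact add_mem ha hb
      | tmul a b =>
        rw [TensorProduct.map_tmul, LinearMap.id_apply]
        induction b using word_induction with
        | h1 => exact ⟨1 ⊗ₜ a, by simp [invBraiding_one]⟩
        | hadd x y hx hy => rw [TensorProduct.tmul_add, map_add]; exact add_mem hx hy
        | hsmul c x hx => rw [TensorProduct.tmul_smul, map_smul]; exact Submodule.smul_mem _ _ hx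
        | hι j b hb =>
          rw [invBraiding_ι_mul]
          obtain ⟨s, hs⟩ := hb
          rw [← hs]
          clear hs
          induction s using TensorProduct.induction_on with
          | zero => simp
          | add a b ha hb => rw [map_add, map_add]; exact add_mem ha hb
          | tmul c d =>
            exact ⟨(FreeAlgebra.ι k j * c) ⊗ₜ
              ⟨_, scale_mem_of_homogeneous hI.homogeneous (fun i => (q i j)⁻¹) d.2⟩, by simp⟩
    · rintro _ ⟨t, rfl⟩
      refine Submodule.mem_sup_left ?_
      induction t using TensorProduct.induction_on with
      | zero => simp
      | add a b ha hb => rw [map_add, map_add]; exact add_mem ha hb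
      | tmul a b =>
        rw [TensorProduct.map_tmul, LinearMap.id_apply]
        refine (iSup_le fun β c hc => ?_ : _ ≤ Submodule.comap
          (invBraiding q ∘ₗ TensorProduct.mk k _ _ a)
          (LinearMap.range (TensorProduct.map I.subtype LinearMap.id))) (hI.homogeneous b.2)
        rw [Submodule.mem_comap, LinearMap.comp_apply, TensorProduct.mk_apply,
          invBraiding_of_mem hc.2]
        exact ⟨⟨c, hc.1⟩ ⊗ₜ _, TensorProduct.map_tmul _ _ _ _⟩

/-- Applied to `q` and to `q⁻¹` this gives equality, which carries finite dimensionality from `B(V)`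
to `B(W)`. -/
theorem nicholsIdeal_le_inv (hq : ∀ i j, q i j = q j i) : nicholsIdeal q ≤ nicholsIdeal q⁻¹ :=
  sSup_le_sSup fun _ hI => hI.inv hq

end Ideal

namespace Datum

variable {k : Type u} [Field k] {Γ : Type v} [CommGroup Γ] {θ : ℕ} (D : Datum k Γ θ)

/-! ### The bilinear form -/

theorem form_add (γ : Γ) (lam mu : Lat θ) : D.form γ (lam + mu) = D.form γ lam * D.form γ mu := by
  simp [form, ofAdd_add]

@[simp] theorem form_zero (γ : Γ) : D.form γ 0 = 1 := by simp [form]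

theorem form_neg (γ : Γ) (lam : Lat θ) : D.form γ (-lam) = (D.form γ lam)⁻¹ := by
  simp [form, ofAdd_neg]

@[simp] theorem form_alpha (γ : Γ) (i : Fin θ) : D.form γ (alpha i) = D.χ i γ :=
  D.pairing_alpha γ i

theorem form_sub (γ : Γ) (lam mu : Lat θ) :
    D.form γ (lam - mu) = D.form γ lam * (D.form γ mu)⁻¹ := by
  rw [sub_eq_add_neg, form_add, form_neg]

@[simp] theorem form_one (lam : Lat θ) : D.form 1 lam = 1 := by simp [form]

theorem form_mul (γ γ' : Γ) (lam : Lat θ) :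
    D.form (γ * γ') lam = D.form γ lam * D.form γ' lam := by simp [form]

/-! ### The algebra `U` and its grading -/

theorem mkU_surjective : Function.Surjective D.mkU := RingQuot.mkAlgHom_surjective k D.Rel

theorem lift_gen (x : FreeAlgebra k (Gen θ Γ)) : FreeAlgebra.lift k D.gen x = D.mkU x := by
  rw [show FreeAlgebra.lift k D.gen = D.mkU by ext; simp [gen]]

variable {D} in
theorem U_induction {P : D.U → Prop} (h1 : P 1) (hgen : ∀ x u, P u → P (D.gen x * u))
    (hadd : ∀ x y, P x → P y → P (x + y)) (hsmul : ∀ (c : k) x, P x → P (c • x)) (u : D.U) :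
    P u := by
  obtain ⟨x, rfl⟩ := D.mkU_surjective u
  induction x using word_induction with
  | h1 => simpa using h1
  | hι i x hx => rw [map_mul]; exact hgen i _ hx
  | hadd x y hx hy => rw [map_add]; exact hadd _ _ hx hy
  | hsmul c x hx => rw [map_smul]; exact hsmul c _ hx

theorem one_mem_grU : (1 : D.U) ∈ D.grU 0 := ⟨1, one_mem_homog _, map_one D.mkU⟩

theorem gen_mem_grU (x : Gen θ Γ) : D.gen x ∈ D.grU (genDeg x) :=
  ⟨_, ι_mem_homog genDeg x, rfl⟩

variable {D} in
theorem mul_mem_grU {β γ : Lat θ} {x y : D.U} (hx : x ∈ D.grU β) (hy : y ∈ D.grU γ) :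
    x * y ∈ D.grU (β + γ) := by
  obtain ⟨a, ha, rfl⟩ := hx
  obtain ⟨b, hb, rfl⟩ := hy
  exact ⟨a * b, homog_mul ha hb, map_mul D.mkU _ _⟩

variable {D} in
theorem grU_induction {β : Lat θ} (P : Submodule k D.U)
    (hw : ∀ l : List (Gen θ Γ), (l.map genDeg).sum = β → (l.map D.gen).prod ∈ P)
    {u : D.U} (hu : u ∈ D.grU β) : u ∈ P := by
  obtain ⟨x, hx, rfl⟩ := hu
  induction hx using homog_induction with
  | h0 => simp
  | hadd x y hx hy => rw [map_add]; exact add_mem hx hy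
  | hsmul c x hx => rw [map_smul]; exact P.smul_mem c hx
  | hw l hl =>
    have : D.mkU (word l) = (l.map D.gen).prod := by
      simp only [word, map_list_prod, List.map_map]
      rfl
    rw [AlgHom.toLinearMap_apply, this]
    exact hw l hl

/-- The image of `T(V)` in `U`. -/
noncomputable def vlift : FreeAlgebra k (Fin θ) →ₐ[k] D.U :=
  FreeAlgebra.lift k fun i => D.gen (.v i)

/-- The image of `T(W)` in `U`. -/
noncomputable def wlift : FreeAlgebra k (Fin θ) →ₐ[k] D.U :=
  FreeAlgebra.lift k fun i => D.gen (.w i)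

@[simp] theorem wlift_ι (i : Fin θ) : D.wlift (FreeAlgebra.ι k i) = D.gen (.w i) := by
  simp [wlift]

theorem wlift_mem_grU {β : Lat θ} {x : FreeAlgebra k (Fin θ)} (hx : x ∈ homog k alpha β) :
    D.wlift x ∈ D.grU (-β) := by
  induction hx using homog_induction with
  | h0 => simp
  | hadd a b ha hb => rw [map_add]; exact add_mem ha hb
  | hsmul c a ha => rw [map_smul]; exact Submodule.smul_mem _ c ha
  | hw l hl =>
    subst hl
    induction l with
    | nil => simpa using D.one_mem_grU
    | cons a l ih =>
      simp only [word_cons, map_mul, wlift_ι, List.map_cons, List.sum_cons, neg_add]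
      exact mul_mem_grU (D.gen_mem_grU (.w a)) ih

/-- The Nichols ideal is spanned by homogeneous elements, and on these the coaction only records a
degree. The sign `s = ±1` treats the relations of the `vᵢ` and of the `wᵢ` together. -/
theorem coactLift_lift_eq_zero (f : Fin θ → Gen θ Γ) (s : ℤ)
    (hf : ∀ i, genDeg (f i) = s • alpha i) (q : Fin θ → Fin θ → kˣ)
    (h : ∀ y ∈ nicholsIdeal q, FreeAlgebra.lift k (fun i => D.gen (f i)) y = 0)
    (y : FreeAlgebra k (Fin θ)) (hy : y ∈ nicholsIdeal q) :
    coactLift genDeg D.gen (FreeAlgebra.lift k (fun i => FreeAlgebra.ι k (f i)) y) = 0 := by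
  have hdeg : ∀ β, ∀ c ∈ homog k (alpha (θ := θ)) β,
      FreeAlgebra.lift k (fun i => FreeAlgebra.ι k (f i)) c ∈ homog k genDeg (s • β) := by
    intro β c hc
    induction hc using homog_induction with
    | h0 => simp
    | hadd a b ha hb => rw [map_add]; exact add_mem ha hb
    | hsmul c a ha => rw [map_smul]; exact Submodule.smul_mem _ c ha
    | hw l hl =>
      subst hl
      induction l with
      | nil => simpa using one_mem_homog (k := k) (genDeg (θ := θ) (Γ := Γ))
      | cons a l ih =>
        simp only [word_cons, map_mul, FreeAlgebra.lift_ι_apply, List.map_cons, List.sum_cons,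
          smul_add, ← hf]
        exact homog_mul (ι_mem_homog _ _) ih
  refine (iSup_le fun β c hc => ?_ : _ ≤ LinearMap.ker
    ((coactLift genDeg D.gen).toLinearMap ∘ₗ (FreeAlgebra.lift k
      (fun i => FreeAlgebra.ι k (f i))).toLinearMap)) (nicholsIdeal_homogeneous hy)
  rw [LinearMap.mem_ker, LinearMap.comp_apply, AlgHom.toLinearMap_apply,
    AlgHom.toLinearMap_apply, coactLift_of_mem _ _ (hdeg β c hc.2), lift_comp_ι]
  simp [h c hc.1]

variable {D} in
/-- The defining relations of `U` are homogeneous. -/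
theorem coactLift_rel {x y : FreeAlgebra k (Gen θ Γ)} (h : D.Rel x y) :
    coactLift genDeg D.gen x = coactLift genDeg D.gen y := by
  -- If both sides of a relation have the same degree `β`, both go to the same element of `U` placed
  -- in degree `β`.
  have key : ∀ {x y : FreeAlgebra k (Gen θ Γ)} (β : Lat θ), D.Rel x y →
      x ∈ homog k genDeg β → y ∈ homog k genDeg β →
        coactLift genDeg D.gen x = coactLift genDeg D.gen y := by
    intro x y β h hx hy
    rw [coactLift_of_mem _ _ hx, coactLift_of_mem _ _ hy, lift_gen, lift_gen, gen_rel h]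
  have hg : ∀ γ : Γ, FreeAlgebra.ι k (Gen.g γ) ∈ homog k (genDeg (θ := θ)) 0 := fun γ =>
    ι_mem_homog _ (Gen.g γ)
  have hv : ∀ i, FreeAlgebra.ι k (Gen.v i) ∈ homog k (genDeg (Γ := Γ)) (alpha (θ := θ) i) :=
    fun i => ι_mem_homog _ (Gen.v i)
  have hw : ∀ i, FreeAlgebra.ι k (Gen.w i) ∈ homog k (genDeg (Γ := Γ)) (-alpha (θ := θ) i) :=
    fun i => ι_mem_homog _ (Gen.w i)
  have hmul : ∀ {β γ : Lat θ} {x y : FreeAlgebra k (Gen θ Γ)} (c : k), x ∈ homog k genDeg β →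
      y ∈ homog k genDeg γ → c • (x * y) ∈ homog k genDeg (γ + β) := by
    intro β γ x y c hx hy
    rw [add_comm]
    exact Submodule.smul_mem _ c (homog_mul hx hy)
  have h' := h
  induction h with
  | g_one => exact key 0 h' (hg 1) (one_mem_homog _)
  | g_mul γ γ' =>
    refine key 0 h' (hg _) ?_
    have := homog_mul (hg γ) (hg γ')
    rwa [add_zero] at this
  | g_v γ i => exact key _ h' (homog_mul (hg γ) (hv i)) (hmul _ (hv i) (hg γ))
  | g_w γ i => exact key _ h' (homog_mul (hg γ) (hw i)) (hmul _ (hw i) (hg γ))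
  | nichols_v x hx =>
    rw [D.coactLift_lift_eq_zero Gen.v 1 (fun i => (one_smul ℤ _).symm) D.q D.gen_nichols_v x hx,
      map_zero]
  | nichols_w x hx =>
    rw [D.coactLift_lift_eq_zero Gen.w (-1) (fun i => (neg_one_smul ℤ (alpha i)).symm) D.q⁻¹
      D.gen_nichols_w x hx, map_zero]
  | linking i j =>
    refine key (alpha i + -alpha j) h' (sub_mem (homog_mul (hv i) (hw j))
      (hmul _ (hw j) (hv i))) ?_
    split_ifs with hij
    · subst hij
      rw [add_neg_cancel, pow_two]
      have := homog_mul (hg (D.g i)) (hg (D.g i))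
      rw [add_zero] at this
      exact sub_mem this (one_mem_homog _)
    · exact zero_mem _

/-- The algebra map `U → U[Λ]` given by the grading of `U`. -/
noncomputable def coactU : D.U →ₐ[k] AddMonoidAlgebra D.U (Lat θ) :=
  RingQuot.liftAlgHom k ⟨coactLift genDeg D.gen, fun _ _ h => coactLift_rel h⟩

theorem coactU_of_mem {β : Lat θ} {u : D.U} (hu : u ∈ D.grU β) :
    D.coactU u = AddMonoidAlgebra.single β u := by
  obtain ⟨x, hx, rfl⟩ := hu
  rw [AlgHom.toLinearMap_apply, ← lift_gen, ← coactLift_of_mem genDeg D.gen hx, lift_gen, coactU,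
    mkU, RingQuot.liftAlgHom_mkAlgHom_apply]

theorem isInternal_grU : DirectSum.IsInternal D.grU := by
  have htop : ⨆ β, D.grU β = ⊤ := by
    simp only [grU]
    rw [← Submodule.map_iSup, iSup_homog, Submodule.map_top, LinearMap.range_eq_top]
    exact D.mkU_surjective
  refine isInternal_of_proj htop (fun β => coeffHom k _ β ∘ₗ D.coactU.toLinearMap)
    (fun β x hx => ?_) (fun β γ hne x hx => ?_)
  · simp [D.coactU_of_mem hx, coeffHom_single]
  · simp [D.coactU_of_mem hx, coeffHom_single, hne]

theorem wlift_of_mem {x : FreeAlgebra k (Fin θ)} (hx : x ∈ nicholsIdeal D.q⁻¹) :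
    D.wlift x = 0 := D.gen_nichols_w x hx

theorem vlift_of_mem {x : FreeAlgebra k (Fin θ)} (hx : x ∈ nicholsIdeal D.q) :
    D.vlift x = 0 := D.gen_nichols_v x hx

theorem gen_g_wlift (γ : Γ) (x : FreeAlgebra k (Fin θ)) : D.gen (.g γ) * D.wlift x =
    D.wlift (scale (fun i => (D.χ i γ)⁻¹) x) * D.gen (.g γ) := by
  induction x using word_induction with
  | h1 => simp
  | hι i x hx =>
    rw [map_mul, map_mul, map_mul, wlift_ι, scale_ι, map_smul, wlift_ι, ← mul_assoc, gen_g_w,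
      smul_mul_assoc, mul_assoc, hx, smul_mul_assoc, smul_mul_assoc, mul_assoc]
  | hadd x y hx hy => simp only [map_add, mul_add, add_mul, hx, hy]
  | hsmul c x hx => simp only [map_smul, mul_smul_comm, smul_mul_assoc, hx]

/-! ### Objects of `C_U` -/

section Obj

variable {D} {M : GrMod.{u, max u v, w} k D.U θ}

theorem IsObj.gen_smul_mem (hM : D.IsObj M) (x : Gen θ Γ) {lam : Lat θ} {m : M.carrier}
    (hm : m ∈ M.gr lam) : D.gen x • m ∈ M.gr (genDeg x + lam) := by
  cases x with
  | v i => rw [add_comm]; exact hM.v_smul i _ _ hm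
  | w i =>
    have := hM.w_smul i _ _ hm
    rwa [sub_eq_add_neg, add_comm] at this
  | g γ =>
    rw [hM.g_smul γ _ _ hm]
    rw [genDeg, zero_add]
    exact Submodule.smul_mem _ _ hm

theorem IsObj.smul_mem (hM : D.IsObj M) {β lam : Lat θ} {u : D.U} (hu : u ∈ D.grU β)
    {m : M.carrier} (hm : m ∈ M.gr lam) : u • m ∈ M.gr (β + lam) := by
  refine grU_induction ((M.gr (β + lam)).comap
    ((LinearMap.toSpanSingleton D.U M.carrier m).restrictScalars k)) (fun l hl => ?_) hu
  rw [Submodule.mem_comap]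
  subst hl
  clear hu
  induction l with
  | nil => simpa using hm
  | cons a l ih =>
    simp only [LinearMap.restrictScalars_apply, LinearMap.toSpanSingleton_apply, List.map_cons,
      List.prod_cons, mul_smul, List.sum_cons, add_assoc] at ih ⊢
    exact hM.gen_smul_mem a ih

/-- A vector of weight `lam` which is killed by the `vᵢ`. -/
structure IsHighest (M : GrMod.{u, max u v, w} k D.U θ) (lam : Lat θ) (m : M.carrier) : Prop where
  mem : m ∈ M.gr lam
  g_smul : ∀ γ, D.gen (.g γ) • m = (D.form γ lam : k) • m
  v_smul : ∀ i, D.gen (.v i) • m = 0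

/-- A highest weight module is generated by the `wᵢ`. -/
theorem IsHighest.exists_wlift {lam : Lat θ} {m : M.carrier} (h : IsHighest M lam m) (u : D.U) :
    ∃ x, u • m = D.wlift x • m := by
  have hg : ∀ γ x, D.gen (.g γ) • D.wlift x • m =
      D.wlift ((D.form γ lam : k) • scale (fun i => (D.χ i γ)⁻¹) x) • m := by
    intro γ x
    rw [← mul_smul, gen_g_wlift, mul_smul, h.g_smul, smul_comm, map_smul, smul_assoc]
  -- The only nontrivial stability: `vᵢ` is moved to the right through the word by the linking
  -- relation until it reaches `m` and kills it.
  have hv : ∀ i x, ∃ y, D.gen (.v i) • D.wlift x • m = D.wlift y • m := by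
    intro i x
    induction x using word_induction with
    | h1 => exact ⟨0, by simp [h.v_smul]⟩
    | hadd x y hx hy =>
      obtain ⟨a, ha⟩ := hx
      obtain ⟨b, hb⟩ := hy
      exact ⟨a + b, by rw [map_add, add_smul, smul_add, ha, hb, map_add, add_smul]⟩
    | hsmul c x hx =>
      obtain ⟨a, ha⟩ := hx
      exact ⟨c • a, by rw [map_smul, smul_assoc, smul_comm, ha, map_smul, smul_assoc]⟩
    | hι j x hx =>
      obtain ⟨a, ha⟩ := hx
      rw [map_mul, wlift_ι, ← mul_smul, ← mul_assoc, gen_linking, add_mul, add_smul,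
        smul_mul_assoc, smul_assoc, mul_assoc, mul_smul, mul_smul, ha]
      split_ifs with hij
      -- The first summand is `wⱼ vᵢ x m` by induction; the second is `(gᵢ² - 1) x m`, with each
      -- `gᵢ` acting through `hg`.
      · refine ⟨(((D.χ j (D.g i))⁻¹ : kˣ) : k) • (FreeAlgebra.ι k j * a) +
          ((D.form (D.g i) lam : k) • scale (fun l => (D.χ l (D.g i))⁻¹)
            ((D.form (D.g i) lam : k) • scale (fun l => (D.χ l (D.g i))⁻¹) x) - x), ?_⟩
        rw [sub_mul, sub_smul, pow_two, mul_assoc, mul_smul, mul_smul, hg, hg, one_mul, map_add,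
          add_smul, map_sub, sub_smul]
        congr 1
        rw [map_smul, map_mul, wlift_ι, smul_assoc, mul_smul]
      · refine ⟨(((D.χ j (D.g i))⁻¹ : kˣ) : k) • (FreeAlgebra.ι k j * a), ?_⟩
        rw [zero_mul, zero_smul, add_zero, map_smul, map_mul, wlift_ι, smul_assoc, mul_smul]
  induction u using U_induction with
  | h1 => exact ⟨1, by simp⟩
  | hadd x y hx hy =>
    obtain ⟨a, ha⟩ := hx
    obtain ⟨b, hb⟩ := hy
    exact ⟨a + b, by rw [add_smul, ha, hb, map_add, add_smul]⟩
  | hsmul c x hx =>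
    obtain ⟨a, ha⟩ := hx
    exact ⟨c • a, by rw [smul_assoc, ha, map_smul, smul_assoc]⟩
  | hgen x u hu =>
    obtain ⟨a, ha⟩ := hu
    rw [mul_smul, ha]
    cases x with
    | v i => exact hv i a
    | w i => exact ⟨FreeAlgebra.ι k i * a, by rw [map_mul, wlift_ι, mul_smul]⟩
    | g γ => exact ⟨_, hg γ a⟩

theorem IsObj.isHighest (hM : D.IsObj M) {lam : Lat θ} {m : M.carrier} (hm : m ∈ M.gr lam)
    (hv : ∀ i, D.gen (.v i) • m = 0) : IsHighest M lam m := ⟨hm, fun γ => hM.g_smul γ _ _ hm, hv⟩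

variable {N : GrMod.{u, max u v, w'} k D.U θ}

theorem isObj_of_iso (e : M.Iso N) (hM : D.IsObj M) : D.IsObj N := by
  have hmem : ∀ μ m, m ∈ N.gr μ → ∃ m', m' ∈ M.gr μ ∧ e.toEquiv m' = m := fun μ m hm =>
    ⟨e.toEquiv.symm m, by rw [e.mem_gr]; simpa using hm, by simp⟩
  have := hM.finite
  refine ⟨Module.Finite.equiv (e.toEquiv.restrictScalars k), e.isInternal hM.internal, ?_, ?_, ?_⟩
  · intro γ lam m hm
    obtain ⟨m', hm', rfl⟩ := hmem _ _ hm
    rw [← map_smul, hM.g_smul γ lam m' hm']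
    exact map_smul (e.toEquiv.restrictScalars k) _ _
  · intro i lam m hm
    obtain ⟨m', hm', rfl⟩ := hmem _ _ hm
    rw [← map_smul]
    exact (e.mem_gr _ _).1 (hM.v_smul i lam m' hm')
  · intro i lam m hm
    obtain ⟨m', hm', rfl⟩ := hmem _ _ hm
    rw [← map_smul]
    exact (e.mem_gr _ _).1 (hM.w_smul i lam m' hm')

end Obj

/-! ### The opposite datum -/

/-- The two data differ by inversion of the matrix, the characters and the form. -/
structure IsOpp (D D' : Datum k Γ θ) : Prop where
  q_eq : D'.q = D.q⁻¹
  g_eq : D'.g = D.g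
  χ_eq : ∀ i γ, D'.χ i γ = (D.χ i γ)⁻¹
  form_eq : ∀ γ lam, D'.form γ lam = (D.form γ lam)⁻¹

/-- Being opposite is kept as a symmetric relation between two data, so that modules can be pulled
back in both directions without identifying `D.opp.opp` with `D`. -/
theorem IsOpp.symm {D D' : Datum k Γ θ} (h : IsOpp D D') : IsOpp D' D :=
  ⟨by rw [h.q_eq, inv_inv], h.g_eq.symm, fun i γ => by rw [h.χ_eq, inv_inv],
    fun γ lam => by rw [h.form_eq, inv_inv]⟩

/-- The datum with inverse matrix, characters and form. -/
def opp : Datum k Γ θ where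
  q := D.q⁻¹
  symm i j := by simp [D.symm i j]
  g := D.g
  χ j := (D.χ j)⁻¹
  χ_g i j := by simp [D.χ_g]
  pairing := D.pairing⁻¹
  pairing_alpha γ j := by simp [D.pairing_alpha]

theorem isOpp_opp : IsOpp D D.opp := ⟨rfl, rfl, fun _ _ => rfl, fun _ _ => rfl⟩

/-- This computation fixes the scalar `-q i i` in `opHom`: exchanging `vᵢ` and `wᵢ` reverses the
commutator, and the factor `-q` restores the right side `gᵢ² - 1` with its sign. -/
theorem neg_smul_comm_sub {A : Type*} [Ring A] [Algebra k A] {q : k} (hq : q ≠ 0) {x y z : A}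
    (h : y * x = q • (x * y) + z) : (-q) • x * y - q⁻¹ • (y * (-q) • x) = z := by
  rw [smul_mul_assoc, mul_smul_comm, h, smul_smul, mul_neg, inv_mul_cancel₀ hq]
  simp only [neg_smul, one_smul]
  abel

section Opp

variable {D} {D' : Datum k Γ θ} (h : IsOpp D D')

/-- The algebra map from `U` to the algebra `U` of the opposite datum, which exchanges the `vᵢ`
and the `wᵢ` up to scalars. -/
noncomputable def opHom (h : IsOpp D D') : D.U →ₐ[k] D'.U :=
  RingQuot.liftAlgHom k ⟨FreeAlgebra.lift k fun x => match x with
    | .v i => ((-D.q i i : kˣ) : k) • D'.gen (.w i)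
    | .w i => D'.gen (.v i)
    | .g γ => D'.gen (.g γ), by
    intro x y hxy
    induction hxy with
    | g_one => simpa using D'.gen_g_one
    | g_mul γ γ' => simpa using D'.gen_g_mul γ γ'
    | g_v γ i =>
      simp only [map_mul, map_smul, FreeAlgebra.lift_ι_apply, mul_smul_comm, smul_mul_assoc,
        gen_g_w, h.χ_eq, inv_inv]
      rw [smul_comm]
    | g_w γ i =>
      simp only [map_mul, map_smul, FreeAlgebra.lift_ι_apply, gen_g_v, h.χ_eq]
    | nichols_v x hx =>
      rw [lift_comp_ι, map_zero]
      simp only [FreeAlgebra.lift_ι_apply]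
      have h1 : FreeAlgebra.lift k (fun i => ((-D.q i i : kˣ) : k) • D'.gen (.w i)) =
          D'.wlift.comp (scale fun i => -D.q i i) := by
        ext i
        simp [-Units.val_neg]
      rw [h1]
      refine D'.wlift_of_mem ?_
      rw [h.q_eq, inv_inv]
      exact scale_mem_nicholsIdeal _ hx
    | nichols_w x hx =>
      rw [lift_comp_ι, map_zero]
      simp only [FreeAlgebra.lift_ι_apply]
      exact D'.vlift_of_mem (by rw [h.q_eq]; exact hx)
    | linking i j =>
      have h1 := D'.gen_linking j i
      simp only [h.χ_eq, inv_inv, h.g_eq] at h1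
      have h2 : D.χ i (D.g j) = D.χ j (D.g i) := by rw [D.χ_g, D.χ_g, D.symm]
      rw [h2] at h1
      rw [map_sub, map_smul, map_mul, map_mul]
      simp only [FreeAlgebra.lift_ι_apply]
      by_cases hij : i = j
      · subst hij
        rw [if_pos rfl] at h1 ⊢
        rw [map_sub, map_pow, map_one, FreeAlgebra.lift_ι_apply]
        rw [D.χ_g] at h1 ⊢
        rw [Units.val_inv_eq_inv_val, Units.val_neg]
        exact neg_smul_comm_sub (D.q i i).ne_zero h1
      · rw [if_neg (Ne.symm hij), add_zero] at h1
        rw [if_neg hij, map_zero, smul_mul_assoc, mul_smul_comm, h1, smul_smul, smul_smul,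
          mul_right_comm, Units.inv_mul, one_mul, sub_self]⟩

@[simp] theorem opHom_v (i : Fin θ) :
    opHom h (D.gen (.v i)) = ((-D.q i i : kˣ) : k) • D'.gen (.w i) := by
  rw [opHom, gen, mkU, RingQuot.liftAlgHom_mkAlgHom_apply]
  simp

@[simp] theorem opHom_w (i : Fin θ) : opHom h (D.gen (.w i)) = D'.gen (.v i) := by
  rw [opHom, gen, mkU, RingQuot.liftAlgHom_mkAlgHom_apply]
  simp

@[simp] theorem opHom_g (γ : Γ) : opHom h (D.gen (.g γ)) = D'.gen (.g γ) := by
  rw [opHom, gen, mkU, RingQuot.liftAlgHom_mkAlgHom_apply]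
  simp

/-- Surjectivity is all that is needed to read submodules and linear maps of a pull-back as those of
the original module. -/
theorem opHom_surjective : Function.Surjective (opHom h) := by
  intro u
  have hgen : ∀ x, ∃ u, opHom h u = D'.gen x := by
    intro x
    cases x with
    | v i => exact ⟨D.gen (.w i), by simp⟩
    | w i => exact ⟨(((-D.q i i)⁻¹ : kˣ) : k) • D.gen (.v i), by
        rw [map_smul, opHom_v, smul_smul, Units.inv_mul, one_smul]⟩
    | g γ => exact ⟨D.gen (.g γ), by simp⟩
  induction u using U_induction with
  | h1 => exact ⟨1, map_one _⟩
  | hadd x y hx hy =>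
    obtain ⟨a, rfl⟩ := hx
    obtain ⟨b, rfl⟩ := hy
    exact ⟨a + b, map_add _ _ _⟩
  | hsmul c x hx =>
    obtain ⟨a, rfl⟩ := hx
    exact ⟨c • a, map_smul _ _ _⟩
  | hgen x u hu =>
    obtain ⟨a, rfl⟩ := hu
    obtain ⟨b, hb⟩ := hgen x
    exact ⟨b * a, by rw [map_mul, hb]⟩

/-- The pull-back of a graded module along `opHom`, with the opposite grading. -/
noncomputable def pull (M : GrMod.{u, max u v, w} k D'.U θ) : GrMod.{u, max u v, w} k D.U θ :=
  letI : Module D.U M.carrier := Module.compHom M.carrier (opHom h).toRingHom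
  haveI : IsScalarTower k D.U M.carrier := ⟨fun c b x => by
    change opHom h (c • b) • x = c • (opHom h b • x)
    rw [map_smul, smul_assoc]⟩
  { carrier := M.carrier
    gr := fun μ => M.gr (-μ) }

variable (M : GrMod.{u, max u v, w} k D'.U θ)

/-- The identity map from a graded module to its pull-back. -/
noncomputable def toPull : M.carrier ≃ₗ[k] (pull h M).carrier := LinearEquiv.refl k M.carrier

theorem smul_toPull (u : D.U) (m : M.carrier) : u • toPull h M m = toPull h M (opHom h u • m) := rfl

theorem toPull_mem_gr (μ : Lat θ) (m : M.carrier) :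
    toPull h M m ∈ (pull h M).gr μ ↔ m ∈ M.gr (-μ) := Iff.rfl

variable {M}

theorem isObj_pull (hM : D'.IsObj M) : D.IsObj (pull h M) where
  finite := hM.finite
  internal := by
    refine isInternal_of_proj (gr := (pull h M).gr) ?_
      (fun μ => gproj (gr := M.gr) hM.internal (-μ)) ?_ ?_
    · refine Eq.trans ?_ hM.internal.submodule_iSup_eq_top
      exact (Equiv.neg (Lat θ)).iSup_comp (g := M.gr)
    · exact fun μ m hm => gproj_of_mem hM.internal hm
    · exact fun μ ν hne m hm => gproj_of_mem_ne hM.internal hm (by simpa using hne)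
  g_smul γ lam m hm := by
    change toPull h M (opHom h _ • _) = _
    rw [opHom_g, hM.g_smul γ (-lam) _ hm, form_neg, h.form_eq, inv_inv]
    rfl
  v_smul i lam m hm := by
    change opHom h _ • (toPull h M).symm m ∈ M.gr _
    rw [opHom_v, smul_assoc, neg_add]
    have := hM.w_smul i (-lam) _ hm
    rw [sub_eq_add_neg] at this
    exact Submodule.smul_mem _ _ this
  w_smul i lam m hm := by
    change opHom h _ • (toPull h M).symm m ∈ M.gr _
    rw [opHom_w, neg_sub', sub_neg_eq_add]
    exact hM.v_smul i (-lam) _ hm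

/-- The submodules of the pull-back are those of the module. -/
def unpullSub (N : Submodule D.U (pull h M).carrier) : Submodule D'.U M.carrier where
  carrier := {m | toPull h M m ∈ N}
  add_mem' ha hb := N.add_mem ha hb
  zero_mem' := N.zero_mem
  smul_mem' u m hm := by
    obtain ⟨u, rfl⟩ := opHom_surjective h u
    exact N.smul_mem u hm

theorem isSimpleObj_pull (hM : D'.IsSimpleObj M) : D.IsSimpleObj (pull h M) where
  isObj := isObj_pull h hM.isObj
  nontrivial := hM.nontrivial
  eq_bot_or_eq_top N hN := by
    have hP : M.IsGradedSub (unpullSub h N) := by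
      intro x hx
      have h1 := hN (x := toPull h M x) hx
      rw [← (Equiv.neg (Lat θ)).iSup_comp]
      exact h1
    refine (hM.eq_bot_or_eq_top _ hP).imp (fun e => ?_) (fun e => ?_)
    · rw [eq_bot_iff]
      intro x hx
      have : (toPull h M).symm x ∈ unpullSub h N := hx
      rw [e] at this
      exact this
    · rw [eq_top_iff]
      intro x _
      have : (toPull h M).symm x ∈ unpullSub h N := e ▸ Submodule.mem_top
      exact this

/-- Modules with isomorphic pull-backs are isomorphic. -/
theorem nonempty_iso_of_pull {N : GrMod.{u, max u v, w'} k D'.U θ}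
    (e : (pull h M).Iso (pull h N)) : Nonempty (M.Iso N) := by
  refine ⟨⟨{ (e.toEquiv.restrictScalars k : M.carrier ≃ₗ[k] N.carrier) with
    map_smul' := fun u m => ?_ }, fun μ m => ?_⟩⟩
  · obtain ⟨u, rfl⟩ := opHom_surjective h u
    exact e.toEquiv.map_smul u (toPull h M m)
  · have := e.mem_gr (-μ) m
    change m ∈ M.gr (- -μ) ↔ e.toEquiv m ∈ N.gr (- -μ) at this
    rw [neg_neg] at this
    exact this

end Opp

end Datum

theorem counit_of_mem_degGeTwo {k : Type u} [Field k] {θ : ℕ} {x : FreeAlgebra k (Fin θ)}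
    (hx : x ∈ degGeTwo k θ) : counit k θ x = 0 := by
  refine (Submodule.span_le.2 ?_ : degGeTwo k θ ≤ LinearMap.ker (counit k θ).toLinearMap) hx
  rintro _ ⟨l, hl, rfl⟩
  match l, hl with
  | a :: b :: l, _ => simp

namespace Datum

variable {k : Type u} [Field k] {Γ : Type v} [CommGroup Γ] {θ : ℕ} (D : Datum k Γ θ) (lam : Lat θ)

/-! ### Verma modules

The action of `U` on `B(W)`, where `1` is a vector of weight `lam` killed by the `vᵢ`. -/

theorem scale_χ_inv (i : Fin θ) : (fun j => (D.χ j (D.g i))⁻¹) = D.q⁻¹ i := by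
  ext j
  simp [D.χ_g]

/-- The operator by which `γ` acts on `T(W)`. -/
noncomputable def gOp (γ : Γ) : Module.End k (FreeAlgebra k (Fin θ)) :=
  (D.form γ lam : k) • (scale fun i => (D.χ i γ)⁻¹).toLinearMap

/-- The operator by which `vᵢ` acts on `T(W)`. -/
noncomputable def vOp (i : Fin θ) : Module.End k (FreeAlgebra k (Fin θ)) :=
  -- Moving `vᵢ` through a word in the `wⱼ` leaves `gᵢ² - 1` at each letter `wᵢ`. The part `-1`
  -- gives the left derivation; in the part `gᵢ²`, one `gᵢ` supplies the twist of the right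
  -- derivation, the other combines with the factors from the letters on the left to the outer
  -- scaling, and the vector of weight `lam` contributes the squared form.
  ((D.form (D.g i) lam : k) * (D.form (D.g i) lam : k)) •
    ((scale (D.q⁻¹ i)).toLinearMap ∘ₗ derivR D.q⁻¹ i) - derivL D.q⁻¹ i

theorem gOp_apply (γ : Γ) (x : FreeAlgebra k (Fin θ)) :
    D.gOp lam γ x = (D.form γ lam : k) • scale (fun i => (D.χ i γ)⁻¹) x := rfl

theorem gOp_ι_mul (γ : Γ) (j : Fin θ) (x : FreeAlgebra k (Fin θ)) :
    D.gOp lam γ (FreeAlgebra.ι k j * x) =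
      (((D.χ j γ)⁻¹ : kˣ) : k) • (FreeAlgebra.ι k j * D.gOp lam γ x) := by
  simp only [gOp_apply, map_mul, scale_ι, smul_mul_assoc, mul_smul_comm]
  rw [smul_comm]

theorem gOp_comm (γ γ' : Γ) (x : FreeAlgebra k (Fin θ)) :
    D.gOp lam γ (D.gOp lam γ' x) = D.gOp lam γ' (D.gOp lam γ x) := by
  simp only [gOp_apply, map_smul, scale_scale]
  rw [smul_comm, mul_comm]

@[simp] theorem vOp_one (i : Fin θ) : D.vOp lam i 1 = 0 := by simp [vOp]

/-- The linking relation for the operators. The two Leibniz rules carry the common factor `(q i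
j)⁻¹`, and their undifferentiated terms are `gᵢ² x` and `-x`. -/
theorem vOp_ι_mul (i j : Fin θ) (x : FreeAlgebra k (Fin θ)) :
    D.vOp lam i (FreeAlgebra.ι k j * x) =
      (((D.q i j)⁻¹ : kˣ) : k) • (FreeAlgebra.ι k j * D.vOp lam i x) +
        (if i = j then D.gOp lam (D.g i) (D.gOp lam (D.g i) x) - x else 0) := by
  have hq : D.q⁻¹ j i = (D.q i j)⁻¹ := by simp [D.symm i j]
  have hq' : D.q⁻¹ i j = (D.q i j)⁻¹ := by simp
  simp only [vOp, LinearMap.sub_apply, LinearMap.smul_apply, LinearMap.comp_apply,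
    AlgHom.toLinearMap_apply, derivR_ι_mul, derivL_ι_mul, map_add, map_mul, scale_ι, hq, hq',
    gOp_apply, map_smul, scale_χ_inv, twist_eq_scale, smul_add, smul_sub, mul_sub, mul_smul,
    smul_mul_assoc, mul_smul_comm]
  rcases eq_or_ne i j with rfl | hij
  · simp only [if_true]
    rw [smul_comm (((D.q i i)⁻¹ : kˣ) : k), smul_comm (((D.q i i)⁻¹ : kˣ) : k)]
    abel
  · simp only [hij, hij.symm, if_false, map_zero, smul_zero]
    rw [smul_comm (((D.q i j)⁻¹ : kˣ) : k), smul_comm (((D.q i j)⁻¹ : kˣ) : k)]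
    abel

theorem gOp_vOp (γ : Γ) (i : Fin θ) (x : FreeAlgebra k (Fin θ)) :
    D.gOp lam γ (D.vOp lam i x) = (D.χ i γ : k) • D.vOp lam i (D.gOp lam γ x) := by
  induction x using word_induction with
  | h1 => simp [gOp_apply]
  | hadd x y hx hy => simp only [map_add, hx, hy, smul_add]
  | hsmul c x hx => simp only [map_smul, hx]; rw [smul_comm]
  | hι j x hx =>
    rw [vOp_ι_mul, gOp_ι_mul, map_add, map_smul, map_smul, gOp_ι_mul, hx, vOp_ι_mul, smul_add,
      smul_add]
    congr 1
    · simp only [mul_smul_comm, smul_smul]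
      congr 1
      ring
    · split_ifs with hij
      · subst hij
        rw [smul_smul, Units.mul_inv, one_smul, map_sub, gOp_comm, gOp_comm _ _ γ (D.g i) x]
      · simp

/-- The action of `T(V)` on `T(W)`. -/
noncomputable def vOps : FreeAlgebra k (Fin θ) →ₐ[k] Module.End k (FreeAlgebra k (Fin θ)) :=
  FreeAlgebra.lift k (D.vOp lam)

theorem vOps_ι_mul (i : Fin θ) (y x : FreeAlgebra k (Fin θ)) :
    D.vOps lam (FreeAlgebra.ι k i * y) x = D.vOp lam i (D.vOps lam y x) := by simp [vOps]

theorem vOps_one (y : FreeAlgebra k (Fin θ)) : D.vOps lam y 1 = counit k θ y • 1 := by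
  induction y using word_induction with
  | h1 => simp
  | hι i x hx => rw [vOps_ι_mul, hx, map_smul, vOp_one, map_mul, counit_ι]; simp
  | hadd x y hx hy => simp only [map_add, LinearMap.add_apply, hx, hy, add_smul]
  | hsmul c x hx => simp only [map_smul, LinearMap.smul_apply, hx, smul_assoc]

theorem gOp_vOps (γ : Γ) (y x : FreeAlgebra k (Fin θ)) : D.gOp lam γ (D.vOps lam y x) =
    D.vOps lam (scale (fun i => D.χ i γ) y) (D.gOp lam γ x) := by
  induction y using word_induction with
  | h1 => simp
  | hι i y hy =>
    rw [vOps_ι_mul, gOp_vOp, hy, map_mul, scale_ι, smul_mul_assoc, map_smul, LinearMap.smul_apply,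
      vOps_ι_mul]
  | hadd x y hx hy => simp only [map_add, LinearMap.add_apply, hx, hy]
  | hsmul c x hx => simp only [map_smul, LinearMap.smul_apply, hx]

/-- The dual form of the linking relation: a whole element `y` of `T(V)` is moved past `wⱼ`, and the
error terms are skew derivatives of `y`, now for the matrix `q`. This is what makes the action of
`J(V)` accessible. -/
theorem vOps_ι_mul_right (j : Fin θ) (y x : FreeAlgebra k (Fin θ)) :
    D.vOps lam y (FreeAlgebra.ι k j * x) =
      FreeAlgebra.ι k j * D.vOps lam (scale (D.q⁻¹ j) y) x +
        D.vOps lam (derivR D.q j y) (D.gOp lam (D.g j) (D.gOp lam (D.g j) x)) -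
          D.vOps lam (scale (D.q⁻¹ j) (derivL D.q j y)) x := by
  induction y using word_induction with
  | h1 => simp
  | hadd x y hx hy =>
    simp only [map_add, LinearMap.add_apply, hx, hy, mul_add]
    abel
  | hsmul c x hx =>
    simp only [map_smul, LinearMap.smul_apply, hx, mul_smul_comm, smul_add, smul_sub]
  | hι i y hy =>
    have h1 : (D.q⁻¹ j i : k) = (((D.q i j)⁻¹ : kˣ) : k) := by simp [D.symm i j]
    have h2 : (fun l => D.χ l (D.g j)) = D.q j := by
      ext l
      rw [D.χ_g]
    have h3 : D.q j * D.q⁻¹ j = 1 := by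
      ext l
      simp
    -- The two operators `gⱼ` contribute the scaling `q j` twice and one of them cancels `q⁻¹ j`;
    -- what remains is the twist in the Leibniz rule of the right derivation.
    have hA : D.gOp lam (D.g j) (D.gOp lam (D.g j) (D.vOps lam (scale (D.q⁻¹ j) y) x)) =
        D.vOps lam (twist D.q j y) (D.gOp lam (D.g j) (D.gOp lam (D.g j) x)) := by
      rw [gOp_vOps, gOp_vOps, h2, scale_scale, scale_scale, mul_assoc, h3, mul_one, twist_eq_scale]
    rw [vOps_ι_mul, hy, map_sub, map_add, vOp_ι_mul, derivR_ι_mul, derivL_ι_mul]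
    simp only [map_mul (scale (D.q⁻¹ j)), scale_ι, h1, map_add, LinearMap.add_apply, vOps_ι_mul,
      smul_mul_assoc, map_smul, LinearMap.smul_apply, smul_smul, mul_smul_comm, Units.mul_inv,
      one_smul]
    split_ifs with hij
    · subst hij
      rw [hA]
      abel
    · simp only [map_zero, LinearMap.zero_apply]
      abel

/-- The induction is on the vector `x`, for all `y` in `J(V)` at once. On `1` only the counit of `y`
survives, which is zero; moving `y` past `wⱼ` replaces it by rescalings and skew derivatives, again
in `J(V)`. -/
theorem vOps_of_mem (x : FreeAlgebra k (Fin θ)) :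
    ∀ y ∈ nicholsIdeal D.q, D.vOps lam y x = 0 := by
  -- Being annihilated by `J(V)` is stable under `Γ`, since `J(V)` is stable under rescaling the
  -- generators.
  have hg : ∀ (γ : Γ) (x : FreeAlgebra k (Fin θ)), (∀ y ∈ nicholsIdeal D.q, D.vOps lam y x = 0) →
      ∀ y ∈ nicholsIdeal D.q, D.vOps lam y (D.gOp lam γ x) = 0 := by
    intro γ x hx y hy
    have h := D.gOp_vOps lam γ (scale (fun i => (D.χ i γ)⁻¹) y) x
    have h1 : (fun i => D.χ i γ) * (fun i => (D.χ i γ)⁻¹) = 1 := by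
      ext i
      simp
    rwa [scale_scale, h1, scale_one, hx _ (scale_mem_nicholsIdeal _ hy), map_zero, eq_comm] at h
  induction x using word_induction with
  | h1 =>
    intro y hy
    rw [vOps_one, counit_of_mem_degGeTwo (nicholsIdeal_le_degGeTwo hy), zero_smul]
  | hadd a b ha hb => intro y hy; rw [map_add, ha y hy, hb y hy, add_zero]
  | hsmul c a ha => intro y hy; rw [map_smul, ha y hy, smul_zero]
  | hι j x hx =>
    intro y hy
    rw [vOps_ι_mul_right, hx _ (scale_mem_nicholsIdeal _ hy),
      hg _ _ (hg _ _ hx) _ (derivR_mem_nicholsIdeal j hy),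
      hx _ (scale_mem_nicholsIdeal _ (derivL_mem_nicholsIdeal j hy))]
    simp

theorem gOp_mem (γ : Γ) {x : FreeAlgebra k (Fin θ)} (hx : x ∈ nicholsIdeal D.q⁻¹) :
    D.gOp lam γ x ∈ nicholsIdeal D.q⁻¹ :=
  Submodule.smul_mem _ _ (scale_mem_nicholsIdeal _ hx)

theorem vOp_mem (i : Fin θ) {x : FreeAlgebra k (Fin θ)} (hx : x ∈ nicholsIdeal D.q⁻¹) :
    D.vOp lam i x ∈ nicholsIdeal D.q⁻¹ :=
  sub_mem (Submodule.smul_mem _ _ (scale_mem_nicholsIdeal _ (derivR_mem_nicholsIdeal i hx)))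
    (derivL_mem_nicholsIdeal i hx)

/-- The vector space `B(W)`. -/
abbrev NegPart : Type u := FreeAlgebra k (Fin θ) ⧸ nicholsIdeal D.q⁻¹

/-- The operators by which the generators of `U` act on `B(W)`. -/
noncomputable def vermaOp : Gen θ Γ → Module.End k D.NegPart
  | .v i => (nicholsIdeal D.q⁻¹).mapQ _ (D.vOp lam i) fun _ hx => D.vOp_mem lam i hx
  | .w i => (nicholsIdeal D.q⁻¹).mapQ _ (LinearMap.mulLeft k (FreeAlgebra.ι k i))
      fun _ hx => mul_mem_nicholsIdeal_left _ hx
  | .g γ => (nicholsIdeal D.q⁻¹).mapQ _ (D.gOp lam γ) fun _ hx => D.gOp_mem lam γ hx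

theorem vermaOp_v (i : Fin θ) (x : FreeAlgebra k (Fin θ)) :
    D.vermaOp lam (.v i) ((nicholsIdeal D.q⁻¹).mkQ x) =
      (nicholsIdeal D.q⁻¹).mkQ (D.vOp lam i x) := rfl

theorem vermaOp_w (i : Fin θ) (x : FreeAlgebra k (Fin θ)) :
    D.vermaOp lam (.w i) ((nicholsIdeal D.q⁻¹).mkQ x) =
      (nicholsIdeal D.q⁻¹).mkQ (FreeAlgebra.ι k i * x) := rfl

theorem vermaOp_g (γ : Γ) (x : FreeAlgebra k (Fin θ)) :
    D.vermaOp lam (.g γ) ((nicholsIdeal D.q⁻¹).mkQ x) =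
      (nicholsIdeal D.q⁻¹).mkQ (D.gOp lam γ x) := rfl

theorem lift_vermaOp_v (y x : FreeAlgebra k (Fin θ)) :
    FreeAlgebra.lift k (fun i => D.vermaOp lam (.v i)) y ((nicholsIdeal D.q⁻¹).mkQ x) =
      (nicholsIdeal D.q⁻¹).mkQ (D.vOps lam y x) := by
  induction y using word_induction with
  | h1 => simp
  | hι i y hy =>
    rw [map_mul, FreeAlgebra.lift_ι_apply, Module.End.mul_apply, hy, vermaOp_v, vOps_ι_mul]
  | hadd a b ha hb => simp only [map_add, LinearMap.add_apply, ha, hb]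
  | hsmul c a ha => simp only [map_smul, LinearMap.smul_apply, ha]

theorem lift_vermaOp_w (y x : FreeAlgebra k (Fin θ)) :
    FreeAlgebra.lift k (fun i => D.vermaOp lam (.w i)) y ((nicholsIdeal D.q⁻¹).mkQ x) =
      (nicholsIdeal D.q⁻¹).mkQ (y * x) := by
  induction y using word_induction with
  | h1 => simp
  | hι i y hy =>
    rw [map_mul, FreeAlgebra.lift_ι_apply, Module.End.mul_apply, hy, vermaOp_w, mul_assoc]
  | hadd a b ha hb => simp only [map_add, LinearMap.add_apply, ha, hb, add_mul]
  | hsmul c a ha => simp only [map_smul, LinearMap.smul_apply, ha, smul_mul_assoc]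

variable {D lam} in
theorem negPart_end_ext {f g : Module.End k D.NegPart}
    (h : ∀ x, f ((nicholsIdeal D.q⁻¹).mkQ x) = g ((nicholsIdeal D.q⁻¹).mkQ x)) : f = g :=
  Submodule.linearMap_qext _ (LinearMap.ext h)

/-- The action of `U` on `B(W)`. -/
noncomputable def vermaRep : D.U →ₐ[k] Module.End k D.NegPart :=
  RingQuot.liftAlgHom k ⟨FreeAlgebra.lift k (D.vermaOp lam), by
    intro x y h
    induction h with
    | g_one =>
      refine negPart_end_ext fun x => ?_
      rw [FreeAlgebra.lift_ι_apply, vermaOp_g, gOp_apply]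
      have : (fun i => ((D.χ i) 1)⁻¹) = 1 := by ext; simp
      rw [this, scale_one, form_one, Units.val_one, one_smul, map_one, Module.End.one_apply]
    | g_mul γ γ' =>
      refine negPart_end_ext fun x => ?_
      rw [map_mul, Module.End.mul_apply]
      simp only [FreeAlgebra.lift_ι_apply, vermaOp_g, gOp_apply, map_smul, scale_scale, smul_smul,
        form_mul, Units.val_mul]
      have : (fun i => (D.χ i (γ * γ'))⁻¹) =
          (fun i => (D.χ i γ)⁻¹) * fun i => (D.χ i γ')⁻¹ := by
        funext i
        simp [mul_comm]
      rw [this, mul_comm (D.form γ' lam : k)]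
    | g_v γ i =>
      refine negPart_end_ext fun x => ?_
      simp only [map_smul, map_mul, Module.End.mul_apply, LinearMap.smul_apply,
        FreeAlgebra.lift_ι_apply, vermaOp_g, vermaOp_v, gOp_vOp]
    | g_w γ i =>
      refine negPart_end_ext fun x => ?_
      simp only [map_smul, map_mul, Module.End.mul_apply, LinearMap.smul_apply,
        FreeAlgebra.lift_ι_apply, vermaOp_g, vermaOp_w, gOp_ι_mul]
    | nichols_v x hx =>
      refine negPart_end_ext fun y => ?_
      rw [lift_comp_ι]
      simp only [FreeAlgebra.lift_ι_apply]
      rw [lift_vermaOp_v, vOps_of_mem _ _ _ _ hx]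
      simp
    | nichols_w x hx =>
      refine negPart_end_ext fun y => ?_
      rw [lift_comp_ι]
      simp only [FreeAlgebra.lift_ι_apply]
      rw [lift_vermaOp_w, map_zero, LinearMap.zero_apply, Submodule.mkQ_apply,
        Submodule.Quotient.mk_eq_zero]
      exact mul_mem_nicholsIdeal_right y hx
    | linking i j =>
      refine negPart_end_ext fun x => ?_
      rw [D.χ_g, map_sub, map_smul, map_mul, map_mul]
      simp only [FreeAlgebra.lift_ι_apply, LinearMap.sub_apply, Module.End.mul_apply,
        LinearMap.smul_apply, vermaOp_w, vermaOp_v, vOp_ι_mul, map_add, map_smul,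
        add_sub_cancel_left]
      split_ifs with hij
      · simp only [map_sub, map_mul, map_one, FreeAlgebra.lift_ι_apply, pow_two,
          LinearMap.sub_apply, Module.End.mul_apply, Module.End.one_apply, vermaOp_g]
      · simp⟩

theorem vermaRep_gen (x : Gen θ Γ) : D.vermaRep lam (D.gen x) = D.vermaOp lam x := by
  rw [vermaRep, gen, mkU, RingQuot.liftAlgHom_mkAlgHom_apply, FreeAlgebra.lift_ι_apply]

/-- The Verma module of highest weight `lam`, realized on `B(W)`. -/
noncomputable def verma : GrMod.{u, max u v, u} k D.U θ :=
  letI : Module D.U D.NegPart := Module.compHom D.NegPart (D.vermaRep lam).toRingHom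
  haveI : IsScalarTower k D.U D.NegPart := ⟨fun c b x => by
    change D.vermaRep lam (c • b) x = c • (D.vermaRep lam b x)
    rw [map_smul, LinearMap.smul_apply]⟩
  { carrier := D.NegPart
    gr := fun μ => (homog k alpha (lam - μ)).map (nicholsIdeal D.q⁻¹).mkQ }

/-- The quotient map from `T(W)` to the Verma module. -/
noncomputable def vermaMk : FreeAlgebra k (Fin θ) →ₗ[k] (D.verma lam).carrier :=
  (nicholsIdeal D.q⁻¹).mkQ

theorem vermaMk_surjective : Function.Surjective (D.vermaMk lam) :=
  Submodule.mkQ_surjective _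

theorem vermaMk_eq_zero {x : FreeAlgebra k (Fin θ)} :
    D.vermaMk lam x = 0 ↔ x ∈ nicholsIdeal D.q⁻¹ := Submodule.Quotient.mk_eq_zero _

theorem verma_gen_smul (x : Gen θ Γ) (y : (D.verma lam).carrier) :
    D.gen x • y = D.vermaOp lam x y := by
  rw [← vermaRep_gen]
  rfl

theorem verma_v_smul (i : Fin θ) (x : FreeAlgebra k (Fin θ)) :
    D.gen (.v i) • D.vermaMk lam x = D.vermaMk lam (D.vOp lam i x) := verma_gen_smul _ _ _ _

theorem verma_w_smul (i : Fin θ) (x : FreeAlgebra k (Fin θ)) :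
    D.gen (.w i) • D.vermaMk lam x = D.vermaMk lam (FreeAlgebra.ι k i * x) := verma_gen_smul _ _ _ _

theorem verma_g_smul (γ : Γ) (x : FreeAlgebra k (Fin θ)) :
    D.gen (.g γ) • D.vermaMk lam x = D.vermaMk lam (D.gOp lam γ x) := verma_gen_smul _ _ _ _

theorem wlift_smul_vermaMk (y x : FreeAlgebra k (Fin θ)) :
    D.wlift y • D.vermaMk lam x = D.vermaMk lam (y * x) := by
  induction y using word_induction with
  | h1 => simp
  | hι i y hy => rw [map_mul, wlift_ι, mul_smul, hy, verma_w_smul, mul_assoc]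
  | hadd a b ha hb => simp only [map_add, add_smul, ha, hb, add_mul]
  | hsmul c a ha => rw [map_smul, smul_assoc, ha, smul_mul_assoc, map_smul]

theorem mem_verma_gr {μ : Lat θ} {y : (D.verma lam).carrier} :
    y ∈ (D.verma lam).gr μ ↔ ∃ x ∈ homog k alpha (lam - μ), D.vermaMk lam x = y := Iff.rfl

theorem isHighest_verma : IsHighest (D.verma lam) lam (D.vermaMk lam 1) where
  mem := ⟨1, by rw [sub_self]; exact one_mem_homog _, rfl⟩
  g_smul γ := by rw [verma_g_smul, gOp_apply, map_one, map_smul]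
  v_smul i := by rw [verma_v_smul, vOp_one, map_zero]

theorem vOp_mem_homog (i : Fin θ) {β : Lat θ} {x : FreeAlgebra k (Fin θ)}
    (hx : x ∈ homog k alpha β) : D.vOp lam i x ∈ homog k alpha (β - alpha i) := by
  induction hx using homog_induction with
  | h0 => simp
  | hadd a b ha hb => rw [map_add]; exact add_mem ha hb
  | hsmul c a ha => rw [map_smul]; exact Submodule.smul_mem _ _ ha
  | hw l hl =>
    subst hl
    induction l with
    | nil => simp
    | cons j l ih =>
      rw [word_cons, vOp_ι_mul, List.map_cons, List.sum_cons]
      refine add_mem (Submodule.smul_mem _ _ ?_) ?_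
      · rw [add_sub_assoc]
        exact homog_mul (ι_mem_homog _ _) ih
      · split_ifs with hij
        · subst hij
          rw [add_sub_cancel_left, gOp_apply, gOp_apply, map_smul]
          have h := word_mem_homog (k := k) alpha l
          rw [scale_of_mem _ h, map_smul, scale_of_mem _ h]
          exact sub_mem (Submodule.smul_mem _ _ (Submodule.smul_mem _ _ (Submodule.smul_mem _ _
            (Submodule.smul_mem _ _ h)))) h
        · exact zero_mem _

theorem form_eq_prod (γ : Γ) (β : Lat θ) : D.form γ β = ∏ i, D.χ i γ ^ β i := by
  have h : β = ∑ i, β i • alpha i := by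
    ext j
    simp [alpha, Finset.sum_apply, Pi.single_apply]
  have h2 : ∀ s : Finset (Fin θ), D.form γ (∑ i ∈ s, β i • alpha i) = ∏ i ∈ s, D.χ i γ ^ β i := by
    intro s
    classical
    induction s using Finset.induction_on with
    | empty => simp
    | insert a s ha ih =>
      rw [Finset.sum_insert ha, Finset.prod_insert ha, form_add, ih, ← form_alpha]
      rw [form, ofAdd_zsmul, map_zpow, form]
  conv_lhs => rw [h]
  exact h2 _

theorem isObj_verma [FiniteDimensional k D.NegPart] : D.IsObj (D.verma lam) where
  finite := inferInstanceAs (FiniteDimensional k D.NegPart)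
  -- The ideal is homogeneous, so the projections of the free algebra descend to the quotient;
  -- degree `β` of `B(W)` becomes weight `lam - β`.
  internal := by
    let e : Lat θ ≃ Lat θ := Equiv.subLeft lam
    have hJ : ∀ β, nicholsIdeal D.q⁻¹ ≤ (nicholsIdeal D.q⁻¹).comap
        (gproj (isInternal_homog (k := k) (alpha (θ := θ))) β) :=
      fun β x hx => gproj_mem_nicholsIdeal hx β
    refine isInternal_of_proj (gr := (D.verma lam).gr) ?_ (fun μ => (nicholsIdeal D.q⁻¹).mapQ _ _
      (hJ (lam - μ))) ?_ ?_
    · change ⨆ μ, (homog k alpha (e μ)).map (D.vermaMk lam) = ⊤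
      rw [e.iSup_comp (g := fun β => (homog k alpha β).map (D.vermaMk lam)), ← Submodule.map_iSup,
        iSup_homog, Submodule.map_top, LinearMap.range_eq_top]
      exact D.vermaMk_surjective lam
    · rintro μ _ ⟨x, hx, rfl⟩
      exact congrArg (D.vermaMk lam) (gproj_of_mem _ hx)
    · rintro μ ν hne _ ⟨x, hx, rfl⟩
      refine (congrArg (D.vermaMk lam) (gproj_of_mem_ne _ hx ?_)).trans (map_zero _)
      exact fun h => hne (e.injective h)
  g_smul γ mu m hm := by
    obtain ⟨x, hx, rfl⟩ := (D.mem_verma_gr lam).1 hm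
    rw [verma_g_smul, gOp_apply, scale_of_mem _ hx, smul_smul, map_smul, ← Units.val_mul]
    congr 2
    have h : mu = lam - (lam - mu) := by abel
    conv_rhs => rw [h, form_sub, form_eq_prod _ _ (lam - mu), ← Finset.prod_inv_distrib]
    simp only [inv_zpow]
  v_smul i mu m hm := by
    obtain ⟨x, hx, rfl⟩ := (D.mem_verma_gr lam).1 hm
    rw [verma_v_smul]
    refine ⟨_, ?_, rfl⟩
    rw [← sub_sub]
    exact D.vOp_mem_homog lam i hx
  w_smul i mu m hm := by
    obtain ⟨x, hx, rfl⟩ := (D.mem_verma_gr lam).1 hm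
    rw [verma_w_smul]
    refine ⟨_, ?_, rfl⟩
    have h : lam - (mu - alpha i) = alpha i + (lam - mu) := by abel
    rw [h]
    exact homog_mul (ι_mem_homog _ _) hx

/-- Since `J(q) ⊆ J(q⁻¹)`, the algebra `B(V)` maps onto `B(W)`. As `B(V)` is a ring quotient and
`B(W)` is here a quotient space, the map is built as an action by left multiplications, applied to
the class of `1`. The weight `0` is immaterial: the operators of the `wᵢ` do not depend on it. -/
theorem finite_negPart [FiniteDimensional k (NicholsAlgebra D.q)] :
    FiniteDimensional k D.NegPart := by
  let π := RingQuot.mkAlgHom k fun a b : FreeAlgebra k (Fin θ) => a ∈ nicholsIdeal D.q ∧ b = 0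
  let ρ : Module.End k D.NegPart → D.NegPart := fun f => f ((nicholsIdeal D.q⁻¹).mkQ 1)
  let f : NicholsAlgebra D.q →ₐ[k] Module.End k D.NegPart :=
    RingQuot.liftAlgHom k ⟨FreeAlgebra.lift k (fun i => D.vermaOp 0 (.w i)), by
      rintro x y ⟨hx, rfl⟩
      refine negPart_end_ext fun y => ?_
      rw [lift_vermaOp_w, map_zero, LinearMap.zero_apply, Submodule.mkQ_apply,
        Submodule.Quotient.mk_eq_zero]
      exact mul_mem_nicholsIdeal_right y (nicholsIdeal_le_inv D.symm hx)⟩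
  let g : NicholsAlgebra D.q →ₗ[k] D.NegPart :=
    LinearMap.applyₗ ((nicholsIdeal D.q⁻¹).mkQ 1) ∘ₗ f.toLinearMap
  refine Module.Finite.of_surjective g fun y => ?_
  obtain ⟨x, rfl⟩ := Submodule.mkQ_surjective _ y
  refine ⟨π x, ?_⟩
  change f (π x) _ = _
  rw [RingQuot.liftAlgHom_mkAlgHom_apply, lift_vermaOp_w, mul_one]

theorem finite_negPart_opp [FiniteDimensional k (NicholsAlgebra D.q)] :
    FiniteDimensional k D.opp.NegPart := by
  have h := D.finite_negPart
  have hq : nicholsIdeal D.opp.q⁻¹ = nicholsIdeal D.q⁻¹ := by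
    change nicholsIdeal D.q⁻¹⁻¹ = _
    refine le_antisymm ?_ (nicholsIdeal_le_inv D.opp.symm)
    rw [inv_inv]
    exact nicholsIdeal_le_inv D.symm
  unfold NegPart
  rw [hq]
  exact h

end Datum

section Ind

variable {k : Type u} [Field k] {θ : ℕ} {A : Type v} [Ring A] [Algebra k A]
  {B : Type v} [Ring B] [Algebra k B] (φ : B →ₐ[k] A) (grA : Lat θ → Submodule k A)
  (T : GrMod.{u, v, w} k B θ)

/-! ### Induced modules -/

namespace GrMod

/-- The element `a ⊗ t` of the induced module. -/
noncomputable def indMk (a : A) (t : T.carrier) : (GrMod.ind φ grA T).carrier :=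
  (balanced φ T.carrier).mkQ (a ⊗ₜ[k] t)

theorem smul_indMk (a b : A) (t : T.carrier) :
    a • indMk φ grA T b t = indMk φ grA T (a * b) t := rfl

theorem indMk_smul (c : k) (a : A) (t : T.carrier) :
    c • indMk φ grA T a t = indMk φ grA T a (c • t) :=
  congrArg (balanced φ T.carrier).mkQ (TensorProduct.tmul_smul c a t).symm

theorem indMk_mul (a : A) (b : B) (t : T.carrier) :
    indMk φ grA T (a * φ b) t = indMk φ grA T a (b • t) :=
  (Submodule.Quotient.eq _).2 (Submodule.subset_span ⟨a, b, t, rfl⟩)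

theorem ind_induction {P : (GrMod.ind φ grA T).carrier → Prop} (h0 : P 0)
    (hmk : ∀ a t, P (indMk φ grA T a t)) (hadd : ∀ x y, P x → P y → P (x + y))
    (x : (GrMod.ind φ grA T).carrier) : P x := by
  obtain ⟨y, rfl⟩ := Submodule.mkQ_surjective _ x
  induction y using TensorProduct.induction_on with
  | zero => exact h0
  | tmul a t => exact hmk a t
  | add a b ha hb => exact hadd _ _ ha hb

theorem indMk_mem_gr {β γ : Lat θ} {a : A} {t : T.carrier} (ha : a ∈ grA β) (ht : t ∈ T.gr γ) :
    indMk φ grA T a t ∈ (GrMod.ind φ grA T).gr (β + γ) := by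
  refine le_iSup (fun β' : Lat θ => (Submodule.map₂ (TensorProduct.mk k A T.carrier) (grA β')
    (T.gr (β + γ - β'))).map ((balanced φ T.carrier).mkQ.restrictScalars k)) β
    ⟨a ⊗ₜ[k] t, Submodule.apply_mem_map₂ _ ha ?_, rfl⟩
  rwa [add_sub_cancel_left]

theorem ind_gr_le {μ : Lat θ} {P : Submodule k (GrMod.ind φ grA T).carrier}
    (hP : ∀ β, ∀ a ∈ grA β, ∀ t ∈ T.gr (μ - β), indMk φ grA T a t ∈ P) :
    (GrMod.ind φ grA T).gr μ ≤ P :=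
  iSup_le fun β => Submodule.map_le_iff_le_comap.2 (Submodule.map₂_le.2 fun a ha t ht =>
    hP β a ha t ht)

variable {φ T} {M : Type w'} [AddCommGroup M] [Module k M] [Module A M] [IsScalarTower k A M]

/-- The linear map `a ⊗ t ↦ a • g t`. -/
noncomputable def tensorDesc (A : Type v) [Ring A] [Algebra k A] [Module A M] [IsScalarTower k A M]
    {T : Type w} [AddCommGroup T] [Module k T] (g : T →ₗ[k] M) : A ⊗[k] T →ₗ[k] M :=
  TensorProduct.lift ((Algebra.lsmul k k M : A →ₐ[k] Module.End k M).toLinearMap.compl₂ g)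

theorem tensorDesc_smul {T : Type w} [AddCommGroup T] [Module k T] (g : T →ₗ[k] M) (a : A)
    (z : A ⊗[k] T) : tensorDesc A g (a • z) = a • tensorDesc A g z := by
  induction z using TensorProduct.induction_on with
  | zero => simp
  | tmul b t => exact mul_smul a b (g t)
  | add x y hx hy => rw [smul_add, map_add, hx, hy, map_add, smul_add]

/-- The universal property of the induced module. -/
noncomputable def indDesc (g : T.carrier →ₗ[k] M) (hg : ∀ b t, g (b • t) = φ b • g t) :
    (GrMod.ind φ grA T).carrier →ₗ[A] M :=
  Submodule.liftQ (balanced φ T.carrier)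
    { tensorDesc A g with map_smul' := tensorDesc_smul g } (by
    refine Submodule.span_le.2 ?_
    rintro _ ⟨a, b, t, rfl⟩
    rw [SetLike.mem_coe, LinearMap.mem_ker, map_sub, sub_eq_zero]
    change (a * φ b) • g t = a • g (b • t)
    rw [hg, mul_smul])

theorem indDesc_indMk (g : T.carrier →ₗ[k] M) (hg : ∀ b t, g (b • t) = φ b • g t) (a : A)
    (t : T.carrier) : indDesc grA g hg (indMk φ grA T a t) = a • g t := rfl

end GrMod

end Ind

namespace Datum

variable {k : Type u} [Field k] {Γ : Type v} [CommGroup Γ] {θ : ℕ} (D : Datum k Γ θ) (lam : Lat θ)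

/-! ### Weyl modules -/

/-- The projection of the free algebra on the generators to `B`. -/
noncomputable def mkB : FreeAlgebra k (BGen θ Γ) →ₐ[k] D.Bor := RingQuot.mkAlgHom k D.BRel

theorem mkB_surjective : Function.Surjective D.mkB := RingQuot.mkAlgHom_surjective k D.BRel

theorem toU_v (i : Fin θ) : D.toU (D.mkB (FreeAlgebra.ι k (.v i))) = D.gen (.v i) := by
  rw [toU, mkB, RingQuot.liftAlgHom_mkAlgHom_apply]
  simp

theorem toU_g (γ : Γ) : D.toU (D.mkB (FreeAlgebra.ι k (.g γ))) = D.gen (.g γ) := by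
  rw [toU, mkB, RingQuot.liftAlgHom_mkAlgHom_apply]
  simp

theorem charB_v (i : Fin θ) : D.charB lam (D.mkB (FreeAlgebra.ι k (.v i))) = 0 := by
  rw [charB, mkB, RingQuot.liftAlgHom_mkAlgHom_apply]
  simp

theorem charB_g (γ : Γ) :
    D.charB lam (D.mkB (FreeAlgebra.ι k (.g γ))) = (D.form γ lam : k) := by
  rw [charB, mkB, RingQuot.liftAlgHom_mkAlgHom_apply]
  simp

variable {D} in
theorem bor_induction {P : D.Bor → Prop} (h1 : P 1)
    (hv : ∀ i b, P b → P (D.mkB (FreeAlgebra.ι k (.v i)) * b))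
    (hg : ∀ γ b, P b → P (D.mkB (FreeAlgebra.ι k (.g γ)) * b))
    (hadd : ∀ x y, P x → P y → P (x + y)) (hsmul : ∀ (c : k) x, P x → P (c • x)) (b : D.Bor) :
    P b := by
  obtain ⟨x, rfl⟩ := D.mkB_surjective b
  induction x using word_induction with
  | h1 => simpa using h1
  | hι i x hx =>
    rw [map_mul]
    cases i with
    | v i => exact hv i _ hx
    | g γ => exact hg γ _ hx
  | hadd x y hx hy => rw [map_add]; exact hadd _ _ hx hy
  | hsmul c x hx => rw [map_smul]; exact hsmul c _ hx

variable {lam} in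
variable {D} in
theorem IsHighest.toU_smul {M : GrMod.{u, max u v, w} k D.U θ} {m : M.carrier}
    (h : IsHighest M lam m) (b : D.Bor) : D.toU b • m = D.charB lam b • m := by
  induction b using bor_induction with
  | h1 => simp
  | hv i b hb => rw [map_mul, mul_smul, hb, toU_v, smul_comm, h.v_smul, map_mul, charB_v]; simp
  | hg γ b hb => rw [map_mul, mul_smul, hb, toU_g, smul_comm, h.g_smul, map_mul, charB_g, smul_smul,
      mul_comm]
  | hadd a b ha hb => simp only [map_add, add_smul, ha, hb]
  | hsmul c a ha => simp only [map_smul, smul_assoc, ha]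

/-- The basis vector of the one-dimensional module. -/
def oneDimVec : (D.oneDim lam).carrier := (1 : k)

theorem oneDim_eq (t : (D.oneDim lam).carrier) : ∃ c : k, t = c • D.oneDimVec lam :=
  let c : k := t
  ⟨c, (mul_one c).symm⟩

theorem bor_smul (b : D.Bor) (t : (D.oneDim lam).carrier) : b • t = D.charB lam b • t := rfl

theorem oneDimVec_mem : D.oneDimVec lam ∈ (D.oneDim lam).gr lam := by
  change (1 : k) ∈ (if lam = lam then ⊤ else ⊥ : Submodule k k)
  simp

theorem oneDim_gr {μ : Lat θ} {t : (D.oneDim lam).carrier} (ht : t ∈ (D.oneDim lam).gr μ) :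
    t = 0 ∨ μ = lam := by
  change (t : k) ∈ (if μ = lam then ⊤ else ⊥ : Submodule k k) at ht
  split_ifs at ht with h
  · exact Or.inr h
  · exact Or.inl ht

/-- The highest weight vector of the Weyl module. -/
noncomputable def weylVec : (D.weyl lam).carrier :=
  GrMod.indMk D.toU D.grU (D.oneDim lam) 1 (D.oneDimVec lam)

theorem smul_weylVec (u : D.U) : u • D.weylVec lam =
    GrMod.indMk D.toU D.grU (D.oneDim lam) u (D.oneDimVec lam) :=
  (GrMod.smul_indMk D.toU D.grU (D.oneDim lam) u 1 _).trans (by rw [mul_one])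

theorem weyl_exists_smul (x : (D.weyl lam).carrier) : ∃ u : D.U, x = u • D.weylVec lam := by
  refine GrMod.ind_induction D.toU D.grU (D.oneDim lam)
    (P := fun x => ∃ u : D.U, x = u • D.weylVec lam) ⟨0, (zero_smul _ _).symm⟩ ?_ ?_ x
  · intro u t
    obtain ⟨c, rfl⟩ := D.oneDim_eq lam t
    refine ⟨c • u, ?_⟩
    rw [← GrMod.indMk_smul, smul_assoc, smul_weylVec]
    rfl
  · rintro _ _ ⟨c, rfl⟩ ⟨d, rfl⟩
    exact ⟨c + d, (add_smul c d (D.weylVec lam)).symm⟩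

theorem smul_weylVec_mem {β : Lat θ} {u : D.U} (hu : u ∈ D.grU β) :
    u • D.weylVec lam ∈ (D.weyl lam).gr (β + lam) := by
  rw [smul_weylVec]
  exact GrMod.indMk_mem_gr D.toU D.grU (D.oneDim lam) hu (D.oneDimVec_mem lam)

theorem toU_smul_weylVec (b : D.Bor) : D.toU b • D.weylVec lam = D.charB lam b • D.weylVec lam := by
  rw [smul_weylVec, ← one_mul (D.toU b), GrMod.indMk_mul, bor_smul, ← GrMod.indMk_smul]
  rfl

theorem isHighest_weylVec : IsHighest (D.weyl lam) lam (D.weylVec lam) where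
  mem := by
    have := D.smul_weylVec_mem lam D.one_mem_grU
    rwa [one_smul, zero_add] at this
  g_smul γ := by rw [← toU_g, toU_smul_weylVec, charB_g]
  v_smul i := by rw [← toU_v, toU_smul_weylVec, charB_v, zero_smul]

section Desc

variable {D lam} {M : GrMod.{u, max u v, w} k D.U θ} {m : M.carrier}

/-- The linear map sending the basis vector of the one-dimensional module to `m`. -/
noncomputable def oneDimLift (lam : Lat θ) (m : M.carrier) :
    (D.oneDim lam).carrier →ₗ[k] M.carrier :=
  LinearMap.toSpanSingleton k M.carrier m

theorem oneDimLift_vec (m : M.carrier) : oneDimLift lam m (D.oneDimVec lam) = m :=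
  one_smul k m

theorem oneDimLift_smul (h : IsHighest M lam m) (b : D.Bor) (t : (D.oneDim lam).carrier) :
    oneDimLift lam m (b • t) = D.toU b • oneDimLift lam m t := by
  obtain ⟨c, rfl⟩ := D.oneDim_eq lam t
  rw [bor_smul, map_smul, map_smul, oneDimLift_vec, smul_comm (D.toU b), h.toU_smul, smul_comm]

/-- The map from the Weyl module given by a vector of highest weight. -/
noncomputable def weylDesc (h : IsHighest M lam m) : (D.weyl lam).carrier →ₗ[D.U] M.carrier :=
  GrMod.indDesc D.grU (oneDimLift lam m) (oneDimLift_smul h)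

theorem weylDesc_smul_vec (h : IsHighest M lam m) (u : D.U) :
    weylDesc h (u • D.weylVec lam) = u • m := by
  rw [smul_weylVec]
  refine (GrMod.indDesc_indMk _ _ (oneDimLift_smul h) _ _).trans ?_
  rw [oneDimLift_vec]

theorem weyl_gr_induction {μ : Lat θ} (P : Submodule k (D.weyl lam).carrier)
    (hP : ∀ u ∈ D.grU (μ - lam), u • D.weylVec lam ∈ P) : (D.weyl lam).gr μ ≤ P := by
  refine GrMod.ind_gr_le D.toU D.grU (D.oneDim lam) fun β u hu t ht => ?_
  obtain ⟨c, rfl⟩ := D.oneDim_eq lam t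
  rw [← GrMod.indMk_smul, ← smul_weylVec]
  rcases D.oneDim_gr lam ht with h | h
  · rw [smul_weylVec, GrMod.indMk_smul, h, ← zero_smul k (D.oneDimVec lam), ← GrMod.indMk_smul,
      zero_smul]
    exact P.zero_mem
  · refine P.smul_mem _ (hP u ?_)
    rwa [← h, sub_sub_cancel]

theorem weylDesc_mem_gr (hM : D.IsObj M) (h : IsHighest M lam m) (μ : Lat θ)
    (x : (D.weyl lam).carrier) (hx : x ∈ (D.weyl lam).gr μ) : weylDesc h x ∈ M.gr μ := by
  refine weyl_gr_induction ((M.gr μ).comap ((weylDesc h).restrictScalars k)) (fun u hu => ?_) hx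
  rw [Submodule.mem_comap, LinearMap.restrictScalars_apply, weylDesc_smul_vec]
  have := hM.smul_mem hu h.mem
  rwa [sub_add_cancel] at this

end Desc

/-- The Weyl module is isomorphic to the Verma module on `B(W)`. -/
theorem weyl_iso_verma [FiniteDimensional k D.NegPart] :
    Nonempty ((D.weyl lam).Iso (D.verma lam)) := by
  have hV := D.isObj_verma lam
  have h := D.isHighest_verma lam
  have hw : ∀ x, weylDesc h (D.wlift x • D.weylVec lam) = D.vermaMk lam x := fun x => by
    rw [weylDesc_smul_vec, wlift_smul_vermaMk, mul_one]
  have hex : ∀ y, ∃ x, y = D.wlift x • D.weylVec lam := fun y => by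
    obtain ⟨u, rfl⟩ := D.weyl_exists_smul lam y
    exact (D.isHighest_weylVec lam).exists_wlift u
  -- Every element is `wlift x` applied to the generator, with image the class of `x`; if this class
  -- vanishes, `wlift x` is already zero in `U`.
  have hinj : Function.Injective (weylDesc h) := by
    rw [injective_iff_map_eq_zero]
    intro y hy
    obtain ⟨x, rfl⟩ := hex y
    rw [hw, vermaMk_eq_zero] at hy
    rw [D.wlift_of_mem hy, zero_smul]
  have hsurj : Function.Surjective (weylDesc h) := by
    intro y
    obtain ⟨x, rfl⟩ := D.vermaMk_surjective lam y
    exact ⟨_, hw x⟩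
  refine ⟨⟨LinearEquiv.ofBijective _ ⟨hinj, hsurj⟩, fun μ m =>
    ⟨weylDesc_mem_gr hV h μ m, fun hm => ?_⟩⟩⟩
  obtain ⟨x, hx, e⟩ := (D.mem_verma_gr lam).1 hm
  rw [← hw] at e
  rw [← hinj e]
  have := D.smul_weylVec_mem lam (D.wlift_mem_grU hx)
  rwa [neg_sub, sub_add_cancel] at this

theorem isObj_weyl [FiniteDimensional k D.NegPart] : D.IsObj (D.weyl lam) := by
  obtain ⟨e⟩ := D.weyl_iso_verma lam
  exact isObj_of_iso e.symm (D.isObj_verma lam)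

/-- Its image in the Verma module is the class of `1`, which is nonzero because the Nichols ideal
lies in degrees `≥ 2`. -/
theorem weylVec_ne_zero : D.weylVec lam ≠ 0 := by
  intro h
  have h1 := weylDesc_smul_vec (D.isHighest_verma lam) 1
  rw [h, smul_zero, map_zero, one_smul, eq_comm, vermaMk_eq_zero] at h1
  have h2 := counit_of_mem_degGeTwo (nicholsIdeal_le_degGeTwo h1)
  simp at h2

/-- The component of highest weight of the Weyl module. -/
theorem weyl_gr_top {x : (D.weyl lam).carrier} [FiniteDimensional k D.NegPart]
    (hx : x ∈ (D.weyl lam).gr lam) : ∃ c : k, x = c • D.weylVec lam := by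
  obtain ⟨e⟩ := D.weyl_iso_verma lam
  have he : ∀ y ∈ (D.verma lam).gr lam, ∃ c : k, y = c • D.vermaMk lam 1 := by
    intro y hy
    obtain ⟨z, hz, rfl⟩ := (D.mem_verma_gr lam).1 hy
    rw [sub_self] at hz
    obtain ⟨c, rfl⟩ := homog_alpha_zero hz
    exact ⟨c, map_smul _ _ _⟩
  obtain ⟨c, hc⟩ := he _ ((e.mem_gr lam x).1 hx)
  obtain ⟨d, hd⟩ := he _ ((e.mem_gr lam _).1 (D.isHighest_weylVec lam).mem)
  have hd0 : d ≠ 0 := by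
    rintro rfl
    rw [zero_smul] at hd
    exact D.weylVec_ne_zero lam (e.toEquiv.injective (hd.trans (map_zero _).symm))
  refine ⟨c * d⁻¹, e.toEquiv.injective ?_⟩
  refine Eq.trans ?_ (map_smul (e.toEquiv.restrictScalars k) _ _).symm
  refine hc.trans ?_
  change _ = (c * d⁻¹) • e.toEquiv (D.weylVec lam)
  rw [hd, smul_smul, mul_assoc, inv_mul_cancel₀ hd0, mul_one]

/-- The weights of the Weyl module. -/
theorem weyl_gr_le [FiniteDimensional k D.NegPart] {μ : Lat θ} {x : (D.weyl lam).carrier}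
    (hx : x ∈ (D.weyl lam).gr μ) (hx0 : x ≠ 0) : μ ≤ lam := by
  obtain ⟨e⟩ := D.weyl_iso_verma lam
  by_contra h
  obtain ⟨z, hz, hzx⟩ := (D.mem_verma_gr lam).1 ((e.mem_gr μ x).1 hx)
  rw [homog_alpha_eq_bot (by rwa [sub_nonneg]), Submodule.mem_bot] at hz
  rw [hz, map_zero] at hzx
  exact hx0 (e.toEquiv.injective (hzx.symm.trans (map_zero _).symm))

end Datum

/-! ### Heads of graded modules. -/

namespace GrMod

variable {k : Type u} [Field k] {θ : ℕ} {A : Type v} [Ring A] [Algebra k A]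
  (M : GrMod.{u, v, w} k A θ)

/-- The projection to the head. -/
def headMk : M.carrier →ₗ[A] M.head.carrier := M.radical.mkQ

theorem headMk_surjective : Function.Surjective M.headMk := Submodule.mkQ_surjective _

theorem headMk_eq_zero {x : M.carrier} : M.headMk x = 0 ↔ x ∈ M.radical :=
  Submodule.Quotient.mk_eq_zero _

theorem mem_head_gr {μ : Lat θ} {y : M.head.carrier} :
    y ∈ M.head.gr μ ↔ ∃ x ∈ M.gr μ, M.headMk x = y := Iff.rfl

variable {M} in
theorem isInternal_head (h : DirectSum.IsInternal M.gr) (hR : M.IsGradedSub M.radical) :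
    DirectSum.IsInternal M.head.gr :=
  isInternal_map_of_surjective h (M.headMk.restrictScalars k) M.headMk_surjective fun μ x hx =>
    M.headMk_eq_zero.2 ((isGradedSub_iff h _).1 hR x (M.headMk_eq_zero.1 hx) μ)

theorem finite_head [FiniteDimensional k M.carrier] : FiniteDimensional k M.head.carrier :=
  Module.Finite.of_surjective (M.headMk.restrictScalars k) M.headMk_surjective

end GrMod

namespace Datum

variable {k : Type u} [Field k] {Γ : Type v} [CommGroup Γ] {θ : ℕ}

/-! ### The simple quotients of the Weyl modules -/

section Head

variable {D : Datum k Γ θ} {M : GrMod.{u, max u v, w} k D.U θ}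

theorem isObj_head (hM : D.IsObj M) (hR : M.IsGradedSub M.radical) : D.IsObj M.head := by
  have := hM.finite
  refine ⟨M.finite_head, GrMod.isInternal_head hM.internal hR, ?_, ?_, ?_⟩
  · intro γ lam y hy
    obtain ⟨x, hx, rfl⟩ := M.mem_head_gr.1 hy
    rw [← map_smul, hM.g_smul γ lam x hx]
    exact map_smul (M.headMk.restrictScalars k) _ _
  · intro i lam y hy
    obtain ⟨x, hx, rfl⟩ := M.mem_head_gr.1 hy
    rw [← map_smul]
    exact M.mem_head_gr.2 ⟨_, hM.v_smul i lam x hx, rfl⟩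
  · intro i lam y hy
    obtain ⟨x, hx, rfl⟩ := M.mem_head_gr.1 hy
    rw [← map_smul]
    exact M.mem_head_gr.2 ⟨_, hM.w_smul i lam x hx, rfl⟩

end Head

variable (D : Datum k Γ θ) (lam : Lat θ)

theorem eq_top_of_weylVec_mem {N : Submodule D.U (D.weyl lam).carrier} (h : D.weylVec lam ∈ N) :
    N = ⊤ := by
  rw [eq_top_iff]
  intro x _
  obtain ⟨u, rfl⟩ := D.weyl_exists_smul lam x
  exact N.smul_mem u h

variable [FiniteDimensional k D.NegPart]

/-- The component of weight `lam` is the line of the generator, so a graded submodule meeting it is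
everything. -/
theorem gproj_of_mem_proper {N : Submodule D.U (D.weyl lam).carrier}
    (hN : (D.weyl lam).IsGradedSub N) (hne : N ≠ ⊤) {x : (D.weyl lam).carrier} (hx : x ∈ N) :
    gproj (D.isObj_weyl lam).internal lam x = 0 := by
  have h1 := (GrMod.isGradedSub_iff (D.isObj_weyl lam).internal N).1 hN x hx lam
  obtain ⟨c, hc⟩ := D.weyl_gr_top lam (gproj_mem (D.isObj_weyl lam).internal lam x)
  by_cases h0 : c = 0
  · rw [hc, h0, zero_smul]
  · refine absurd (D.eq_top_of_weylVec_mem lam ?_) hne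
    have h2 := (N.restrictScalars k).smul_mem c⁻¹ h1
    rwa [hc, smul_smul, inv_mul_cancel₀ h0, one_smul] at h2

/-- The greatest proper graded submodule of the Weyl module. -/
theorem weyl_exists_greatest : ∃ R : Submodule D.U (D.weyl lam).carrier,
    (D.weyl lam).IsGradedSub R ∧ R ≠ ⊤ ∧ ∀ N, (D.weyl lam).IsGradedSub N → N ≠ ⊤ → N ≤ R := by
  have hI := (D.isObj_weyl lam).internal
  refine ⟨sSup {N | (D.weyl lam).IsGradedSub N ∧ N ≠ ⊤},
    GrMod.IsGradedSub.sSup hI fun N hN => hN.1, fun h => ?_, fun N h1 h2 => le_sSup ⟨h1, h2⟩⟩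
  -- Having no component of weight `lam` is a linear condition, so it passes to the sum of all
  -- proper graded submodules, which is therefore proper.
  have h1 : ∀ x ∈ sSup {N | (D.weyl lam).IsGradedSub N ∧ N ≠ ⊤}, gproj hI lam x = 0 := by
    intro x hx
    rw [sSup_eq_iSup'] at hx
    induction hx using Submodule.iSup_induction' with
    | mem N x hx => exact D.gproj_of_mem_proper lam N.2.1 N.2.2 hx
    | zero => simp
    | add x y _ _ hx hy => rw [map_add, hx, hy, add_zero]
  have h2 := h1 (D.weylVec lam) (by rw [h]; exact Submodule.mem_top)
  rw [gproj_of_mem hI (D.isHighest_weylVec lam).mem] at h2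
  exact D.weylVec_ne_zero lam h2

/-- The greatest proper graded submodule is the only maximal one, so the intersection defining the
radical has a single member. -/
theorem weyl_radical : (D.weyl lam).IsGradedSub (D.weyl lam).radical ∧ (D.weyl lam).radical ≠ ⊤ ∧
    ∀ N, (D.weyl lam).IsGradedSub N → N ≠ ⊤ → N ≤ (D.weyl lam).radical := by
  obtain ⟨R, h1, h2, h3⟩ := D.weyl_exists_greatest lam
  have h4 : {N | (D.weyl lam).IsMaximalSub N} = {R} := by
    ext N
    refine ⟨fun hN => ?_, fun hN => ?_⟩
    · exact le_antisymm (h3 N hN.1.1 hN.1.2) (hN.2 ⟨h1, h2⟩ (h3 N hN.1.1 hN.1.2))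
    · rw [Set.mem_singleton_iff] at hN
      subst hN
      exact ⟨⟨h1, h2⟩, fun N' hN' _ => h3 N' hN'.1 hN'.2⟩
  have h5 : (D.weyl lam).radical = R := by rw [GrMod.radical, h4, sInf_singleton]
  rw [h5]
  exact ⟨h1, h2, h3⟩

theorem isObj_E : D.IsObj (D.E lam) := isObj_head (D.isObj_weyl lam) (D.weyl_radical lam).1

omit [FiniteDimensional k D.NegPart] in
/-- The projection from the Weyl module to its head. -/
noncomputable def toE : (D.weyl lam).carrier →ₗ[D.U] (D.E lam).carrier := (D.weyl lam).headMk

omit [FiniteDimensional k D.NegPart] in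
theorem toE_surjective : Function.Surjective (D.toE lam) := (D.weyl lam).headMk_surjective

omit [FiniteDimensional k D.NegPart] in
theorem toE_eq_zero {x : (D.weyl lam).carrier} : D.toE lam x = 0 ↔ x ∈ (D.weyl lam).radical :=
  (D.weyl lam).headMk_eq_zero

omit [FiniteDimensional k D.NegPart] in
theorem mem_E_gr {μ : Lat θ} {y : (D.E lam).carrier} :
    y ∈ (D.E lam).gr μ ↔ ∃ x ∈ (D.weyl lam).gr μ, D.toE lam x = y :=
  (D.weyl lam).mem_head_gr

theorem toE_weylVec_ne_zero : D.toE lam (D.weylVec lam) ≠ 0 := by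
  rw [Ne, toE_eq_zero]
  exact fun h => (D.weyl_radical lam).2.1 (D.eq_top_of_weylVec_mem lam h)

omit [FiniteDimensional k D.NegPart] in
theorem isHighest_toE : IsHighest (D.E lam) lam (D.toE lam (D.weylVec lam)) where
  mem := ⟨_, (D.isHighest_weylVec lam).mem, rfl⟩
  g_smul γ := by
    rw [← map_smul, (D.isHighest_weylVec lam).g_smul]
    rfl
  v_smul i := by rw [← map_smul, (D.isHighest_weylVec lam).v_smul, map_zero]

theorem isSimpleObj_E : D.IsSimpleObj (D.E lam) where
  isObj := D.isObj_E lam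
  nontrivial := ⟨_, 0, D.toE_weylVec_ne_zero lam⟩
  eq_bot_or_eq_top N hN := by
    have h1 := hN.comap (D.isObj_weyl lam).internal (D.isObj_E lam).internal (D.toE lam)
      fun μ m hm => ⟨m, hm, rfl⟩
    by_cases h : N.comap (D.toE lam) = ⊤
    · right
      rw [eq_top_iff]
      intro y _
      obtain ⟨x, rfl⟩ := D.toE_surjective lam y
      exact (h ▸ Submodule.mem_top : x ∈ N.comap (D.toE lam))
    · left
      rw [eq_bot_iff]
      intro y hy
      obtain ⟨x, rfl⟩ := D.toE_surjective lam y
      exact (D.toE_eq_zero lam).2 ((D.weyl_radical lam).2.2 _ h1 h hy)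

theorem E_gr_le {μ : Lat θ} {y : (D.E lam).carrier} (hy : y ∈ (D.E lam).gr μ) (h0 : y ≠ 0) :
    μ ≤ lam := by
  obtain ⟨x, hx, rfl⟩ := (D.mem_E_gr lam).1 hy
  refine D.weyl_gr_le lam hx ?_
  rintro rfl
  exact h0 (map_zero _)

/-! ### Classification of the simple objects. -/

section Classify

variable {D lam} {S : GrMod.{u, max u v, w} k D.U θ}

/-- A simple object with a highest weight vector of weight `lam` is isomorphic to `E(lam)`. -/
theorem IsSimpleObj.iso_E (hS : D.IsSimpleObj S) {m : S.carrier} (h0 : m ≠ 0)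
    (hm : m ∈ S.gr lam) (hv : ∀ i, D.gen (.v i) • m = 0) : Nonempty (S.Iso (D.E lam)) := by
  have h := hS.isObj.isHighest hm hv
  have hW := (D.isObj_weyl lam).internal
  have hgr := weylDesc_mem_gr hS.isObj h
  have hvec : weylDesc h (D.weylVec lam) = m := by
    have := weylDesc_smul_vec h 1
    rwa [one_smul, one_smul] at this
  have hsurj : Function.Surjective (weylDesc h) := by
    rw [← LinearMap.range_eq_top, ← Submodule.map_top]
    refine (hS.eq_bot_or_eq_top _ (GrMod.IsGradedSub.map hW hS.isObj.internal _ hgr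
      (P := ⊤) ?_)).resolve_left fun e => ?_
    · rw [GrMod.isGradedSub_iff hW]
      exact fun _ _ _ => Submodule.mem_top
    · have : m ∈ Submodule.map (weylDesc h) ⊤ := ⟨_, Submodule.mem_top, hvec⟩
      rw [e] at this
      exact h0 this
  have hker : LinearMap.ker (weylDesc h) ≤ (D.weyl lam).radical := by
    refine (D.weyl_radical lam).2.2 _ ((GrMod.IsGradedSub.bot S).comap hW hS.isObj.internal _
      hgr) fun e => h0 ?_
    rw [← hvec, ← LinearMap.mem_ker, e]
    exact Submodule.mem_top
  -- The image of the radical is `⊥` or `⊤`. If it were `⊤`, the generator would differ from some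
  -- `r` in the radical by an element of the kernel, hence of the radical, and the radical would be
  -- everything.
  have hrad : (D.weyl lam).radical ≤ LinearMap.ker (weylDesc h) := by
    rw [LinearMap.le_ker_iff_map]
    refine (hS.eq_bot_or_eq_top _ ((D.weyl_radical lam).1.map hW hS.isObj.internal _
      hgr)).resolve_right fun e => (D.weyl_radical lam).2.1 ?_
    obtain ⟨r, hr, hrm⟩ : m ∈ (D.weyl lam).radical.map (weylDesc h) := e ▸ Submodule.mem_top
    refine D.eq_top_of_weylVec_mem lam ?_
    have h1 : D.weylVec lam - r ∈ LinearMap.ker (weylDesc h) := by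
      rw [LinearMap.mem_ker, map_sub, hvec, hrm, sub_self]
    rw [← sub_add_cancel (D.weylVec lam) r]
    exact add_mem (hker h1) hr
  let f : (D.E lam).carrier →ₗ[D.U] S.carrier := (D.weyl lam).radical.liftQ (weylDesc h) hrad
  have hf : ∀ x, f (D.toE lam x) = weylDesc h x := fun _ => rfl
  obtain ⟨e⟩ : Nonempty ((D.E lam).Iso S) := by
    refine GrMod.nonempty_iso_of_bijective (D.isObj_E lam).internal hS.isObj.internal f ?_ ⟨?_, ?_⟩
    · rintro μ _ ⟨x, hx, rfl⟩
      exact hgr μ x hx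
    · rw [injective_iff_map_eq_zero]
      intro y hy
      obtain ⟨x, rfl⟩ := D.toE_surjective lam y
      rw [hf] at hy
      exact (D.toE_eq_zero lam).2 (hker hy)
    · intro y
      obtain ⟨x, rfl⟩ := hsurj y
      exact ⟨_, hf x⟩
  exact ⟨e.symm⟩

omit [FiniteDimensional k D.NegPart] in
-- A finite dimensional object has finitely many weights. At a maximal one every vector is killed by
-- the `vᵢ`, which would raise the weight.
theorem IsSimpleObj.exists_highest (hS : D.IsSimpleObj S) :
    ∃ lam, ∃ m ∈ S.gr lam, m ≠ 0 ∧ ∀ i, D.gen (.v i) • m = 0 := by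
  have := hS.isObj.finite
  have := hS.nontrivial
  have hfin : {μ | S.gr μ ≠ ⊥}.Finite :=
    WellFoundedGT.finite_ne_bot_of_iSupIndep hS.isObj.internal.submodule_iSupIndep
  have hne : {μ | S.gr μ ≠ ⊥}.Nonempty := by
    by_contra h
    rw [Set.not_nonempty_iff_eq_empty, Set.eq_empty_iff_forall_notMem] at h
    have h1 := hS.isObj.internal.submodule_iSup_eq_top
    have h2 : ∀ μ, S.gr μ = ⊥ := fun μ => not_not.1 (h μ)
    rw [funext h2, iSup_bot] at h1
    exact bot_ne_top h1
  obtain ⟨lam, hlam⟩ := hfin.exists_maximal hne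
  obtain ⟨m, hm, h0⟩ := Submodule.exists_mem_ne_zero_of_ne_bot hlam.1
  refine ⟨lam, m, hm, h0, fun i => ?_⟩
  by_contra hv
  have h1 : S.gr (lam + alpha i) ≠ ⊥ := fun e => hv (by
    have := hS.isObj.v_smul i lam m hm
    rwa [e, Submodule.mem_bot] at this)
  have h2 := hlam.2 h1 (le_add_of_nonneg_right (Pi.single_nonneg.2 zero_le_one)) i
  simp [alpha] at h2

theorem IsSimpleObj.exists_iso_E (hS : D.IsSimpleObj S) : ∃ lam, Nonempty (S.Iso (D.E lam)) := by
  obtain ⟨lam, m, hm, h0, hv⟩ := hS.exists_highest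
  exact ⟨lam, hS.iso_E h0 hm hv⟩

theorem E_le_of_iso {mu : Lat θ} (e : (D.E lam).Iso (D.E mu)) : lam ≤ mu :=
  D.E_gr_le mu ((e.mem_gr _ _).1 (D.isHighest_toE lam).mem) fun h =>
    D.toE_weylVec_ne_zero lam (e.toEquiv.injective (h.trans (map_zero _).symm))

theorem E_injective {mu : Lat θ} (h : Nonempty ((D.E lam).Iso (D.E mu))) : lam = mu := by
  obtain ⟨e⟩ := h
  exact le_antisymm (E_le_of_iso e) (E_le_of_iso e.symm)

end Classify

end Datum

namespace Datum

variable {k : Type u} [Field k] {Γ : Type v} [CommGroup Γ] {θ : ℕ} {D : Datum k Γ θ}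

/-! ### One-dimensional objects and tensor products -/

section Shift

/-- The graded module obtained from `M` by adding `mu` to all degrees. -/
def shift (M : GrMod.{u, max u v, w} k D.U θ) (mu : Lat θ) : GrMod.{u, max u v, w} k D.U θ where
  carrier := M.carrier
  gr nu := M.gr (nu - mu)

variable {M : GrMod.{u, max u v, w} k D.U θ} {mu : Lat θ}

/-- The action of `Γ` on a component is prescribed by its degree, so shifting by `mu` without
changing the action is allowed when `mu` pairs trivially with `Γ`. -/
theorem isObj_shift (hM : D.IsObj M) (hmu : mu ∈ D.perp) : D.IsObj (shift M mu) where
  finite := hM.finite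
  internal := by
    refine isInternal_of_proj (gr := (shift M mu).gr) ?_
      (fun nu => gproj (gr := M.gr) hM.internal (nu - mu)) ?_ ?_
    · refine Eq.trans ?_ hM.internal.submodule_iSup_eq_top
      exact (Equiv.subRight mu).iSup_comp (g := M.gr)
    · exact fun nu m hm => gproj_of_mem hM.internal hm
    · exact fun nu nu' hne m hm => gproj_of_mem_ne hM.internal hm (by simpa using hne)
  g_smul γ lam m hm := by
    have h1 := hM.g_smul γ (lam - mu) m hm
    rw [form_sub, hmu γ, inv_one, mul_one] at h1
    exact h1
  v_smul i lam m hm := by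
    have h1 := hM.v_smul i (lam - mu) m hm
    rw [sub_add_eq_add_sub] at h1
    exact h1
  w_smul i lam m hm := by
    have h1 := hM.w_smul i (lam - mu) m hm
    rw [sub_right_comm] at h1
    exact h1

theorem isSimpleObj_shift (hM : D.IsSimpleObj M) (hmu : mu ∈ D.perp) :
    D.IsSimpleObj (shift M mu) where
  isObj := isObj_shift hM.isObj hmu
  nontrivial := hM.nontrivial
  eq_bot_or_eq_top N hN := by
    refine hM.eq_bot_or_eq_top N ?_
    intro x hx
    rw [← (Equiv.subRight mu).iSup_comp]
    exact hN hx

end Shift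

/-! ### Tensor products with a one-dimensional object. -/

section Tensor

variable (M : GrMod.{u, max u v, w} k D.U θ) (N : GrMod.{u, max u v, w'} k D.U θ)

theorem comul_gen (x : Gen θ Γ) : D.comul (D.gen x) = D.comulGen x := by
  rw [comul, gen, mkU, RingQuot.liftAlgHom_mkAlgHom_apply, FreeAlgebra.lift_ι_apply]

theorem tensor_gen_v (i : Fin θ) (m : M.carrier) (n : N.carrier) :
    D.gen (.v i) • D.tensorMk M N m n = D.tensorMk M N (D.gen (.v i) • m) n +
      D.tensorMk M N (D.gen (.g (D.g i)) • m) (D.gen (.v i) • n) := by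
  rw [tensor_smul_def, tensorAction, AlgHom.comp_apply, AlgHom.comp_apply, comul_gen, comulGen,
    map_add, map_add]
  change _ + _ = (D.gen (.v i) • m) ⊗ₜ n + (D.gen (.g (D.g i)) • m) ⊗ₜ[k] (D.gen (.v i) • n)
  rw [Algebra.TensorProduct.map_tmul, Algebra.TensorProduct.map_tmul, map_one]
  rfl

theorem tensor_gen_w (i : Fin θ) (m : M.carrier) (n : N.carrier) :
    D.gen (.w i) • D.tensorMk M N m n = D.tensorMk M N (D.gen (.w i) • m) n +
      D.tensorMk M N (D.gen (.g (D.g i)) • m) (D.gen (.w i) • n) := by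
  rw [tensor_smul_def, tensorAction, AlgHom.comp_apply, AlgHom.comp_apply, comul_gen, comulGen,
    map_add, map_add]
  change _ + _ = (D.gen (.w i) • m) ⊗ₜ n + (D.gen (.g (D.g i)) • m) ⊗ₜ[k] (D.gen (.w i) • n)
  rw [Algebra.TensorProduct.map_tmul, Algebra.TensorProduct.map_tmul, map_one]
  rfl

theorem tensor_gen_g (γ : Γ) (m : M.carrier) (n : N.carrier) :
    D.gen (.g γ) • D.tensorMk M N m n =
      D.tensorMk M N (D.gen (.g γ) • m) (D.gen (.g γ) • n) := by
  rw [tensor_smul_def, tensorAction, AlgHom.comp_apply, AlgHom.comp_apply, comul_gen, comulGen]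
  rfl

/-- A basis vector of a one-dimensional object on which the `vᵢ`, `wᵢ` act by `0` and `Γ` acts
trivially. -/
structure IsTrivial (L : GrMod.{u, max u v, w} k D.U θ) (mu : Lat θ) (l : L.carrier) : Prop where
  mem : l ∈ L.gr mu
  ne_zero : l ≠ 0
  span : ∀ x, ∃ c : k, c • l = x
  v_smul : ∀ i, D.gen (.v i) • l = 0
  w_smul : ∀ i, D.gen (.w i) • l = 0
  g_smul : ∀ γ, D.gen (.g γ) • l = l

variable {M N} {mu : Lat θ}

/-- The linear equivalence `c ↦ c • l`. -/
noncomputable def IsTrivial.equiv {l : M.carrier} (h : IsTrivial M mu l) : k ≃ₗ[k] M.carrier :=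
  LinearEquiv.ofBijective (LinearMap.toSpanSingleton k M.carrier l)
    ⟨by
      rw [injective_iff_map_eq_zero]
      intro c hc
      rw [LinearMap.toSpanSingleton_apply, smul_eq_zero] at hc
      exact hc.resolve_right h.ne_zero, h.span⟩

theorem smul_of_gen {j : M.carrier →ₗ[k] N.carrier}
    (hj : ∀ x n, j (D.gen x • n) = D.gen x • j n) (u : D.U) (n : M.carrier) :
    j (u • n) = u • j n := by
  induction u using U_induction with
  | h1 => simp
  | hgen x u hu => rw [mul_smul, hj, hu, mul_smul]
  | hadd x y hx hy => rw [add_smul, map_add, hx, hy, add_smul]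
  | hsmul c x hx => rw [smul_assoc, map_smul, hx, smul_assoc]

/-- A linear isomorphism which is compatible with the generators and the gradings. -/
theorem nonempty_iso_of_gen (j : M.carrier ≃ₗ[k] N.carrier)
    (hj : ∀ x n, j (D.gen x • n) = D.gen x • j n) (hgr : ∀ μ, ∀ n ∈ M.gr μ, j n ∈ N.gr μ)
    (hgr' : ∀ μ, N.gr μ ≤ (M.gr μ).map j.toLinearMap) : Nonempty (M.Iso N) := by
  refine ⟨⟨{ j with map_smul' := smul_of_gen (j := j.toLinearMap) hj }, fun μ n => ⟨hgr μ n, ?_⟩⟩⟩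
  intro hn
  obtain ⟨n', hn', e⟩ := hgr' μ hn
  rwa [← j.injective e]

theorem tensor_gr_le {P : Submodule k (D.TensorSpace M N)} {μ : Lat θ}
    (hP : ∀ β, ∀ m ∈ M.gr β, ∀ n ∈ N.gr (μ - β), D.tensorMk M N m n ∈ P) :
    (D.tensor M N).gr μ ≤ P :=
  iSup_le fun β => Submodule.map₂_le.2 fun m hm n hn => hP β m hm n hn

theorem tensorMk_mem_gr {β γ : Lat θ} {m : M.carrier} {n : N.carrier} (hm : m ∈ M.gr β)
    (hn : n ∈ N.gr γ) : D.tensorMk M N m n ∈ (D.tensor M N).gr (β + γ) := by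
  refine le_iSup (fun β' => Submodule.map₂ (D.tensorMk M N) (M.gr β') (N.gr (β + γ - β'))) β
    (Submodule.apply_mem_map₂ _ hm ?_)
  rwa [add_sub_cancel_left]

/-- The map is `n ↦ l ⊗ n`. In `vᵢ ⊗ 1 + gᵢ ⊗ vᵢ` the first term kills `l` and `gᵢ` fixes it, so the
action reaches only the second factor; likewise for `wᵢ` and `Γ`. -/
theorem IsTrivial.shift_iso_left (hM : D.IsObj M) {l : M.carrier} (h : IsTrivial M mu l) :
    Nonempty ((shift N mu).Iso (D.tensor M N)) := by
  let j : N.carrier ≃ₗ[k] (M.carrier ⊗[k] N.carrier) :=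
    (TensorProduct.lid k N.carrier).symm ≪≫ₗ TensorProduct.congr h.equiv (LinearEquiv.refl k _)
  let j' : (shift N mu).carrier ≃ₗ[k] (D.tensor M N).carrier := j
  have hj : ∀ n : N.carrier, j' n = D.tensorMk M N l n := fun n =>
    congrArg (fun y => y ⊗ₜ[k] n) (one_smul k l)
  have hgen : ∀ x (n : N.carrier), D.gen x • D.tensorMk M N l n =
      D.tensorMk M N l (D.gen x • n) := by
    intro x n
    cases x with
    | v i => rw [tensor_gen_v, h.v_smul, h.g_smul, map_zero, LinearMap.zero_apply, zero_add]
    | w i => rw [tensor_gen_w, h.w_smul, h.g_smul, map_zero, LinearMap.zero_apply, zero_add]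
    | g γ => rw [tensor_gen_g, h.g_smul]
  refine nonempty_iso_of_gen j' (fun x n => ?_) (fun μ n hn => ?_) fun μ => ?_
  · rw [hj n]
    exact (hj (D.gen x • n)).trans (hgen x n).symm
  · rw [hj n]
    have := tensorMk_mem_gr h.mem (show n ∈ N.gr (μ - mu) from hn)
    rwa [add_sub_cancel] at this
  · refine tensor_gr_le fun β m hm n hn => ?_
    obtain ⟨c, rfl⟩ := h.span m
    by_cases hβ : mu = β
    · subst hβ
      refine ⟨(c • n : N.carrier), Submodule.smul_mem (N.gr (μ - mu)) c hn, ?_⟩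
      refine (hj (c • n)).trans ?_
      rw [map_smul, map_smul, LinearMap.smul_apply]
    -- The line is concentrated in degree `mu`, so other degrees contribute nothing to the tensor
    -- product.
    · have h0 : c • l = 0 := by
        rw [← gproj_of_mem hM.internal hm, map_smul, gproj_of_mem_ne hM.internal h.mem hβ,
          smul_zero]
      rw [h0, map_zero, LinearMap.zero_apply]
      exact Submodule.zero_mem _

/-- Here the map is `n ↦ n ⊗ l`: the terms `gᵢ ⊗ vᵢ` and `gᵢ ⊗ wᵢ` vanish because `l` is killed, and
`vᵢ ⊗ 1` and `wᵢ ⊗ 1` act on the first factor only. -/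
theorem IsTrivial.shift_iso_right (hM : D.IsObj M) {l : M.carrier} (h : IsTrivial M mu l) :
    Nonempty ((shift N mu).Iso (D.tensor N M)) := by
  let j : N.carrier ≃ₗ[k] (N.carrier ⊗[k] M.carrier) :=
    (TensorProduct.rid k N.carrier).symm ≪≫ₗ TensorProduct.congr (LinearEquiv.refl k _) h.equiv
  let j' : (shift N mu).carrier ≃ₗ[k] (D.tensor N M).carrier := j
  have hj : ∀ n : N.carrier, j' n = D.tensorMk N M n l := fun n =>
    congrArg (fun y => n ⊗ₜ[k] y) (one_smul k l)
  have hgen : ∀ x (n : N.carrier), D.gen x • D.tensorMk N M n l =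
      D.tensorMk N M (D.gen x • n) l := by
    intro x n
    cases x with
    | v i => rw [tensor_gen_v, h.v_smul, map_zero, add_zero]
    | w i => rw [tensor_gen_w, h.w_smul, map_zero, add_zero]
    | g γ => rw [tensor_gen_g, h.g_smul]
  refine nonempty_iso_of_gen j' (fun x n => ?_) (fun μ n hn => ?_) fun μ => ?_
  · rw [hj n]
    exact (hj (D.gen x • n)).trans (hgen x n).symm
  · rw [hj n]
    have := tensorMk_mem_gr (show n ∈ N.gr (μ - mu) from hn) h.mem
    rwa [sub_add_cancel] at this
  · refine tensor_gr_le fun β n hn m hm => ?_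
    obtain ⟨c, rfl⟩ := h.span m
    by_cases hβ : mu = μ - β
    · refine ⟨(c • n : N.carrier), Submodule.smul_mem (N.gr (μ - mu)) c ?_, ?_⟩
      · rwa [hβ, sub_sub_cancel]
      · refine (hj (c • n)).trans ?_
        rw [map_smul, map_smul, LinearMap.smul_apply]
    · have h0 : c • l = 0 := by
        rw [← gproj_of_mem hM.internal hm, map_smul, gproj_of_mem_ne hM.internal h.mem hβ,
          smul_zero]
      rw [h0, map_zero]
      exact Submodule.zero_mem _

end Tensor

/-! ### The simple objects with highest weight in `Γ^⊥`. -/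

section Perp

variable (D) [FiniteDimensional k D.NegPart] {mu : Lat θ}

theorem isTrivial_E (hmu : mu ∈ D.perp) :
    IsTrivial (D.E mu) mu (D.toE mu (D.weylVec mu)) := by
  have h := D.isHighest_toE mu
  have hg : ∀ γ, D.gen (.g γ) • D.toE mu (D.weylVec mu) = D.toE mu (D.weylVec mu) := fun γ => by
    rw [h.g_smul, hmu γ, Units.val_one, one_smul]
  have hw : ∀ i, D.gen (.w i) • D.toE mu (D.weylVec mu) = 0 := by
    intro i
    by_contra h0
    -- Since `Γ` fixes the highest weight vector, `gᵢ² - 1` kills it, so a nonzero `wᵢ m` would be a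
    -- second highest weight vector, of weight `mu - αᵢ`.
    have hiso := (D.isSimpleObj_E mu).iso_E h0 ((D.isObj_E mu).w_smul i mu _ h.mem) fun j => by
      rw [← mul_smul, gen_linking, add_smul, smul_assoc, mul_smul, h.v_smul, smul_zero, smul_zero,
        zero_add]
      split_ifs with hij
      · rw [sub_smul, pow_two, mul_smul, hg, hg, one_smul, sub_self]
      · rw [zero_smul]
    have h1 := congrFun (E_injective hiso) i
    simp [alpha] at h1
    omega
  refine ⟨h.mem, D.toE_weylVec_ne_zero mu, fun x => ?_, h.v_smul, hw, hg⟩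
  obtain ⟨y, rfl⟩ := D.toE_surjective mu x
  obtain ⟨u, rfl⟩ := D.weyl_exists_smul mu y
  rw [map_smul]
  induction u using U_induction with
  | h1 => exact ⟨1, by rw [one_smul, one_smul]⟩
  | hadd a b ha hb =>
    obtain ⟨c, hc⟩ := ha
    obtain ⟨d, hd⟩ := hb
    exact ⟨c + d, by rw [add_smul, hc, hd, add_smul]⟩
  | hsmul c a ha =>
    obtain ⟨d, hd⟩ := ha
    exact ⟨c * d, by rw [mul_smul, hd, smul_assoc]⟩
  | hgen x u hu =>
    obtain ⟨c, hc⟩ := hu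
    rw [mul_smul, ← hc, smul_comm]
    cases x with
    | v i => exact ⟨0, by rw [h.v_smul, smul_zero, zero_smul]⟩
    | w i => exact ⟨0, by rw [hw, smul_zero, zero_smul]⟩
    | g γ => exact ⟨c, by rw [hg]⟩

theorem finrank_E (hmu : mu ∈ D.perp) : Module.finrank k (D.E mu).carrier = 1 := by
  have h := D.isTrivial_E hmu
  rw [← h.equiv.finrank_eq, Module.finrank_self]

theorem shift_E_iso (hmu : mu ∈ D.perp) (lam : Lat θ) :
    Nonempty ((shift (D.E lam) mu).Iso (D.E (lam + mu))) := by
  refine (isSimpleObj_shift (D.isSimpleObj_E lam) hmu).iso_E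
    (m := (D.toE lam (D.weylVec lam) : (D.E lam).carrier)) (D.toE_weylVec_ne_zero lam) ?_
    (D.isHighest_toE lam).v_smul
  change _ ∈ (D.E lam).gr (lam + mu - mu)
  rw [add_sub_cancel_right]
  exact (D.isHighest_toE lam).mem

theorem tensor_E_iso (hmu : mu ∈ D.perp) (lam : Lat θ) :
    Nonempty ((D.tensor (D.E mu) (D.E lam)).Iso (D.E (lam + mu))) ∧
      Nonempty ((D.tensor (D.E lam) (D.E mu)).Iso (D.E (lam + mu))) := by
  have h := D.isTrivial_E hmu
  obtain ⟨e⟩ := D.shift_E_iso hmu lam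
  obtain ⟨e1⟩ := h.shift_iso_left (D.isObj_E mu) (N := D.E lam)
  obtain ⟨e2⟩ := h.shift_iso_right (D.isObj_E mu) (N := D.E lam)
  exact ⟨⟨e1.symm.trans e⟩, ⟨e2.symm.trans e⟩⟩

end Perp

end Datum

section Pro

variable {k : Type u} [Field k] {θ : ℕ} {A : Type v} [Ring A] [Algebra k A]
  {B : Type v} [Ring B] [Algebra k B] (φ : B →ₐ[k] A) (grA : Lat θ → Submodule k A)
  (T : GrMod.{u, v, w} k B θ)

/-! ### Produced modules and socles -/

namespace GrMod

/-- An element of the produced module, as a linear map. -/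
def proEval : (GrMod.pro φ grA T).carrier →ₗ[k] A →ₗ[k] T.carrier :=
  (produced φ T.carrier).subtype

theorem proEval_injective : Function.Injective (proEval φ grA T) := Subtype.coe_injective

theorem proEval_mul (f : (GrMod.pro φ grA T).carrier) (b : B) (x : A) :
    proEval φ grA T f (φ b * x) = b • proEval φ grA T f x := f.2 b x

theorem exists_proEval (h : A →ₗ[k] T.carrier) (hh : ∀ b x, h (φ b * x) = b • h x) :
    ∃ f, proEval φ grA T f = h := ⟨⟨h, hh⟩, rfl⟩

theorem mem_pro_gr {f : (GrMod.pro φ grA T).carrier} {μ : Lat θ} :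
    f ∈ (GrMod.pro φ grA T).gr μ ↔ ∀ β, ∀ x ∈ grA β, proEval φ grA T f x ∈ T.gr (β + μ) := Iff.rfl

/-- An embedding whose image is the socle gives an isomorphism to the socle. -/
theorem nonempty_iso_socle {S : GrMod.{u, v, w} k A θ} {M : GrMod.{u, v, w'} k A θ}
    (f : S.carrier →ₗ[A] M.carrier) (hf : Function.Injective f)
    (hgr : ∀ μ m, m ∈ S.gr μ ↔ f m ∈ M.gr μ) (hr : LinearMap.range f = M.socleSub) :
    Nonempty (S.Iso M.socle) := by
  refine ⟨⟨LinearEquiv.ofBijective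
    (f.codRestrict M.socleSub fun x => hr ▸ LinearMap.mem_range_self f x) ⟨?_, ?_⟩, hgr⟩⟩
  · exact fun x y h => hf (congrArg Subtype.val h)
  · rintro ⟨y, hy⟩
    rw [← hr] at hy
    obtain ⟨x, rfl⟩ := hy
    exact ⟨x, rfl⟩

end GrMod

end Pro

/-! ### Produced modules as spaces of linear forms on `U`. -/

namespace Datum

variable {k : Type u} [Field k] {Γ : Type v} [CommGroup Γ] {θ : ℕ} (D : Datum k Γ θ) (ν : Lat θ)

/-- The module produced from the one-dimensional module of weight `ν`. -/
noncomputable abbrev coind : GrMod.{u, max u v, max u v} k D.U θ :=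
  GrMod.pro D.toU D.grU (D.oneDim ν)

/-- The identification of the one-dimensional module with the field. -/
noncomputable def oneDimEquiv : (D.oneDim ν).carrier ≃ₗ[k] k := LinearEquiv.refl k k

theorem oneDim_mem_gr {μ : Lat θ} {t : (D.oneDim ν).carrier} :
    t ∈ (D.oneDim ν).gr μ ↔ (μ ≠ ν → D.oneDimEquiv ν t = 0) := by
  change (t : k) ∈ (if μ = ν then ⊤ else ⊥ : Submodule k k) ↔ _
  split_ifs with h
  · exact ⟨fun _ h' => absurd h h', fun _ => trivial⟩
  · exact ⟨fun h' _ => h', fun h' => h' h⟩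

/-- An element of the produced module, as a linear form on `U`. -/
noncomputable def coeval : (D.coind ν).carrier →ₗ[k] D.U →ₗ[k] k :=
  LinearMap.compRight k (D.oneDimEquiv ν).toLinearMap ∘ₗ GrMod.proEval D.toU D.grU (D.oneDim ν)

theorem coeval_apply (f : (D.coind ν).carrier) (u : D.U) :
    D.coeval ν f u = D.oneDimEquiv ν (GrMod.proEval D.toU D.grU (D.oneDim ν) f u) := rfl

theorem coeval_injective : Function.Injective (D.coeval ν) := by
  intro f g h
  refine GrMod.proEval_injective D.toU D.grU (D.oneDim ν) (LinearMap.ext fun u => ?_)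
  exact (D.oneDimEquiv ν).injective (congrArg (fun l => l u) h)

theorem coeval_smul (a : D.U) (f : (D.coind ν).carrier) (x : D.U) :
    D.coeval ν (a • f) x = D.coeval ν f (x * a) := rfl

theorem coeval_toU_mul (f : (D.coind ν).carrier) (b : D.Bor) (x : D.U) :
    D.coeval ν f (D.toU b * x) = D.charB ν b * D.coeval ν f x := by
  rw [coeval_apply, GrMod.proEval_mul, bor_smul, map_smul, smul_eq_mul, coeval_apply]

theorem coeval_v_mul (f : (D.coind ν).carrier) (i : Fin θ) (x : D.U) :
    D.coeval ν f (D.gen (.v i) * x) = 0 := by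
  rw [← toU_v, coeval_toU_mul, charB_v, zero_mul]

theorem coeval_g_mul (f : (D.coind ν).carrier) (γ : Γ) (x : D.U) :
    D.coeval ν f (D.gen (.g γ) * x) = D.form γ ν * D.coeval ν f x := by
  rw [← toU_g, coeval_toU_mul, charB_g]

theorem exists_coeval (h : D.U →ₗ[k] k) (hv : ∀ i x, h (D.gen (.v i) * x) = 0)
    (hg : ∀ γ x, h (D.gen (.g γ) * x) = D.form γ ν * h x) : ∃ f, D.coeval ν f = h := by
  have hb : ∀ b x, h (D.toU b * x) = D.charB ν b * h x := by
    intro b x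
    induction b using bor_induction with
    | h1 => rw [map_one, map_one, one_mul, one_mul]
    | hv i b hb => rw [map_mul D.toU, toU_v, mul_assoc, hv, map_mul, charB_v, zero_mul, zero_mul]
    | hg γ b hb => rw [map_mul D.toU, toU_g, mul_assoc, hg, hb, map_mul, charB_g, mul_assoc]
    | hadd a b ha hb => rw [map_add, add_mul, map_add, ha, hb, map_add, add_mul]
    | hsmul c b hb => rw [map_smul, smul_mul_assoc, map_smul, hb, map_smul, smul_mul_assoc]
  obtain ⟨f, hf⟩ := GrMod.exists_proEval D.toU D.grU (D.oneDim ν)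
    ((D.oneDimEquiv ν).symm.toLinearMap ∘ₗ h) fun b x => by
      rw [bor_smul, LinearMap.comp_apply, hb]
      exact map_smul (D.oneDimEquiv ν).symm (D.charB ν b) (h x)
  refine ⟨f, LinearMap.ext fun u => ?_⟩
  rw [coeval_apply, hf]
  rfl

theorem mem_coind_gr {f : (D.coind ν).carrier} {μ : Lat θ} : f ∈ (D.coind ν).gr μ ↔
    ∀ β, ∀ x ∈ D.grU β, β + μ ≠ ν → D.coeval ν f x = 0 :=
  (GrMod.mem_pro_gr D.toU D.grU (D.oneDim ν)).trans
    (forall_congr' fun _ => forall₂_congr fun _ _ => D.oneDim_mem_gr ν)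

/-- Normal ordering with `vᵢ` moved to the right of `T(W)`; what the linking relations leave is of
the form `a gᵢ² + b` with `a`, `b` from `T(W)`. -/
theorem v_mul_wlift (i : Fin θ) (x : FreeAlgebra k (Fin θ)) :
    ∃ a b, D.gen (.v i) * D.wlift x =
      D.wlift (scale (fun j => (D.χ j (D.g i))⁻¹) x) * D.gen (.v i) +
        D.wlift a * D.gen (.g (D.g i)) * D.gen (.g (D.g i)) + D.wlift b := by
  induction x using word_induction with
  | h1 => exact ⟨0, 0, by simp⟩
  | hadd x y hx hy =>
    obtain ⟨a, b, h⟩ := hx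
    obtain ⟨a', b', h'⟩ := hy
    refine ⟨a + a', b + b', ?_⟩
    simp only [map_add, mul_add, add_mul, h, h']
    abel
  | hsmul c x hx =>
    obtain ⟨a, b, h⟩ := hx
    refine ⟨c • a, c • b, ?_⟩
    simp only [map_smul, mul_smul_comm, smul_mul_assoc, h, smul_add]
  | hι j x hx =>
    obtain ⟨a, b, h⟩ := hx
    let c : k := (((D.χ j (D.g i))⁻¹ : kˣ) : k)
    let s : FreeAlgebra k (Fin θ) →ₐ[k] FreeAlgebra k (Fin θ) := scale fun l => (D.χ l (D.g i))⁻¹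
    refine ⟨c • (FreeAlgebra.ι k j * a) + if i = j then s (s x) else 0,
      c • (FreeAlgebra.ι k j * b) - if i = j then x else 0, ?_⟩
    rw [map_mul, wlift_ι, ← mul_assoc, gen_linking, add_mul, smul_mul_assoc, mul_assoc, h, map_mul,
      scale_ι, map_add, map_sub, map_smul, map_smul, map_mul, map_mul, map_mul, map_smul, wlift_ι]
    have h1 : (if i = j then D.gen (.g (D.g i)) ^ 2 - 1 else 0) * D.wlift x =
        D.wlift (if i = j then s (s x) else 0) * D.gen (.g (D.g i)) * D.gen (.g (D.g i)) -
          D.wlift (if i = j then x else 0) := by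
      split_ifs
      · rw [sub_mul, one_mul, pow_two, mul_assoc, gen_g_wlift, ← mul_assoc, gen_g_wlift]
      · simp
    rw [h1]
    simp only [mul_add, add_mul, smul_add, smul_mul_assoc, mul_assoc]
    abel

/-- A form that transforms under `B` on the left is determined by its values on the image of `T(W)`,
as `U` is spanned by products `b x` with `b` from `B` and `x` from `T(W)`. In place of that
factorization, the forms vanishing on `T(W)` are shown to be a `U`-submodule, and `u • f` is
evaluated at `1`. -/
theorem coeval_eq_zero_of_wlift {f : (D.coind ν).carrier}
    (hf : ∀ x, D.coeval ν f (D.wlift x) = 0) (u : D.U) : D.coeval ν f u = 0 := by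
  have hg : ∀ f : (D.coind ν).carrier, (∀ x, D.coeval ν f (D.wlift x) = 0) → ∀ γ x,
      D.coeval ν (D.gen (.g γ) • f) (D.wlift x) = 0 := by
    intro f hf γ x
    have h1 := D.gen_g_wlift γ (scale (fun j => D.χ j γ) x)
    rw [scale_scale, show (fun i => (D.χ i γ)⁻¹) * (fun i => D.χ i γ) = 1 by ext; simp,
      scale_one] at h1
    rw [coeval_smul, ← h1, coeval_g_mul, hf, mul_zero]
  have hv : ∀ f : (D.coind ν).carrier, (∀ x, D.coeval ν f (D.wlift x) = 0) → ∀ i x,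
      D.coeval ν (D.gen (.v i) • f) (D.wlift x) = 0 := by
    intro f hf i x
    -- Normal ordering is applied to a rescaled `x`, so that the leading term is exactly `x vᵢ`; the
    -- left side vanishes under `f` because it starts with `vᵢ`.
    obtain ⟨a, b, h1⟩ := D.v_mul_wlift i (scale (fun j => D.χ j (D.g i)) x)
    rw [scale_scale, show (fun j => (D.χ j (D.g i))⁻¹) * (fun j => D.χ j (D.g i)) = 1 by ext; simp,
      scale_one] at h1
    have h2 := congrArg (D.coeval ν f) h1
    rw [coeval_v_mul, map_add, map_add, hf, add_zero, ← coeval_smul, ← coeval_smul,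
      ← coeval_smul, hg _ (hg f hf _), add_zero] at h2
    exact h2.symm
  have hu : ∀ x, D.coeval ν (u • f) (D.wlift x) = 0 := by
    induction u using U_induction with
    | h1 => rwa [one_smul]
    | hadd a b ha hb =>
      intro x
      rw [add_smul, map_add, LinearMap.add_apply, ha, hb, add_zero]
    | hsmul c a ha =>
      intro x
      rw [smul_assoc, map_smul, LinearMap.smul_apply, ha, smul_zero]
    | hgen x u hu =>
      intro y
      rw [mul_smul]
      cases x with
      | v i => exact hv _ hu i y
      | g γ => exact hg _ hu γ y
      | w i =>
        rw [coeval_smul, ← wlift_ι, ← map_mul]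
        exact hu _
  have h1 := hu 1
  rwa [map_one, coeval_smul, one_mul] at h1

theorem coind_ext {f g : (D.coind ν).carrier}
    (h : ∀ β, ∀ x ∈ homog k alpha β, D.coeval ν f (D.wlift x) = D.coeval ν g (D.wlift x)) :
    f = g := by
  rw [← sub_eq_zero]
  refine D.coeval_injective ν (LinearMap.ext fun u => ?_)
  rw [map_zero, LinearMap.zero_apply]
  refine D.coeval_eq_zero_of_wlift ν (fun x => ?_) u
  induction x using gr_induction (isInternal_homog (k := k) (alpha (θ := θ))).submodule_iSup_eq_top
    with
  | h0 => rw [map_zero, map_zero]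
  | hadd a b ha hb => rw [map_add, map_add, ha, hb, add_zero]
  | hgr β x hx => rw [map_sub, LinearMap.sub_apply, h β x hx, sub_self]

theorem gen_g_mul_of_mem (γ : Γ) {β : Lat θ} {u : D.U} (hu : u ∈ D.grU β) :
    D.gen (.g γ) * u = (D.form γ β : k) • (u * D.gen (.g γ)) := by
  refine grU_induction (LinearMap.eqLocus (LinearMap.mulLeft k (D.gen (.g γ)))
    ((D.form γ β : k) • LinearMap.mulRight k (D.gen (.g γ)))) (fun l hl => ?_) hu
  subst hl
  change D.gen (.g γ) * _ = (D.form γ _ : k) • (_ * D.gen (.g γ))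
  clear hu
  induction l with
  | nil => simp
  | cons x l ih =>
    have hx : D.gen (.g γ) * D.gen x =
        (D.form γ (genDeg x) : k) • (D.gen x * D.gen (.g γ)) := by
      cases x with
      | v i => rw [genDeg, form_alpha, gen_g_v]
      | w i => rw [genDeg, form_neg, form_alpha, gen_g_w]
      | g γ' => rw [genDeg, form_zero, ← gen_g_mul, mul_comm, gen_g_mul, Units.val_one, one_smul]
    rw [List.map_cons, List.prod_cons, List.map_cons, List.sum_cons, ← mul_assoc, hx,
      smul_mul_assoc, mul_assoc, ih, mul_smul_comm, smul_smul, form_add, Units.val_mul, mul_assoc]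

/-- The homogeneous components of an element of the produced module. -/
theorem exists_coeval_gproj (f : (D.coind ν).carrier) (σ : Lat θ) :
    ∃ g ∈ (D.coind ν).gr (ν - σ),
      ∀ u, D.coeval ν g u = D.coeval ν f (gproj D.isInternal_grU σ u) := by
  have hcomm : ∀ x β u, gproj D.isInternal_grU (genDeg x + β) (D.gen x * u) =
      D.gen x * gproj D.isInternal_grU β u := by
    intro x β u
    induction u using gr_induction D.isInternal_grU.submodule_iSup_eq_top with
    | h0 => rw [mul_zero, map_zero, map_zero, mul_zero]
    | hadd a b ha hb => rw [mul_add, map_add, map_add, ha, hb, mul_add]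
    | hgr β' u hu =>
      have h1 := mul_mem_grU (D.gen_mem_grU x) hu
      by_cases h : β' = β
      · subst h
        rw [gproj_of_mem _ hu, gproj_of_mem _ h1]
      · rw [gproj_of_mem_ne _ hu h, gproj_of_mem_ne _ h1 (by simpa using h), mul_zero]
  obtain ⟨g, hg⟩ := D.exists_coeval ν (D.coeval ν f ∘ₗ gproj D.isInternal_grU σ)
    (fun i x => by
      have := hcomm (.v i) (σ - genDeg (Gen.v i : Gen θ Γ)) x
      rw [add_sub_cancel] at this
      rw [LinearMap.comp_apply, this, coeval_v_mul])
    (fun γ x => by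
      have := hcomm (.g γ) σ x
      rw [genDeg, zero_add] at this
      rw [LinearMap.comp_apply, this, coeval_g_mul, LinearMap.comp_apply])
  refine ⟨g, (D.mem_coind_gr ν).2 fun β x hx hne => ?_, fun u => by rw [hg, LinearMap.comp_apply]⟩
  rw [hg, LinearMap.comp_apply, gproj_of_mem_ne _ hx, map_zero]
  rintro rfl
  exact hne (add_sub_cancel _ _)

/-! ### Finiteness and weight decomposition of produced modules. -/

section Finite

variable [FiniteDimensional k D.NegPart]

/-- Restriction to `T(W)` is injective on the produced module and lands in the forms vanishing on
`J(W)`, that is in the dual of `B(W)`. -/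
theorem finite_coind : FiniteDimensional k (D.coind ν).carrier := by
  let R : (D.coind ν).carrier →ₗ[k] Module.Dual k (FreeAlgebra k (Fin θ)) :=
    LinearMap.lcomp k k D.wlift.toLinearMap ∘ₗ D.coeval ν
  have hR : ∀ f x, R f x = D.coeval ν f (D.wlift x) := fun _ _ => rfl
  have hle : ∀ f, R f ∈ LinearMap.range (nicholsIdeal D.q⁻¹).mkQ.dualMap := fun f =>
    ⟨(nicholsIdeal D.q⁻¹).liftQ (R f) fun x hx => by
      rw [LinearMap.mem_ker, hR, D.wlift_of_mem hx, map_zero], LinearMap.ext fun x => rfl⟩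
  refine Module.Finite.of_injective (R.codRestrict _ hle) fun f g h => D.coind_ext ν fun β x _ => ?_
  exact congrArg (fun l => l.1 x) h

theorem isObj_coind : D.IsObj (D.coind ν) where
  finite := D.finite_coind ν
  internal := by
    refine isInternal_of_ker ?_
      (fun μ => LinearMap.lcomp k k (gproj D.isInternal_grU (ν - μ)) ∘ₗ D.coeval ν) ?_ ?_
    · rw [eq_top_iff]
      intro f _
      choose p hp hp' using D.exists_coeval_gproj ν f
      -- The weights of the Verma module at `0` are the negatives of the degrees of `B(W)`. Only
      -- these contribute to a form on `T(W)`, so the sum of its components is finite.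
      have hfin : {μ | (D.verma 0).gr μ ≠ ⊥}.Finite := by
        have := (D.isObj_verma 0).finite
        exact WellFoundedGT.finite_ne_bot_of_iSupIndep
          (D.isObj_verma 0).internal.submodule_iSupIndep
      have hf : f = ∑ σ ∈ hfin.toFinset, p σ := by
        refine D.coind_ext ν fun β x hx => ?_
        have hx' := D.wlift_mem_grU hx
        rw [map_sum, LinearMap.sum_apply]
        by_cases h0 : (D.verma 0).gr (-β) = ⊥
        · have h1 : D.vermaMk 0 x ∈ (D.verma 0).gr (-β) :=
            ⟨x, by rwa [zero_sub, neg_neg], rfl⟩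
          rw [h0, Submodule.mem_bot, vermaMk_eq_zero] at h1
          rw [D.wlift_of_mem h1, map_zero]
          simp
        · rw [Finset.sum_eq_single (-β)]
          · rw [hp', gproj_of_mem _ hx']
          · intro σ _ hσ
            rw [hp', gproj_of_mem_ne _ hx' hσ.symm, map_zero]
          · intro h
            exact absurd (hfin.mem_toFinset.2 h0) h
      rw [hf]
      exact Submodule.sum_mem _ fun σ _ => Submodule.mem_iSup_of_mem _ (hp σ)
    · intro μ f hf h0
      refine D.coind_ext ν fun β x hx => ?_
      have hx' := D.wlift_mem_grU hx
      rw [map_zero, LinearMap.zero_apply]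
      by_cases h : -β + μ = ν
      · have h1 := congrArg (fun l => l (D.wlift x)) h0
        change D.coeval ν f (gproj D.isInternal_grU (ν - μ) (D.wlift x)) = 0 at h1
        rwa [← eq_sub_iff_add_eq.2 h, gproj_of_mem _ hx'] at h1
      · exact (D.mem_coind_gr ν).1 hf _ _ hx' h
    · intro μ μ' hne f hf
      refine LinearMap.ext fun u => ?_
      refine (D.mem_coind_gr ν).1 hf _ _ (gproj_mem D.isInternal_grU (ν - μ) u) fun h => hne ?_
      rw [sub_add_eq_add_sub, sub_eq_iff_eq_add] at h
      exact add_left_cancel h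
  g_smul γ μ f hf := by
    refine D.coind_ext ν fun β x hx => ?_
    have hx' := D.wlift_mem_grU hx
    have h1 := D.gen_g_mul_of_mem γ hx'
    rw [coeval_smul, map_smul, LinearMap.smul_apply, smul_eq_mul]
    have h2 := congrArg (D.coeval ν f) h1
    rw [coeval_g_mul, map_smul, smul_eq_mul] at h2
    by_cases h : -β + μ = ν
    · have h3 : D.form γ ν = D.form γ (-β) * D.form γ μ := by rw [← form_add, h]
      rw [h3, Units.val_mul, mul_assoc] at h2
      exact (mul_left_cancel₀ (Units.ne_zero _) h2).symm
    · rw [(D.mem_coind_gr ν).1 hf _ _ hx' h, mul_zero] at h2 ⊢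
      exact (mul_eq_zero.1 h2.symm).resolve_left (Units.ne_zero _)
  v_smul i μ f hf := by
    refine (D.mem_coind_gr ν).2 fun β x hx hne => ?_
    rw [coeval_smul]
    refine (D.mem_coind_gr ν).1 hf _ _ (mul_mem_grU hx (D.gen_mem_grU _)) ?_
    rwa [genDeg, add_right_comm, add_assoc]
  w_smul i μ f hf := by
    refine (D.mem_coind_gr ν).2 fun β x hx hne => ?_
    rw [coeval_smul]
    refine (D.mem_coind_gr ν).1 hf _ _ (mul_mem_grU hx (D.gen_mem_grU _)) ?_
    rwa [genDeg, add_right_comm, add_assoc, ← sub_eq_add_neg]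

end Finite

end Datum

namespace Datum

variable {k : Type u} [Field k] {Γ : Type v} [CommGroup Γ] {θ : ℕ} {D : Datum k Γ θ} {ν : Lat θ}

/-! ### The socle of a produced module -/

/-- A form of degree `ν` is supported in degree `0`, where `T(W)` consists of scalars. Hence this
component is at most a line, detected by evaluation at `1`. -/
theorem coind_eq_zero {f : (D.coind ν).carrier} (hf : f ∈ (D.coind ν).gr ν)
    (h1 : D.coeval ν f 1 = 0) : f = 0 := by
  refine D.coind_ext ν fun β x hx => ?_
  rw [map_zero, LinearMap.zero_apply]
  by_cases h : β = 0
  · subst h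
    obtain ⟨c, rfl⟩ := homog_alpha_zero hx
    rw [map_smul, map_one, map_smul, h1, smul_zero]
  · exact (D.mem_coind_gr ν).1 hf _ _ (D.wlift_mem_grU hx) (by simpa using h)

section Socle

variable [FiniteDimensional k D.NegPart]

/-- If `f u ≠ 0`, then `u • f` has a nonzero value at `1`, and projecting to degree `ν` does not
change this value. -/
theorem exists_mem_of_isGradedSub {N : Submodule D.U (D.coind ν).carrier}
    (hN : (D.coind ν).IsGradedSub N) (h0 : N ≠ ⊥) :
    ∃ f ∈ N, f ∈ (D.coind ν).gr ν ∧ D.coeval ν f 1 = 1 := by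
  have hC := (D.isObj_coind ν).internal
  obtain ⟨f, hf, hf0⟩ := N.exists_mem_ne_zero_of_ne_bot h0
  obtain ⟨u, hu⟩ : ∃ u, D.coeval ν f u ≠ 0 := by
    by_contra! h
    exact hf0 (D.coeval_injective ν (by rw [map_zero]; exact LinearMap.ext h))
  have hproj : ∀ g : (D.coind ν).carrier, D.coeval ν (gproj hC ν g) 1 = D.coeval ν g 1 := by
    intro g
    induction g using gr_induction hC.submodule_iSup_eq_top with
    | h0 => rw [map_zero]
    | hadd a b ha hb => simp only [map_add, LinearMap.add_apply, ha, hb]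
    | hgr μ g hg =>
      by_cases e : μ = ν
      · subst e
        rw [gproj_of_mem hC hg]
      · rw [gproj_of_mem_ne hC hg e, map_zero, LinearMap.zero_apply,
          (D.mem_coind_gr ν).1 hg 0 1 D.one_mem_grU (by rwa [zero_add])]
  have hmem : gproj hC ν (u • f) ∈ N :=
    (GrMod.isGradedSub_iff hC N).1 hN _ (N.smul_mem u hf) ν
  refine ⟨(D.coeval ν f u)⁻¹ • gproj hC ν (u • f), ?_,
    Submodule.smul_mem _ _ (gproj_mem hC ν _), ?_⟩
  · exact (N.restrictScalars k).smul_mem _ hmem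
  · rw [map_smul, LinearMap.smul_apply, hproj, coeval_smul, one_mul, smul_eq_mul,
      inv_mul_cancel₀ hu]

/-- Both submodules contain the unique form of degree `ν` with value `1` at `1`. So there is at most
one simple graded submodule. -/
theorem inf_ne_bot_of_isGradedSub {N N' : Submodule D.U (D.coind ν).carrier}
    (hN : (D.coind ν).IsGradedSub N) (h0 : N ≠ ⊥) (hN' : (D.coind ν).IsGradedSub N')
    (h0' : N' ≠ ⊥) : N ⊓ N' ≠ ⊥ := by
  obtain ⟨f, hf, hfν, hf1⟩ := exists_mem_of_isGradedSub hN h0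
  obtain ⟨f', hf', hfν', hf1'⟩ := exists_mem_of_isGradedSub hN' h0'
  have h : f - f' = 0 := coind_eq_zero (sub_mem hfν hfν') (by
    rw [map_sub, LinearMap.sub_apply, hf1, hf1', sub_self])
  rw [sub_eq_zero] at h
  subst h
  rw [Submodule.ne_bot_iff]
  refine ⟨f, ⟨hf, hf'⟩, ?_⟩
  rintro rfl
  simp at hf1

theorem socleSub_coind {N : Submodule D.U (D.coind ν).carrier}
    (hN : (D.coind ν).IsSimpleSub N) : (D.coind ν).socleSub = N := by
  have hC := (D.isObj_coind ν).internal
  have hle : ∀ N₁ N₂, (D.coind ν).IsSimpleSub N₁ → (D.coind ν).IsSimpleSub N₂ → N₁ ≤ N₂ := by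
    intro N₁ N₂ h₁ h₂
    exact (h₁.2 ⟨h₁.1.1.inf hC h₂.1.1, inf_ne_bot_of_isGradedSub h₁.1.1 h₁.1.2 h₂.1.1 h₂.1.2⟩
      inf_le_left).trans inf_le_right
  exact le_antisymm (sSup_le fun N' hN' => hle _ _ hN' hN) (le_sSup hN)

variable {S : GrMod.{u, max u v, max u v} k D.U θ}

omit [FiniteDimensional k D.NegPart] in
/-- The matrix coefficients of a linear form. -/
theorem exists_matrixCoeff (hS : D.IsObj S) (ℓ : S.carrier →ₗ[k] k)
    (hv : ∀ i m, ℓ (D.gen (.v i) • m) = 0) (hgr : ∀ μ, μ ≠ ν → ∀ m ∈ S.gr μ, ℓ m = 0) :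
    ∃ j : S.carrier →ₗ[D.U] (D.coind ν).carrier, ∀ m u, D.coeval ν (j m) u = ℓ (u • m) := by
  have hg : ∀ γ m, ℓ (D.gen (.g γ) • m) = D.form γ ν * ℓ m := by
    intro γ m
    induction m using gr_induction hS.internal.submodule_iSup_eq_top with
    | h0 => rw [smul_zero, map_zero, mul_zero]
    | hadd a b ha hb => rw [smul_add, map_add, ha, hb, map_add, mul_add]
    | hgr μ m hm =>
      rw [hS.g_smul γ μ m hm, map_smul, smul_eq_mul]
      by_cases h : μ = ν
      · rw [h]
      · rw [hgr μ h m hm, mul_zero, mul_zero]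
  have hex : ∀ m, ∃ f, ∀ u, D.coeval ν f u = ℓ (u • m) := by
    intro m
    obtain ⟨f, hf⟩ := D.exists_coeval ν
      (ℓ ∘ₗ (Algebra.lsmul k k S.carrier : D.U →ₐ[k] Module.End k S.carrier).toLinearMap.flip m)
      (fun i x => (congrArg ℓ (mul_smul _ x m)).trans (hv i _))
      (fun γ x => (congrArg ℓ (mul_smul _ x m)).trans (hg γ _))
    exact ⟨f, fun u => by rw [hf]; rfl⟩
  choose j hj using hex
  refine ⟨{ toFun := j, map_add' := fun a b => ?_, map_smul' := fun u a => ?_ }, hj⟩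
  · refine D.coeval_injective ν (LinearMap.ext fun x => ?_)
    rw [map_add, LinearMap.add_apply, hj, hj, hj, smul_add, map_add]
  · refine D.coeval_injective ν (LinearMap.ext fun x => ?_)
    rw [hj, RingHom.id_apply, coeval_smul, hj, mul_smul]

/-- A simple object with a suitable linear form is the socle of a produced module. -/
theorem IsSimpleObj.nonempty_iso_socle (hS : D.IsSimpleObj S) {ℓ : S.carrier →ₗ[k] k}
    (hℓ : ℓ ≠ 0) (hv : ∀ i m, ℓ (D.gen (.v i) • m) = 0)
    (hgr : ∀ μ, μ ≠ ν → ∀ m ∈ S.gr μ, ℓ m = 0) : Nonempty (S.Iso (D.coind ν).socle) := by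
  obtain ⟨j, hj⟩ := exists_matrixCoeff hS.isObj ℓ hv hgr
  have hSi := hS.isObj.internal
  have hC := (D.isObj_coind ν).internal
  have hjgr : ∀ μ, ∀ m ∈ S.gr μ, j m ∈ (D.coind ν).gr μ := fun μ m hm =>
    (D.mem_coind_gr ν).2 fun β u hu hne => by
      rw [hj]
      exact hgr _ hne _ (hS.isObj.smul_mem hu hm)
  -- The kernel is a graded submodule of a simple object. It is not everything, as evaluating matrix
  -- coefficients at `1` recovers `ℓ ≠ 0`.
  have hinj : Function.Injective j := by
    rw [← LinearMap.ker_eq_bot, ← Submodule.comap_bot]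
    refine (hS.eq_bot_or_eq_top _ ((GrMod.IsGradedSub.bot (D.coind ν)).comap hSi hC j
      hjgr)).resolve_right fun h => hℓ (LinearMap.ext fun m => ?_)
    have h1 : j m = 0 := by
      have h2 : m ∈ Submodule.comap j ⊥ := h ▸ Submodule.mem_top
      exact h2
    have h2 := hj m 1
    rw [h1, map_zero, one_smul, LinearMap.zero_apply] at h2
    exact h2.symm
  have htop : S.IsGradedSub ⊤ := (GrMod.isGradedSub_iff hSi ⊤).2 fun _ _ _ => Submodule.mem_top
  have := hS.nontrivial
  have hsimple : (D.coind ν).IsSimpleSub (LinearMap.range j) := by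
    refine ⟨⟨?_, ?_⟩, fun N hN hle => ?_⟩
    · rw [← Submodule.map_top]
      exact htop.map hSi hC j hjgr
    · obtain ⟨m, hm⟩ := exists_ne (0 : S.carrier)
      rw [Submodule.ne_bot_iff]
      exact ⟨j m, ⟨m, rfl⟩, fun h => hm (hinj (h.trans (map_zero j).symm))⟩
    · have hmap : (N.comap j).map j = N := Submodule.map_comap_eq_self hle
      rcases hS.eq_bot_or_eq_top _ (hN.1.comap hSi hC j hjgr) with h | h
      · rw [h, Submodule.map_bot] at hmap
        exact absurd hmap.symm hN.2
      · rw [h, Submodule.map_top] at hmap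
        exact hmap.le
  refine GrMod.nonempty_iso_socle j hinj (fun μ m => ⟨hjgr μ m, fun h => ?_⟩)
    (socleSub_coind hsimple).symm
  rw [mem_iff_gproj_eq hSi]
  apply hinj
  rw [GrMod.map_gproj' hSi hC j hjgr]
  exact gproj_of_mem hC h

end Socle

/-! ### Lowest weights -/

section Lowest

variable (D) [FiniteDimensional k D.NegPart] [FiniteDimensional k D.opp.NegPart]

/-- Over the opposite datum the `wᵢ` play the part of the `vᵢ` and degrees change sign, so `κ` is
minus the lowest weight of `E(lam)`. -/
theorem exists_pull_iso (lam : Lat θ) :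
    ∃ κ, Nonempty ((pull D.isOpp_opp.symm (D.E lam)).Iso (D.opp.E κ)) :=
  (isSimpleObj_pull D.isOpp_opp.symm (D.isSimpleObj_E lam)).exists_iso_E

/-- The lowest weight of a simple object, given by its highest weight. -/
noncomputable def lowest (lam : Lat θ) : Lat θ := -(D.exists_pull_iso lam).choose

theorem pull_iso_lowest (lam : Lat θ) :
    Nonempty ((pull D.isOpp_opp.symm (D.E lam)).Iso (D.opp.E (-D.lowest lam))) := by
  rw [lowest, neg_neg]
  exact (D.exists_pull_iso lam).choose_spec

theorem lowest_injective : Function.Injective D.lowest := by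
  intro lam mu h
  obtain ⟨e⟩ := D.pull_iso_lowest lam
  obtain ⟨e'⟩ := D.pull_iso_lowest mu
  rw [← h] at e'
  exact E_injective (nonempty_iso_of_pull D.isOpp_opp.symm (e.trans e'.symm))

/-- Pulling back the opposite simple module of highest weight `-ν` gives some `E(lam)`, in which the
old highest weight vector becomes a vector of weight `ν` killed by all `wᵢ`. -/
theorem lowest_surjective : Function.Surjective D.lowest := by
  intro ν
  have h := D.isOpp_opp
  obtain ⟨lam, ⟨e⟩⟩ := (isSimpleObj_pull h (D.opp.isSimpleObj_E (-ν))).exists_iso_E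
  refine ⟨lam, ?_⟩
  have hhigh := D.opp.isHighest_toE (-ν)
  let m : (D.E lam).carrier := e.toEquiv (toPull h (D.opp.E (-ν)) (D.opp.toE (-ν)
    (D.opp.weylVec (-ν))))
  have hm : m ∈ (D.E lam).gr ν := (e.mem_gr _ _).1 ((toPull_mem_gr h _ _ _).2 hhigh.mem)
  have hm0 : m ≠ 0 := by
    intro h0
    refine D.opp.toE_weylVec_ne_zero (-ν) ((toPull h (D.opp.E (-ν))).injective ?_)
    rw [map_zero]
    exact e.toEquiv.injective (h0.trans (map_zero _).symm)
  have hw : ∀ i, D.gen (.w i) • m = 0 := fun i => by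
    rw [← map_smul, smul_toPull, opHom_w, hhigh.v_smul, map_zero, map_zero]
  -- Carrying only this vector through the second pull-back avoids comparing the double pull-back
  -- with the original module.
  obtain ⟨e'⟩ := (isSimpleObj_pull h.symm (D.isSimpleObj_E lam)).iso_E (lam := -ν)
    (m := toPull h.symm (D.E lam) m)
    (fun h0 => hm0 ((toPull h.symm (D.E lam)).injective (h0.trans (map_zero _).symm)))
    ((toPull_mem_gr h.symm _ _ _).2 (by rwa [neg_neg])) fun i => by
      rw [smul_toPull, opHom_v, smul_assoc, hw, smul_zero, map_zero]
  obtain ⟨e''⟩ := D.pull_iso_lowest lam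
  exact (neg_injective (E_injective ⟨e'.symm.trans e''⟩)).symm

/-- The linear form is a coordinate on the lowest weight component. It vanishes on the images of the
`vᵢ`, which raise weights, so its matrix coefficients lie in the module produced from the lowest
weight. -/
theorem E_iso_socle_coind (lam : Lat θ) :
    Nonempty ((D.E lam).Iso (D.coind (D.lowest lam)).socle) := by
  have h := D.isOpp_opp.symm
  obtain ⟨e⟩ := D.pull_iso_lowest lam
  generalize hκ : -D.lowest lam = κ at e
  have hE := D.opp.isObj_E κ
  obtain ⟨ℓ₀, hℓ₀⟩ := Module.Projective.exists_dual_ne_zero k (D.opp.toE_weylVec_ne_zero κ)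
  let a : (D.E lam).carrier ≃ₗ[k] (D.opp.E κ).carrier :=
    toPull h (D.E lam) ≪≫ₗ e.toEquiv.restrictScalars k
  have ha : ∀ i m, a (D.gen (.v i) • m) = D.opp.gen (.w i) • a m := fun i m => by
    rw [← opHom_w h]
    exact e.toEquiv.map_smul (D.opp.gen (.w i)) (toPull h (D.E lam) m)
  refine (D.isSimpleObj_E lam).nonempty_iso_socle
    (ℓ := ℓ₀ ∘ₗ gproj hE.internal κ ∘ₗ a.toLinearMap) ?_ (fun i m => ?_) fun μ hμ m hm => ?_
  · intro h0
    have h1 := congrArg (fun l => l (a.symm (D.opp.toE κ (D.opp.weylVec κ)))) h0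
    simp only [LinearMap.comp_apply, LinearEquiv.coe_coe, LinearEquiv.apply_symm_apply,
      LinearMap.zero_apply, gproj_of_mem hE.internal (D.opp.isHighest_toE κ).mem] at h1
    exact hℓ₀ h1
  · rw [LinearMap.comp_apply, LinearMap.comp_apply, LinearEquiv.coe_coe, ha]
    generalize a m = y
    induction y using gr_induction hE.internal.submodule_iSup_eq_top with
    | h0 => rw [smul_zero, map_zero, map_zero]
    | hadd x y hx hy => rw [smul_add, map_add, map_add, hx, hy, add_zero]
    | hgr μ y hy =>
      -- Seen over the opposite datum: all weights are `≤ κ` and `wᵢ` lowers them, so `wᵢ y` has no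
      -- component of weight `κ`.
      by_cases hy0 : y = 0
      · rw [hy0, smul_zero, map_zero, map_zero]
      · rw [gproj_of_mem_ne hE.internal (hE.w_smul i μ y hy), map_zero]
        rintro rfl
        have h1 := D.opp.E_gr_le _ hy hy0 i
        simp [alpha] at h1
  · have h1 : a m ∈ (D.opp.E κ).gr (-μ) :=
      (e.mem_gr _ _).1 ((toPull_mem_gr h (D.E lam) _ _).2 (by rwa [neg_neg]))
    rw [LinearMap.comp_apply, LinearMap.comp_apply, LinearEquiv.coe_coe,
      gproj_of_mem_ne hE.internal h1, map_zero]
    rintro rfl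
    exact hμ (neg_injective hκ).symm

end Lowest

end Datum

end NicholsQG

theorem mainTheorem4 {k : Type u} [Field k] [IsAlgClosed k] [CharZero k]
    {Γ : Type v} [CommGroup Γ] [Finite Γ] {θ : ℕ} (D : NicholsQG.Datum k Γ θ)
    [FiniteDimensional k (NicholsQG.NicholsAlgebra D.q)] :
    (∀ lam, D.IsObj (D.weyl lam) ∧ D.IsObj (D.dualWeyl lam)) ∧
    (∀ lam, D.IsSimpleObj (D.E lam)) ∧
    (∀ S : NicholsQG.GrMod.{u, max u v, w} k D.U θ, D.IsSimpleObj S →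
      ∃ lam, Nonempty (S.Iso (D.E lam))) ∧
    (∀ lam mu, Nonempty ((D.E lam).Iso (D.E mu)) → lam = mu) ∧
    (∀ mu ∈ D.perp, Module.finrank k (D.E mu).carrier = 1 ∧
      ∀ lam, Nonempty ((D.tensor (D.E mu) (D.E lam)).Iso (D.E (lam + mu))) ∧
        Nonempty ((D.tensor (D.E lam) (D.E mu)).Iso (D.E (lam + mu)))) ∧
    ∃ w₀ : NicholsQG.Lat θ ≃ NicholsQG.Lat θ,
      ∀ lam, Nonempty ((D.E lam).Iso (D.dualWeyl (w₀ lam)).socle) := by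
  have := D.finite_negPart
  have := D.finite_negPart_opp
  refine ⟨fun lam => ⟨D.isObj_weyl lam, D.isObj_coind _⟩, fun lam => D.isSimpleObj_E lam,
    fun S hS => hS.exists_iso_E, fun _ _ h => NicholsQG.Datum.E_injective h,
    fun mu hmu => ⟨D.finrank_E hmu, D.tensor_E_iso hmu⟩,
    -- As `∇(λ)` is produced from weight `λ - ϱ`, the parameter is the lowest weight plus `ϱ`.
    (Equiv.ofBijective D.lowest ⟨D.lowest_injective, D.lowest_surjective⟩).trans
      (Equiv.addRight (NicholsQG.topDegree D.q)), fun lam => ?_⟩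
  have h1 := D.E_iso_socle_coind lam
  have h2 : D.lowest lam = D.lowest lam + NicholsQG.topDegree D.q - NicholsQG.topDegree D.q :=
    (add_sub_cancel_right _ _).symm
  rw [h2] at h1
  exact h1
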